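/- A \emph{stochastic BPA game} $\Delta$ consists of a finite stack alphabet $\Gamma$, a finite set of rules $X \hookrightarrow \alpha$ with $X \in \Gamma$, $\alpha \in \Gamma^*$, $|\alpha| \le 2$, such that every $X\in\Gamma$ has at least one rule, a partition $(\Gamma_\Box, \Gamma_\Diamond, \Gamma_\bigcirc)$ of $\Gamma$, and, for every $X \in \Gamma_\bigcirc$, a rational positive probability distribution on the rules of $X$. It induces a stochastic game $G_\Delta$ whose vertices are the configurations $\alpha \in \Gamma^*$ (the top of the stack is on the left), with the edges $\varepsilon \to \varepsilon$ and $X\beta \to \alpha\beta$ for every rule $X \hookrightarrow \alpha$ and every $\beta\in\Gamma^*$. The edge out of $X\beta$ is chosen by player $\Box$, by player $\Diamond$, or at random according to the given distribution, depending on whether $X$ belongs to $\Gamma_\Box$, $\Gamma_\Diamond$ or $\Gamma_\bigcirc$. Strategies may be history-dependent and randomized; a strategy $\sigma$ of $\Box$, a strategy $\pi$ of $\Diamond$ and an initial configuration $v$ determine the probability $\mathcal P_v^{\sigma,\pi}(\mathrm{Reach}(T))$ of visiting a set $T$ of configurations. A strategy $\tau$ is \emph{regular} if there is a deterministic finite automaton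 over $\Gamma$ such that the distribution on rules chosen by $\tau$ in a configuration $X\alpha$ depends only on the control state entered after reading the reverse of $X\alpha$; it is \emph{SMD} if it is deterministic and its choice in $X\alpha$ depends only on $X$. Let $T = \{X\alpha : X \in \Gamma_T,\ \alpha \in \Gamma^*\}$ for some $\Gamma_T \subseteq \Gamma$. A strategy $\sigma$ of $\Box$ is \emph{$(T,{>}0)$-winning} in $v$ if $\mathcal P_v^{\sigma,\pi}(\mathrm{Reach}(T)) > 0$ for all $\pi$; a strategy $\pi$ of $\Diamond$ is \emph{$(T,{=}0)$-winning} in $v$ if $\mathcal P_v^{\sigma,\pi}(\mathrm{Reach}(T)) = 0$ for all $\sigma$. Let $W_\Box(T,{>}0)$ and $W_\Diamond(T,{=}0)$ be the sets of all configurations in which $\Box$ has a $(T,{>}0)$-winning strategy and in which $\Diamond$ has a $(T,{=}0)$-winning strategy, respectively. \textbf{Theorem.} Let $\Delta$ and $\Gamma_T$ be given in binary encoding. \begin{enumerate} \item Given $\Delta$, $\Gamma_T$ and a configuration $\alpha \in \Gamma^*$, it is decidable in polynomial time whether $\alpha \in W_\Box(T,{>}0)$, and whether $\alpha \in W_\Diamond(T,{=}0)$.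 \item Both sets $W_\Box(T,{>}0)$ and $W_\Diamond(T,{=}0)$ are regular, and deterministic finite automata accepting them can be computed from $\Delta$ and $\Gamma_T$ in polynomial time. \item There is a regular (and deterministic) strategy $\sigma$ of player $\Box$ that is $(T,{>}0)$-winning in every configuration of $W_\Box(T,{>}0)$. A description of $\sigma$, namely a deterministic finite automaton that reads configurations bottom-up together with the right-hand side of the rule to be used for each control state, can be computed from $\Delta$ and $\Gamma_T$ in polynomial time. \item There is an SMD strategy $\pi$ of player $\Diamond$ that is $(T,{=}0)$-winning in every configuration of $W_\Diamond(T,{=}0)$. A description of $\pi$, namely a table assigning to each $X$ the right-hand side of the rule to be used, can be computed from $\Delta$ and $\Gamma_T$ in polynomial time. \end{enumerate} -/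

import Mathlib

open MeasureTheory ProbabilityTheory
open scoped ENNReal

/-! ### Stochastic games with reachability objectives -/

/-- Who moves in a vertex: player `□`, player `◇`, or chance `○`. -/
inductive Owner : Type
  | box
  | diamond
  | random
  deriving DecidableEq

/-- A stochastic game on the vertex set `V`: a total edge relation, a partition of the vertices
into those of `□`, `◇` and `○`, and, for every vertex of `○`, a positive probability distribution
on its outgoing edges (an edge `v → u` out of `v` is given by its endpoint `u`). -/
structure StochasticGame (V : Type) where
  edge : V → V → Prop
  total : ∀ v, ∃ u, edge v u
  owner : V → Owner
  prob : ∀ v, owner v = Owner.random → PMF V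
  prob_support : ∀ v h u, u ∈ (prob v h).support ↔ edge v u

namespace StochasticGame

variable {V : Type} (G : StochasticGame V)

/-- A (history-dependent, randomized) strategy of player `p`: to every `w v ∈ V* V_p` it assigns
a probability distribution on the outgoing edges of `v`. The history `w` is listed in
chronological order. -/
structure Strategy (p : Owner) where
  act : List V → {v : V // G.owner v = p} → PMF V
  act_edge : ∀ w v, ∀ u ∈ (act w v).support, G.edge v u

end StochasticGame

/-- A nonempty word `w u ∈ V⁺`, i.e. a state of a play: the history `w` and the current vertex
`u`. -/
@[ext]
structure PlayState (V : Type) where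
  hist : List V
  cur : V

instance (V : Type) : MeasurableSpace (PlayState V) := ⊤

instance (V : Type) : DiscreteMeasurableSpace (PlayState V) := ⟨fun _ => trivial⟩

/-- The transition kernels of the Markov chain with transition probabilities `step`, seen as
kernels from the first `n + 1` states of a run to its next state. -/
noncomputable def chainKernel {S : Type} [MeasurableSpace S] [DiscreteMeasurableSpace S]
    (step : S → PMF S) (n : ℕ) : Kernel (∀ _ : Finset.Iic n, S) S where
  toFun h := (step (h ⟨n, Finset.mem_Iic.2 le_rfl⟩)).toMeasure
  measurable' :=
    (Measurable.of_discrete (f := fun s : S => (step s).toMeasure)).comp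
      (measurable_pi_apply (⟨n, Finset.mem_Iic.2 le_rfl⟩ : Finset.Iic n))

instance {S : Type} [MeasurableSpace S] [DiscreteMeasurableSpace S] (step : S → PMF S) (n : ℕ) :
    IsMarkovKernel (chainKernel step n) :=
  ⟨fun h => PMF.toMeasure.isProbabilityMeasure (step (h ⟨n, Finset.mem_Iic.2 le_rfl⟩))⟩

/-- The law, on the space of infinite sequences of states, of the Markov chain with transition
probabilities `step` that starts in the state `s`. -/
noncomputable def chainMeasure {S : Type} [MeasurableSpace S] [DiscreteMeasurableSpace S]
    (step : S → PMF S) (s : S) : Measure (ℕ → S) :=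
  Kernel.traj (X := fun _ : ℕ => S) (chainKernel step) 0 (fun _ => s)

namespace StochasticGame

variable {V : Type} (G : StochasticGame V)

/-- The distribution of the next vertex after the history `s` in the play of `σ` and `π`. -/
noncomputable def nextVertex (σ : G.Strategy Owner.box) (π : G.Strategy Owner.diamond)
    (s : PlayState V) : PMF V :=
  match h : G.owner s.cur with
  | Owner.box => σ.act s.hist ⟨s.cur, h⟩
  | Owner.diamond => π.act s.hist ⟨s.cur, h⟩
  | Owner.random => G.prob s.cur h

/-- The play `G(σ, π)`: the Markov chain on `V⁺` that moves from `w u` to `w u u'` with the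
probability of `u'` under the strategy of the owner of `u` or under the chance distribution. -/
noncomputable def playStep (σ : G.Strategy Owner.box) (π : G.Strategy Owner.diamond)
    (s : PlayState V) : PMF (PlayState V) :=
  (G.nextVertex σ π s).map fun u => ⟨s.hist ++ [s.cur], u⟩

/-- The set of all runs of a play that visit `T`. -/
def Reach (T : Set V) : Set (ℕ → PlayState V) :=
  {ω | ∃ i, (ω i).cur ∈ T}

/-- The probability `P_v^{σ,π}(Reach(T))`. -/
noncomputable def reachProb (T : Set V) (σ : G.Strategy Owner.box) (π : G.Strategy Owner.diamond)
    (v : V) : ℝ≥0∞ :=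
  chainMeasure (G.playStep σ π) ⟨[], v⟩ (Reach T)

variable {G}

/-- `σ` is `(T, >0)`-winning in `v`. -/
def WinningPos (T : Set V) (σ : G.Strategy Owner.box) (v : V) : Prop :=
  ∀ π : G.Strategy Owner.diamond, 0 < G.reachProb T σ π v

/-- `π` is `(T, =0)`-winning in `v`. -/
def WinningZero (T : Set V) (π : G.Strategy Owner.diamond) (v : V) : Prop :=
  ∀ σ : G.Strategy Owner.box, G.reachProb T σ π v = 0

variable (G)

/-- The `(T, >0)`-winning region of player `□`. -/
def regionPos (T : Set V) : Set V :=
  {v | ∃ σ : G.Strategy Owner.box, WinningPos T σ v}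

/-- The `(T, =0)`-winning region of player `◇`. -/
def regionZero (T : Set V) : Set V :=
  {v | ∃ π : G.Strategy Owner.diamond, WinningZero T π v}

end StochasticGame

/-! ### Stochastic BPA games -/

/-- A stochastic BPA game over the (finite) stack alphabet `Γ`. `rules X` is the set of all `α`
such that `X ↪ α` is a rule; for a symbol `X` of `○`, `prob X α` is the rational probability of
the rule `X ↪ α` (the other values of `prob` have no meaning). -/
structure BPAGame (Γ : Type) where
  owner : Γ → Owner
  rules : Γ → Finset (List Γ)
  rules_nonempty : ∀ X, (rules X).Nonempty
  rules_length : ∀ X, ∀ α ∈ rules X, α.length ≤ 2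
  prob : Γ → List Γ → ℚ
  prob_pos : ∀ X, owner X = Owner.random → ∀ α ∈ rules X, 0 < prob X α
  prob_sum : ∀ X, owner X = Owner.random → ∑ α ∈ rules X, prob X α = 1

namespace BPAGame

variable {Γ : Type} (Δ : BPAGame Γ)

open Classical in
/-- The probability distribution on the (right-hand sides of the) rules of a symbol of `○`. -/
noncomputable def ruleDist (X : Γ) (h : Δ.owner X = Owner.random) : PMF (List Γ) :=
  PMF.ofFinset (fun α => if α ∈ Δ.rules X then ENNReal.ofReal (Δ.prob X α : ℝ) else 0) (Δ.rules X)
    (by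
      rw [Finset.sum_congr rfl fun α hα => if_pos hα,
        ← ENNReal.ofReal_sum_of_nonneg fun α hα => by exact_mod_cast (Δ.prob_pos X h α hα).le,
        ← Rat.cast_sum, Δ.prob_sum X h]
      simp)
    (fun α hα => if_neg hα)

theorem mem_support_ruleDist (X : Γ) (h : Δ.owner X = Owner.random) (α : List Γ) :
    α ∈ (Δ.ruleDist X h).support ↔ α ∈ Δ.rules X := by
  classical
  rw [PMF.mem_support_iff, ruleDist, PMF.ofFinset_apply]
  by_cases hα : α ∈ Δ.rules X
  · simp [hα, Δ.prob_pos X h α hα]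
  · simp [hα]

/-- The edges between configurations: `ε → ε`, and `Xβ → αβ` for every rule `X ↪ α`. The top of
the stack is the head of the list. -/
def Edge : List Γ → List Γ → Prop
  | [], v => v = []
  | X :: β, v => ∃ α ∈ Δ.rules X, v = α ++ β

/-- The owner of a configuration: the owner of its top symbol, and `○` for `ε`. -/
def configOwner : List Γ → Owner
  | [] => Owner.random
  | X :: _ => Δ.owner X

/-- The distribution on the successors of a configuration of `○`. -/
noncomputable def configProb : ∀ v : List Γ, Δ.configOwner v = Owner.random → PMF (List Γ)
  | [], _ => PMF.pure []
  | X :: β, h => (Δ.ruleDist X h).map (· ++ β)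

/-- The stochastic game `G_Δ` on the configurations of `Δ`. -/
noncomputable def game : StochasticGame (List Γ) where
  edge := Δ.Edge
  total
    | [] => ⟨[], rfl⟩
    | X :: β => let ⟨α, hα⟩ := Δ.rules_nonempty X; ⟨α ++ β, α, hα, rfl⟩
  owner := Δ.configOwner
  prob := Δ.configProb
  prob_support
    | [], _, u => by simp [configProb, Edge]
    | X :: β, h, u => by
      rw [configProb, PMF.mem_support_map_iff]
      exact exists_congr fun α => and_congr (Δ.mem_support_ruleDist X h α) eq_comm

/-- The simple set of configurations given by a set `ΓT` of stack symbols: all configurations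
whose top symbol belongs to `ΓT`. -/
def simpleSet (ΓT : Set Γ) : Set (List Γ) :=
  {v | ∃ X ∈ ΓT, ∃ α, v = X :: α}

variable {Δ} {p : Owner}

/-- A strategy `τ` of player `p` is regular: there are a deterministic finite automaton and a
function `f` of its control states such that `τ(Xα)` is the distribution on rules given by `f` in
the control state that is entered after reading the reverse of `Xα`. An edge `Xα → βα` is
identified with the right-hand side `β` of its rule. -/
def IsRegular (τ : Δ.game.Strategy p) : Prop :=
  ∃ (Q : Type) (_ : Finite Q) (M : DFA Γ Q) (f : Q → PMF (List Γ)),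
    ∀ (w : List (List Γ)) (X : Γ) (α : List Γ) (h : Δ.game.owner (X :: α) = p),
      τ.act w ⟨X :: α, h⟩ = (f (M.eval (X :: α).reverse)).map (· ++ α)

/-- `τ` is the stackless memoryless deterministic strategy that uses the rule `X ↪ c X` in every
configuration of player `p` with top symbol `X`. -/
def IsGivenByTable (c : Γ → List Γ) (τ : Δ.game.Strategy p) : Prop :=
  ∀ (w : List (List Γ)) (X : Γ) (α : List Γ) (h : Δ.game.owner (X :: α) = p),
    τ.act w ⟨X :: α, h⟩ = PMF.pure (c X ++ α)

/-- `τ` is an SMD (stackless memoryless deterministic) strategy. -/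
def IsSMD (τ : Δ.game.Strategy p) : Prop :=
  ∃ c : Γ → List Γ, IsGivenByTable c τ

end BPAGame

/-- A deterministic finite automaton over `Γ` whose set of control states is `{0, …, k - 1}`. -/
structure FinDFA (Γ : Type) where
  k : ℕ
  dfa : DFA Γ (Fin k)

/-- A finite description of a (deterministic) regular strategy: an automaton (whose accepting
states play no role) and, for every control state, the right-hand side of the rule to be used. -/
structure StrategyAutomaton (Γ : Type) extends FinDFA Γ where
  choice : Fin k → List Γ

/-- `τ` is the strategy described by `A`: in a configuration `Xα` of player `p` it uses the rule
`X ↪ β`, where `β` is the choice of `A` in the control state entered after reading the reverse of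
`Xα`. -/
def StrategyAutomaton.Describes {Γ : Type} {Δ : BPAGame Γ} {p : Owner} (A : StrategyAutomaton Γ)
    (τ : Δ.game.Strategy p) : Prop :=
  ∀ (w : List (List Γ)) (X : Γ) (α : List Γ) (h : Δ.game.owner (X :: α) = p),
    τ.act w ⟨X :: α, h⟩ = PMF.pure (A.choice (A.dfa.eval (X :: α).reverse) ++ α)

/-! ### Instances, their encoding, and polynomial time -/

/-- An instance: a stochastic BPA game with the stack alphabet `{0, …, n - 1}` and a set `ΓT` of
stack symbols. -/
structure BPAInstance where
  n : ℕ
  Δ : BPAGame (Fin n)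
  ΓT : Finset (Fin n)

namespace BPAInstance

/-- The simple set of target configurations of an instance. -/
def T (I : BPAInstance) : Set (List (Fin I.n)) :=
  BPAGame.simpleSet (I.ΓT : Set (Fin I.n))

/-- `W_□(T, >0)`. -/
def WBox (I : BPAInstance) : Set (List (Fin I.n)) := I.Δ.game.regionPos I.T

/-- `W_◇(T, =0)`. -/
def WDiamond (I : BPAInstance) : Set (List (Fin I.n)) := I.Δ.game.regionZero I.T

end BPAInstance

/-- The alphabet of the encodings: two binary digits and two punctuation marks. -/
inductive Tok : Type
  | bit (b : Bool)
  | item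
  | close
  deriving DecidableEq, Fintype

namespace Encode

/-- Binary encoding of a natural number, least significant digit first. -/
def nat (m : ℕ) : List Tok := m.bits.map Tok.bit ++ [Tok.close]

/-- Encoding of a list, given an encoding of its entries. -/
def list {β : Type} (e : β → List Tok) (l : List β) : List Tok :=
  l.flatMap (fun b => Tok.item :: e b) ++ [Tok.close]

/-- Encoding of a word over `{0, …, n - 1}`. -/
def word {n : ℕ} (α : List (Fin n)) : List Tok := list (fun X => nat X) α

def owner : Owner → List Tok
  | Owner.box => [Tok.bit false, Tok.bit false]
  | Owner.diamond => [Tok.bit false, Tok.bit true]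
  | Owner.random => [Tok.bit true, Tok.bit false]

/-- Encoding of the rule `X ↪ α`: its right-hand side and, if `X` is a symbol of `○`, the
numerator and the denominator of its probability. -/
def rule (I : BPAInstance) (X : Fin I.n) (α : List (Fin I.n)) : List Tok :=
  word α ++
    if I.Δ.owner X = Owner.random then
      nat (I.Δ.prob X α).num.toNat ++ nat (I.Δ.prob X α).den
    else []

/-- Encoding of all data of an instance that concern the stack symbol `X`: its name, its owner,
whether it belongs to `ΓT`, and its rules (listed in lexicographic order). -/
def symbol (I : BPAInstance) (X : Fin I.n) : List Tok :=
  nat X ++ owner (I.Δ.owner X) ++ [Tok.bit (decide (X ∈ I.ΓT))] ++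
    list (rule I X) ((I.Δ.rules X).sort (· ≤ ·))

/-- Binary encoding of an instance. -/
def inst (I : BPAInstance) : List Tok :=
  list (symbol I) (List.finRange I.n)

/-- Encoding of an instance together with a configuration. -/
def instConfig (x : Σ I : BPAInstance, List (Fin I.n)) : List Tok :=
  inst x.1 ++ word x.2

open Classical in
/-- Encoding of an automaton: its initial state and, for every control state, its name, whether
it is accepting, and its row of the transition table. -/
noncomputable def dfa {n : ℕ} (M : FinDFA (Fin n)) : List Tok :=
  nat M.dfa.start ++
    list (fun q : Fin M.k =>
      nat q ++ [Tok.bit (decide (q ∈ M.dfa.accept))] ++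
        list (fun X : Fin n => nat (M.dfa.step q X)) (List.finRange n))
      (List.finRange M.k)

/-- Encoding of the description of a regular strategy. -/
noncomputable def strategy {n : ℕ} (A : StrategyAutomaton (Fin n)) : List Tok :=
  dfa A.toFinDFA ++ list (fun q => word (A.choice q)) (List.finRange A.k)

/-- Encoding of the table of an SMD strategy. -/
def table {n : ℕ} (c : Fin n → List (Fin n)) : List Tok :=
  list (fun X => word (c X)) (List.finRange n)

end Encode

/-- There is a Turing machine that, on the encoding `ea a` of an object `a`, outputs the word
`f a` in a number of steps that is polynomial in the length of `ea a`. -/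
def PolyTimeComputable {α : Type} (ea : α → List Tok) (f : α → List Tok) : Prop :=
  Nonempty (Turing.TM2ComputableInPolyTime ea (fun l : List Tok => l) f)

open Classical in
/-- The property `P` of objects, given by their encodings, is decidable in polynomial time. -/
def PolyTimeDecidable {α : Type} (ea : α → List Tok) (P : α → Prop) : Prop :=
  Nonempty (Turing.TM2ComputableInPolyTime ea Computability.encodeBool fun a => decide (P a))

/-!
Call a word `γ` over the stack symbols *winning with status `b`* if player `□` can, with positive
probability against every play of `◇`, reach the target while the stack is at least as high as the
part below `γ`, where emptying `γ` counts as success if `b` is true. Whether a stack `X :: α` is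
winning depends only on `X` and on whether `α` is winning, so that the winning words are determined by
one bit for each symbol and each status, and a word is evaluated by a fold (`wins`). As only positive
probability matters, chance may be treated as a helper of `□`, and the bits form the least fixed point
of a monotone operator (`BPAInstance.round`). It is reached after at most twice as many rounds as there
are symbols (`BPAInstance.round_stage_bound`).

Configurations that are not winning after this saturation form a trap: `◇` can stay inside with a move
that depends on the top symbol only (`BPAInstance.table`). It suffices to prefer a rule that is losing
even with status `true`, for if there is none, then the symbol is losing only on top of losing stacks.
A set that is closed under the transitions of a Markov chain is almost surely not left
(`ae_mem_of_closed`), so this SMD strategy avoids the target.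

For the strategy of `□`, knowing which symbols are winning is not enough, since a winning rule may lead
in circles. The strategy uses ranks, that is, the rounds at which a symbol or a stack was first found
to be winning (`BPAInstance.rank`, `BPAInstance.height`). The rank of `X :: α` is a function of `X` and
the rank of `α`, so that an automaton that reads stacks bottom-up can keep track of it. If the best
way to win from `X :: α` is to do so above `α`, the strategy uses a rule that decreases the rank of the
stack; otherwise it uses a rule that removes `X`, going through symbols of smaller rank
(`BPAInstance.choose`). A nested induction on these ranks (`BPAInstance.attr_cons_true`,
`BPAInstance.attr_of_height_lt`) shows that all winning configurations lie in the attractor of the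
target, and a path of positive probability to the target gives positive probability of reaching it
(`exists_chainMeasure_pos`). In particular the two strategies determine the winning regions
(`BPAInstance.WBox_eq`, `BPAInstance.WDiamond_eq`).

Polynomial running time is proved for multi-stack Turing machines, in three layers. Structured programs
that push to and pop from stacks are compiled to machines (`StackProg.nonempty_computable`). On top of
them, functions between types whose elements are encoded by binary trees are realized by programs that
replace the tree on top of a stack (`PolyTime`), and the class of these functions is closed under
composition, pairing, case distinction and iteration as long as the intermediate results remain small;
natural numbers may be encoded in unary there, as every number that occurs is polynomial in the length
of the input, in which each stack symbol is listed. Finally, input words are parsed into the data of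
the game (`polyTime_data`), and the automata and the table are printed. The saturation never looks at
the probabilities, which the parser skips.
-/

/-! ### Structured stack programs and their compilation to Turing machines -/

/-- Structured programs over finitely many stacks. `loop k c f` pops the stack `k`, runs the body
`f o` on the popped symbol `o` (`none` if the stack was empty), and repeats as long as `c o`
holds. -/
inductive StackProg {K : Type} (Γ : K → Type) : Type
  | skip : StackProg Γ
  | push (k : K) (s : Γ k) : StackProg Γ
  | seq (p q : StackProg Γ) : StackProg Γ
  | loop (k : K) (c : Option (Γ k) → Bool) (f : Option (Γ k) → StackProg Γ) : StackProg Γ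

namespace StackProg

open Function Turing

variable {K : Type} [DecidableEq K] {Γ : K → Type}

/-- `Exec p S t S'`: started on the stacks `S`, the program `p` ends after `t` steps with the
stacks `S'`. -/
inductive Exec : StackProg Γ → (∀ k, List (Γ k)) → ℕ → (∀ k, List (Γ k)) → Prop
  | skip (S) : Exec skip S 1 S
  | push (k s S) : Exec (push k s) S 1 (update S k (s :: S k))
  | seq {p q S S₁ S₂ t₁ t₂} : Exec p S t₁ S₁ → Exec q S₁ t₂ S₂ → Exec (seq p q) S (t₁ + t₂) S₂
  | exit {k c f S S₁ t} : c (S k).head? = false →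
      Exec (f (S k).head?) (update S k (S k).tail) t S₁ → Exec (loop k c f) S (1 + t) S₁
  | again {k c f S S₁ S₂ t₁ t₂} : c (S k).head? = true →
      Exec (f (S k).head?) (update S k (S k).tail) t₁ S₁ → Exec (loop k c f) S₁ t₂ S₂ →
      Exec (loop k c f) S (1 + t₁ + t₂) S₂

/-- A step pushes at most one symbol. -/
theorem Exec.length_le {p : StackProg Γ} {S S' : ∀ k, List (Γ k)} {t : ℕ} (h : Exec p S t S')
    (k : K) : (S' k).length ≤ (S k).length + t := by
  have upd : ∀ (S : ∀ k, List (Γ k)) (j : K),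
      (update S j (S j).tail k).length ≤ (S k).length := by
    intro S j
    rcases eq_or_ne k j with rfl | hk
    · simp
    · simp [hk]
  induction h with
  | skip S => omega
  | push j s S =>
    rcases eq_or_ne k j with rfl | hk
    · simp
    · simp [hk]
  | seq _ _ ih₁ ih₂ => omega
  | @exit j c f S S₁ t hc _ ih => have := upd S j; omega
  | @again j c f S S₁ S₂ t₁ t₂ hc _ _ ih₁ ih₂ => have := upd S j; omega

/-- The program points of a program. -/
def Lab : StackProg Γ → Type
  | skip => Unit
  | push _ _ => Unit
  | seq p q => Lab p ⊕ Lab q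
  | loop k _ f => Unit ⊕ Σ o : Option (Γ k), Lab (f o)

/-- The first program point of a program. -/
def start : (p : StackProg Γ) → Lab p
  | skip => ()
  | push _ _ => ()
  | seq p _ => Sum.inl (start p)
  | loop _ _ _ => Sum.inl ()

instance finite_lab [∀ k, Finite (Γ k)] : (p : StackProg Γ) → Finite (Lab p)
  | skip => inferInstanceAs (Finite Unit)
  | push _ _ => inferInstanceAs (Finite Unit)
  | seq p q =>
    have := finite_lab p
    have := finite_lab q
    inferInstanceAs (Finite (Lab p ⊕ Lab q))
  | loop k _ f =>
    have := fun o => finite_lab (f o)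
    inferInstanceAs (Finite (Unit ⊕ Σ o : Option (Γ k), Lab (f o)))

/-- The code of a program as a part of a larger machine with labels `L`, where `inj` places the
program points of the program among the labels, and control moves on to `exit` in the end. The
internal state of the machine holds the symbol last popped from each stack. -/
def code {L : Type} : (p : StackProg Γ) → (Lab p → L) → L →
    Lab p → TM2.Stmt Γ L (∀ k, Option (Γ k))
  | skip, _, exit => fun _ => .goto fun _ => exit
  | push k s, _, exit => fun _ => .push k (fun _ => s) (.goto fun _ => exit)
  | seq p q, inj, exit =>
    Sum.elim (code p (fun l => inj (Sum.inl l)) (inj (Sum.inr (start q))))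
      (code q (fun l => inj (Sum.inr l)) exit)
  | loop k c f, inj, exit =>
    Sum.elim
      (fun _ => .pop k (fun v o => update v k o)
        (.goto fun v => inj (Sum.inr ⟨v k, start (f (v k))⟩)))
      (fun x => code (f x.1) (fun l => inj (Sum.inr ⟨x.1, l⟩))
        (if c x.1 then inj (Sum.inl ()) else exit) x.2)

/-- The effect of `t` steps of a machine. -/
abbrev run {L : Type} (M : L → TM2.Stmt Γ L (∀ k, Option (Γ k))) (t : ℕ)
    (a : TM2.Cfg Γ L (∀ k, Option (Γ k))) : Option (TM2.Cfg Γ L (∀ k, Option (Γ k))) :=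
  (flip bind (TM2.step M))^[t] (some a)

theorem run_trans {L : Type} {M : L → TM2.Stmt Γ L (∀ k, Option (Γ k))} {t₁ t₂ : ℕ}
    {a b : TM2.Cfg Γ L (∀ k, Option (Γ k))} {c : Option (TM2.Cfg Γ L (∀ k, Option (Γ k)))}
    (h₁ : run M t₁ a = some b) (h₂ : run M t₂ b = c) : run M (t₁ + t₂) a = c := by
  rw [run, add_comm, iterate_add_apply, ← h₂]
  exact congrArg _ h₁

theorem run_one {L : Type} (M : L → TM2.Stmt Γ L (∀ k, Option (Γ k)))
    (a : TM2.Cfg Γ L (∀ k, Option (Γ k))) : run M 1 a = TM2.step M a := rfl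

theorem run_loop_head {L : Type} (M : L → TM2.Stmt Γ L (∀ k, Option (Γ k))) {k : K}
    {c : Option (Γ k) → Bool} {f : Option (Γ k) → StackProg Γ} (inj : Lab (loop k c f) → L)
    (exit : L) (hM : ∀ l, M (inj l) = code (loop k c f) inj exit l) (v : ∀ k, Option (Γ k))
    (S : ∀ k, List (Γ k)) :
    run M 1 ⟨some (inj (start (loop k c f))), v, S⟩ =
      some ⟨some (inj (Sum.inr ⟨(S k).head?, start (f (S k).head?)⟩)), update v k (S k).head?,
        update S k (S k).tail⟩ := by
  refine (congrArg (fun q => some (TM2.stepAux q v S)) (hM (Sum.inl ()))).trans ?_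
  have h : update v k (S k).head? k = (S k).head? := update_self ..
  change some (TM2.Cfg.mk (some (inj (Sum.inr ⟨update v k (S k).head? k,
    start (f (update v k (S k).head? k))⟩))) _ _) = _
  rw [h]

/-- The machine code of a program simulates its execution step by step. -/
theorem Exec.run_code {p : StackProg Γ} {S S' : ∀ k, List (Γ k)} {t : ℕ} (h : Exec p S t S')
    {L : Type} (M : L → TM2.Stmt Γ L (∀ k, Option (Γ k))) (inj : Lab p → L) (exit : L)
    (hM : ∀ l, M (inj l) = code p inj exit l) (v : ∀ k, Option (Γ k)) :
    ∃ v', run M t ⟨some (inj (start p)), v, S⟩ = some ⟨some exit, v', S'⟩ := by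
  induction h generalizing L v with
  | skip S => exact ⟨v, by simp [run_one, hM, code]⟩
  | push k s S => exact ⟨v, by simp [run_one, hM, code]⟩
  | @seq p q S S₁ S₂ t₁ t₂ _ _ ih₁ ih₂ =>
    obtain ⟨v₁, h₁⟩ := ih₁ M (fun l => inj (Sum.inl l)) (inj (Sum.inr (start q)))
      (fun l => hM (Sum.inl l)) v
    obtain ⟨v₂, h₂⟩ := ih₂ M (fun l => inj (Sum.inr l)) exit (fun l => hM (Sum.inr l)) v₁
    exact ⟨v₂, run_trans h₁ h₂⟩
  | @exit k c f S S₁ t hc _ ih =>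
    obtain ⟨v₁, h₁⟩ := ih M (fun l => inj (Sum.inr ⟨_, l⟩)) exit
      (fun l => (hM (Sum.inr ⟨_, l⟩)).trans (by
        change code (f _) _ (if c _ then _ else _) l = _
        rw [hc]; rfl)) (update v k (S k).head?)
    exact ⟨v₁, run_trans (run_loop_head M inj exit hM v S) h₁⟩
  | @again k c f S S₁ S₂ t₁ t₂ hc _ _ ih₁ ih₂ =>
    obtain ⟨v₁, h₁⟩ := ih₁ M (fun l => inj (Sum.inr ⟨_, l⟩)) (inj (Sum.inl ()))
      (fun l => (hM (Sum.inr ⟨_, l⟩)).trans (by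
        change code (f _) _ (if c _ then _ else _) l = _
        rw [hc]; rfl)) (update v k (S k).head?)
    obtain ⟨v₂, h₂⟩ := ih₂ M inj exit hM v₁
    exact ⟨v₂, run_trans (run_trans (run_loop_head M inj exit hM v S) h₁) h₂⟩

open Classical in
/-- The Turing machine of a program. A final step resets the internal state, because a halting
configuration is required to carry the initial one. -/
noncomputable def machine [Fintype K] [∀ k, Fintype (Γ k)] (k₀ k₁ : K) (p : StackProg Γ) :
    FinTM2 where
  K := K
  k₀ := k₀
  k₁ := k₁
  Γ := Γ
  Λ := Option (Lab p)
  main := some (start p)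
  ΛFin := Fintype.ofFinite _
  σ := ∀ k, Option (Γ k)
  initialState := fun _ => none
  m := fun l => l.elim (.load (fun _ _ => none) .halt) (code p some none)

theorem dite_nil_eq_update (k₀ : K) (l : List (Γ k₀)) :
    (fun k => if h : k = k₀ then (by rw [h]; exact l : List (Γ k)) else []) =
      update (fun _ => []) k₀ l := by
  funext k
  by_cases hk : k₀ = k
  · subst hk
    simp
  · rw [dif_neg (Ne.symm hk), update_of_ne (Ne.symm hk)]

/-- A program that turns the input stack into the output stack in polynomial time yields a Turing
machine. -/
theorem nonempty_computable [Fintype K] [∀ k, Fintype (Γ k)] {α β αΓ βΓ : Type}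
    {ea : α → List αΓ} {eb : β → List βΓ} {f : α → β} (k₀ k₁ : K) (i₀ : Γ k₀ ≃ αΓ)
    (i₁ : Γ k₁ ≃ βΓ) (p : StackProg Γ) (P : Polynomial ℕ)
    (h : ∀ a, ∃ t ≤ P.eval (ea a).length,
      Exec p (update (fun _ => []) k₀ ((ea a).map i₀.symm)) t
        (update (fun _ => []) k₁ ((eb (f a)).map i₁.symm))) :
    Nonempty (TM2ComputableInPolyTime ea eb f) := by
  refine ⟨⟨⟨machine k₀ k₁ p, i₀, i₁⟩, P + 1, fun a => ?_⟩⟩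
  choose t ht hx using h a
  refine ⟨⟨t + 1, ?_⟩, by simpa using ht⟩
  obtain ⟨v, hv⟩ := hx.run_code (machine k₀ k₁ p).m some none (fun l => rfl) (fun _ => none)
  have h₀ : initList (machine k₀ k₁ p) ((ea a).map i₀.symm) =
      ⟨some (some (start p)), fun _ => none, update (fun _ => []) k₀ ((ea a).map i₀.symm)⟩ :=
    congrArg (TM2.Cfg.mk _ _) (dite_nil_eq_update k₀ _)
  have h₁ : haltList (machine k₀ k₁ p) ((eb (f a)).map i₁.symm) =
      ⟨none, fun _ => none, update (fun _ => []) k₁ ((eb (f a)).map i₁.symm)⟩ :=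
    congrArg (TM2.Cfg.mk _ _) (dite_nil_eq_update k₁ _)
  refine (congrArg _ (congrArg some h₀)).trans ((run_trans hv ?_).trans (congrArg some h₁.symm))
  rfl

end StackProg

/-! ### Programs on binary trees in Polish notation -/

/-- Binary trees, the universal data type of the polynomial-time functions below. -/
inductive Code : Type
  | leaf : Code
  | node (x y : Code) : Code

/-- Polish notation of a tree. No such word is a proper prefix of another one, so a program can
find the end of a tree that lies on top of other data. -/
def Code.str : Code → List Bool
  | leaf => [false]
  | node x y => true :: (x.str ++ y.str)

/-- The number of nodes and leaves of a tree. -/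
def Code.size : Code → ℕ
  | leaf => 1
  | node x y => x.size + y.size + 1

/-- The length of the right spine of a tree, which is the length of the list that it encodes. -/
def Code.spine : Code → ℕ
  | leaf => 0
  | node _ y => y.spine + 1

theorem Code.length_str (x : Code) : x.str.length = x.size := by
  induction x with
  | leaf => rfl
  | node x y ihx ihy => simp [str, size, ihx, ihy]

theorem Code.size_pos (x : Code) : 0 < x.size := by cases x <;> simp [size]

theorem Code.spine_lt_size (x : Code) : x.spine < x.size := by
  induction x with
  | leaf => simp [spine, size]
  | node x y _ ihy => simp only [spine, size]; omega

/-- The stacks: input, two kinds of output, the stack `A` of operands, the stacks `B` and `C` of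
saved operands and counters, and an auxiliary counter `N`. -/
inductive Stk : Type
  | inp | outT | outB | A | B | C | N
  deriving DecidableEq

instance : Fintype Stk := ⟨{.inp, .outT, .outB, .A, .B, .C, .N}, fun k => by cases k <;> decide⟩

/-- The stack symbols. On the working stacks, `some false` and `some true` are the letters of Polish
notation, and `none` is a separator. -/
abbrev StkSym : Stk → Type
  | .inp => Tok
  | .outT => Tok
  | .outB => Bool
  | .A => Option Bool
  | .B => Option Bool
  | .C => Option Bool
  | .N => Option Bool

instance (k : Stk) : Fintype (StkSym k) := by cases k <;> infer_instance

/-- The stacks with the given contents. -/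
def mem (i : List Tok) (o : List Tok) (u : List Bool) (a b c n : List (Option Bool)) :
    ∀ k, List (StkSym k)
  | .inp => i
  | .outT => o
  | .outB => u
  | .A => a
  | .B => b
  | .C => c
  | .N => n

namespace StackProg

open Function

section Mem

variable (i o : List Tok) (u : List Bool) (a b c n a' : List (Option Bool))

@[simp] theorem update_inp (i' : List Tok) :
    update (mem i o u a b c n) Stk.inp i' = mem i' o u a b c n := by
  funext k; cases k <;> rfl
@[simp] theorem update_outT (o' : List Tok) :
    update (mem i o u a b c n) Stk.outT o' = mem i o' u a b c n := by
  funext k; cases k <;> rfl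
@[simp] theorem update_outB (u' : List Bool) :
    update (mem i o u a b c n) Stk.outB u' = mem i o u' a b c n := by
  funext k; cases k <;> rfl
@[simp] theorem update_A : update (mem i o u a b c n) Stk.A a' = mem i o u a' b c n := by
  funext k; cases k <;> rfl
@[simp] theorem update_B : update (mem i o u a b c n) Stk.B a' = mem i o u a a' c n := by
  funext k; cases k <;> rfl
@[simp] theorem update_C : update (mem i o u a b c n) Stk.C a' = mem i o u a b a' n := by
  funext k; cases k <;> rfl
@[simp] theorem update_N : update (mem i o u a b c n) Stk.N a' = mem i o u a b c a' := by
  funext k; cases k <;> rfl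

end Mem

section Runs

variable {K : Type} [DecidableEq K] {Γ : K → Type}

/-- `Runs p S t S'`: started on `S`, the program `p` ends with `S'` after at most `t` steps. -/
def Runs (p : StackProg Γ) (S : ∀ k, List (Γ k)) (t : ℕ) (S' : ∀ k, List (Γ k)) : Prop :=
  ∃ t' ≤ t, Exec p S t' S'

theorem Runs.mono {p : StackProg Γ} {S S' : ∀ k, List (Γ k)} {t t' : ℕ} (h : Runs p S t S')
    (ht : t ≤ t') : Runs p S t' S' :=
  let ⟨s, hs, hx⟩ := h; ⟨s, hs.trans ht, hx⟩

theorem Runs.skip (S : ∀ k, List (Γ k)) : Runs skip S 1 S := ⟨1, le_rfl, .skip S⟩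

theorem Runs.push {S S' : ∀ k, List (Γ k)} (k : K) (s : Γ k) (h : update S k (s :: S k) = S') :
    Runs (push k s) S 1 S' := ⟨1, le_rfl, h ▸ .push k s S⟩

theorem Runs.seq {p q : StackProg Γ} {S S₁ S₂ : ∀ k, List (Γ k)} {t₁ t₂ : ℕ}
    (h₁ : Runs p S t₁ S₁) (h₂ : Runs q S₁ t₂ S₂) : Runs (seq p q) S (t₁ + t₂) S₂ :=
  let ⟨s₁, hs₁, hx₁⟩ := h₁
  let ⟨s₂, hs₂, hx₂⟩ := h₂
  ⟨s₁ + s₂, add_le_add hs₁ hs₂, .seq hx₁ hx₂⟩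

theorem Runs.exit {S S₁ S₂ : ∀ k, List (Γ k)} {k : K} {c : Option (Γ k) → Bool}
    {f : Option (Γ k) → StackProg Γ} {t : ℕ} (o : Option (Γ k)) (ho : (S k).head? = o)
    (hc : c o = false) (hu : update S k (S k).tail = S₁)
    (h : Runs (f o) S₁ t S₂) : Runs (loop k c f) S (1 + t) S₂ := by
  obtain ⟨s, hs, hx⟩ := h
  subst ho hu
  exact ⟨1 + s, by omega, .exit hc hx⟩

theorem Runs.again {S S₁ S₂ S₃ : ∀ k, List (Γ k)} {k : K} {c : Option (Γ k) → Bool}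
    {f : Option (Γ k) → StackProg Γ} {t₁ t₂ : ℕ} (o : Option (Γ k)) (ho : (S k).head? = o)
    (hc : c o = true) (hu : update S k (S k).tail = S₁)
    (h₁ : Runs (f o) S₁ t₁ S₂) (h₂ : Runs (loop k c f) S₂ t₂ S₃) :
    Runs (loop k c f) S (1 + t₁ + t₂) S₃ := by
  obtain ⟨s₁, hs₁, hx₁⟩ := h₁
  obtain ⟨s₂, hs₂, hx₂⟩ := h₂
  subst ho hu
  exact ⟨1 + s₁ + s₂, by omega, .again hc hx₁ hx₂⟩

end Runs

/-- A program over the stacks `Stk`. -/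
abbrev Prog := StackProg StkSym

/-- One step of `parse`: a letter is taken from `A` and treated by `e`, and, if it is that of an
inner node, two more trees are awaited. -/
def parseBody (e : Bool → Prog) : Option (Option Bool) → Prog
  | some (some _) => loop .A (fun _ => false) fun
    | some (some true) => seq (e true) (seq (push .N (some true)) (push .N (some true)))
    | _ => e false
  | _ => skip

/-- The main loop of `parse`: the height of `N` is the number of trees still awaited. -/
def parseLoop (e : Bool → Prog) : Prog :=
  loop .N (fun o => o == some (some true)) (parseBody e)

/-- Removes a tree from the top of `A`, treating its letters by `e`. -/
def parse (e : Bool → Prog) : Prog :=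
  seq (push .N none) (seq (push .N (some true)) (parseLoop e))

section Parse

variable {e : Bool → Prog} {σ : List (Option Bool) → List (Option Bool) → List Bool →
  ∀ k, List (StkSym k)}

/-- The loop of `parse` treats the letters of `x` and then goes on with one tree less to await. In
the family `σ a n w` of memory contents, `a` and `n` are the contents of `A` and `N`, and `w` records
the letters treated so far, most recent first; `e` only has to record its letter. -/
theorem runs_parseLoop (hA : ∀ a n w, σ a n w .A = a) (hN : ∀ a n w, σ a n w .N = n)
    (uA : ∀ a n w a', update (σ a n w) .A a' = σ a' n w)
    (uN : ∀ a n w n', update (σ a n w) .N n' = σ a n' w)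
    (he : ∀ s a n w, Runs (e s) (σ a n w) 1 (σ a n (s :: w))) (x : Code) :
    ∀ (a n w) (t S'), Runs (parseLoop e) (σ a n (x.str.reverse ++ w)) t S' →
      Runs (parseLoop e) (σ (x.str.map some ++ a) (some true :: n) w) (t + 5 * x.size) S' := by
  induction x with
  | leaf =>
    intro a n w t S' h
    replace h : Runs (parseLoop e) (σ a n (false :: w)) t S' := by simpa [Code.str] using h
    unfold parseLoop at h ⊢
    exact (Runs.again (S₁ := σ (some false :: a) n w) (some (some true)) (by simp [hN])
      rfl (by simp [uN, hN, Code.str]) (Runs.exit (S₁ := σ a n w) (some (some false)) (by simp [hA])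
        rfl (by simp [uA, hA]) (he false a n w)) h).mono
      (by simp only [Code.size]; omega)
  | node x y ihx ihy =>
    intro a n w t S' h
    have h₂ := ihx (y.str.map some ++ a) (some true :: n) (true :: w) _ _
      (ihy a n (x.str.reverse ++ true :: w) t S' (by simpa [Code.str] using h))
    unfold parseLoop at h₂ ⊢
    exact (Runs.again (S₁ := σ (some true :: (x.str.map some ++ (y.str.map some ++ a))) n w)
      (some (some true)) (by simp [hN]) rfl (by simp [uN, hN, Code.str])
      (Runs.exit (S₁ := σ (x.str.map some ++ (y.str.map some ++ a)) n w) (some (some true))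
        (by simp [hA]) rfl (by simp [uA, hA]) (Runs.seq (he true _ _ _)
          (Runs.seq (S₁ := σ (x.str.map some ++ (y.str.map some ++ a)) (some true :: n) (true :: w))
            (Runs.push Stk.N (some true) (by simp [uN, hN]))
            (Runs.push Stk.N (some true) (by simp [uN, hN]))))) h₂).mono
      (by simp only [Code.size]; omega)

theorem runs_parse (hA : ∀ a n w, σ a n w .A = a) (hN : ∀ a n w, σ a n w .N = n)
    (uA : ∀ a n w a', update (σ a n w) .A a' = σ a' n w)
    (uN : ∀ a n w n', update (σ a n w) .N n' = σ a n' w)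
    (he : ∀ s a n w, Runs (e s) (σ a n w) 1 (σ a n (s :: w))) (x : Code)
    (a n : List (Option Bool)) :
    Runs (parse e) (σ (x.str.map some ++ a) n []) (5 * x.size + 4) (σ a n x.str.reverse) := by
  have h := runs_parseLoop hA hN uA uN he x a (none :: n) [] 2 (σ a n x.str.reverse)
    (by
      rw [List.append_nil]
      unfold parseLoop
      exact (Runs.exit (S₁ := σ a n x.str.reverse) (some none) (by simp [hN]) rfl
        (by simp [uN, hN]) (Runs.skip _)).mono le_rfl)
  have h' := Runs.seq (S := σ (x.str.map some ++ a) n [])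
    (Runs.push Stk.N none (by rw [uN, hN]))
    (Runs.seq (Runs.push Stk.N (some true) (by rw [uN, hN])) h)
  exact h'.mono (by omega)

end Parse

/-- One step of `drain`. -/
def drainBody (e : Bool → Prog) : Option (Option Bool) → Prog
  | some (some s) => e s
  | _ => skip

/-- Tests for a letter or a counter mark, as opposed to a separator. -/
def isLetter : Option (Option Bool) → Bool
  | some (some _) => true
  | _ => false

/-- Removes the word above the topmost separator of `B`, and the separator, treating its letters by
`e`. -/
def drainB (e : Bool → Prog) : Prog := loop .B isLetter (drainBody e)

/-- Removes the word above the topmost separator of `C`, and the separator, treating its letters by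
`e`. -/
def drainC (e : Bool → Prog) : Prog := loop .C isLetter (drainBody e)

section Drain

variable {e : Bool → Prog} {τ : List (Option Bool) → List Bool → ∀ k, List (StkSym k)} {d : ℕ}

theorem runs_drainB (hB : ∀ b w, τ b w .B = b) (uB : ∀ b w b', update (τ b w) .B b' = τ b' w)
    (he : ∀ s b w, Runs (e s) (τ b w) d (τ b (s :: w))) (l w : List Bool)
    (b : List (Option Bool)) :
    Runs (drainB e) (τ (l.map some ++ none :: b) w) ((d + 1) * l.length + 2)
      (τ b (l.reverse ++ w)) := by
  induction l generalizing w with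
  | nil =>
    unfold drainB
    exact (Runs.exit (some none) (by simp [hB]) rfl (by simp [uB, hB]) (Runs.skip _)).mono
      (by simp)
  | cons s l ih =>
    replace ih := ih (s :: w)
    unfold drainB at ih ⊢
    rw [List.reverse_cons, List.append_assoc]
    exact (Runs.again (S₁ := τ (l.map some ++ none :: b) w) (some (some s)) (by simp [hB]) rfl
      (by simp [uB, hB]) (he s _ w) ih).mono
      (by simp only [List.length_cons]; ring_nf; omega)

theorem runs_drainC (hC : ∀ c w, τ c w .C = c) (uC : ∀ c w c', update (τ c w) .C c' = τ c' w)
    (he : ∀ s c w, Runs (e s) (τ c w) d (τ c (s :: w))) (l w : List Bool)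
    (c : List (Option Bool)) :
    Runs (drainC e) (τ (l.map some ++ none :: c) w) ((d + 1) * l.length + 2)
      (τ c (l.reverse ++ w)) := by
  induction l generalizing w with
  | nil =>
    unfold drainC
    exact (Runs.exit (some none) (by simp [hC]) rfl (by simp [uC, hC]) (Runs.skip _)).mono
      (by simp)
  | cons s l ih =>
    replace ih := ih (s :: w)
    unfold drainC at ih ⊢
    rw [List.reverse_cons, List.append_assoc]
    exact (Runs.again (S₁ := τ (l.map some ++ none :: c) w) (some (some s)) (by simp [hC]) rfl
      (by simp [uC, hC]) (he s _ w) ih).mono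
      (by simp only [List.length_cons]; ring_nf; omega)

end Drain

section Moves

variable (i o : List Tok) (u : List Bool) (a b c n : List (Option Bool)) (x : Code)

/-- The representation of a tree that has been moved to `B` or `C`. -/
def Code.saved (x : Code) : List (Option Bool) := x.str.reverse.map some ++ [none]

/-- Removes a tree from `A`. -/
def drop : Prog := parse fun _ => skip

theorem runs_drop : Runs drop (mem i o u (x.str.map some ++ a) b c n) (5 * x.size + 4)
    (mem i o u a b c n) :=
  runs_parse (σ := fun a n _ => mem i o u a b c n) (fun _ _ _ => rfl) (fun _ _ _ => rfl)
    (by simp) (by simp) (fun _ _ _ _ => Runs.skip _) x a n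

/-- Moves a tree from `A` to `B`. -/
def toB : Prog := seq (push .B none) (parse fun s => push .B (some s))

theorem runs_toB : Runs toB (mem i o u (x.str.map some ++ a) b c n) (5 * x.size + 5)
    (mem i o u a (Code.saved x ++ b) c n) := by
  have h := runs_parse (e := fun s => push .B (some s))
    (σ := fun a n w => mem i o u a (w.map some ++ none :: b) c n)
    (fun _ _ _ => rfl) (fun _ _ _ => rfl) (by simp) (by simp)
    (fun s _ _ _ => Runs.push Stk.B (some s) (update_B ..)) x a n
  have h' := (Runs.seq (Runs.push Stk.B none (update_B ..)) h).mono
    (show 1 + (5 * x.size + 4) ≤ 5 * x.size + 5 by omega)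
  unfold toB
  simpa [Code.saved] using h'

/-- Moves a tree from `A` to `C`. -/
def toC : Prog := seq (push .C none) (parse fun s => push .C (some s))

theorem runs_toC : Runs toC (mem i o u (x.str.map some ++ a) b c n) (5 * x.size + 5)
    (mem i o u a b (Code.saved x ++ c) n) := by
  have h := runs_parse (e := fun s => push .C (some s))
    (σ := fun a n w => mem i o u a b (w.map some ++ none :: c) n)
    (fun _ _ _ => rfl) (fun _ _ _ => rfl) (by simp) (by simp)
    (fun s _ _ _ => Runs.push Stk.C (some s) (update_C ..)) x a n
  have h' := (Runs.seq (Runs.push Stk.C none (update_C ..)) h).mono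
    (show 1 + (5 * x.size + 4) ≤ 5 * x.size + 5 by omega)
  unfold toC
  simpa [Code.saved] using h'

/-- Moves a tree from `B` back to `A`. -/
def fromB : Prog := drainB fun s => push .A (some s)

theorem runs_fromB : Runs fromB (mem i o u a (Code.saved x ++ b) c n) (5 * x.size + 5)
    (mem i o u (x.str.map some ++ a) b c n) := by
  have h := runs_drainB (e := fun s => push .A (some s)) (d := 1)
    (τ := fun b w => mem i o u (w.map some ++ a) b c n)
    (fun _ _ => rfl) (by simp) (fun s _ _ => Runs.push Stk.A (some s) (update_A ..))
    x.str.reverse [] b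
  simp only [List.length_reverse, Code.length_str, List.reverse_reverse, List.append_nil,
    List.map_nil, List.nil_append] at h
  replace h := h.mono (show (1 + 1) * x.size + 2 ≤ 5 * x.size + 5 by omega)
  unfold fromB
  simpa [Code.saved] using h

/-- Moves a tree from `C` back to `A`. -/
def fromC : Prog := drainC fun s => push .A (some s)

theorem runs_fromC : Runs fromC (mem i o u a b (Code.saved x ++ c) n) (5 * x.size + 5)
    (mem i o u (x.str.map some ++ a) b c n) := by
  have h := runs_drainC (e := fun s => push .A (some s)) (d := 1)
    (τ := fun c w => mem i o u (w.map some ++ a) b c n)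
    (fun _ _ => rfl) (by simp) (fun s _ _ => Runs.push Stk.A (some s) (update_A ..))
    x.str.reverse [] c
  simp only [List.length_reverse, Code.length_str, List.reverse_reverse, List.append_nil,
    List.map_nil, List.nil_append] at h
  replace h := h.mono (show (1 + 1) * x.size + 2 ≤ 5 * x.size + 5 by omega)
  unfold fromC
  simpa [Code.saved] using h

/-- Saves a copy of the topmost tree of `A` on `B`. -/
def copyB : Prog :=
  seq toB (seq (push .C none) (seq (drainB fun s => seq (push .A (some s)) (push .C (some s)))
    (seq (push .B none) (drainC fun s => push .B (some s)))))

theorem runs_copyB : Runs copyB (mem i o u (x.str.map some ++ a) b c n) (10 * x.size + 15)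
    (mem i o u (x.str.map some ++ a) (Code.saved x ++ b) c n) := by
  have h₂ := runs_drainB (e := fun s => seq (push .A (some s)) (push .C (some s))) (d := 2)
    (τ := fun b w => mem i o u (w.map some ++ a) b (w.map some ++ none :: c) n)
    (fun _ _ => rfl) (by simp) (fun s _ _ => Runs.seq (Runs.push Stk.A (some s) (update_A ..))
      (Runs.push Stk.C (some s) (update_C ..)))
    x.str.reverse [] b
  have h₃ := runs_drainC (e := fun s => push .B (some s)) (d := 1)
    (τ := fun c w => mem i o u (x.str.map some ++ a) (w.map some ++ none :: b) c n)
    (fun _ _ => rfl) (by simp) (fun s _ _ => Runs.push Stk.B (some s) (update_B ..))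
    x.str [] c
  simp only [List.length_reverse, Code.length_str, List.reverse_reverse, List.append_nil,
    List.map_nil, List.nil_append] at h₂ h₃
  have h₁ := runs_toB i o u a b c n x
  simp only [Code.saved, List.append_assoc, List.singleton_append] at h₁ ⊢
  have h := Runs.seq h₁ (Runs.seq (Runs.push Stk.C none (update_C ..)) (Runs.seq h₂
    (Runs.seq (Runs.push Stk.B none (update_B ..)) h₃)))
  exact h.mono (by omega)

end Moves

end StackProg

/-! ### Programs for operations on trees -/

/-- An encoding of the elements of `α` by binary trees; it need not be injective. -/
class HasCode (α : Type) where
  toCode : α → Code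

open HasCode

/-- The size of the code of `a`. -/
def csize {α : Type} [HasCode α] (a : α) : ℕ := (toCode a).size

namespace StackProg

/-- The program `p` replaces the tree `x` on top of the stack `A` by `y`, in at most `t` steps and
with no other effect. -/
def Realizes (p : Prog) (x y : Code) (t : ℕ) : Prop :=
  ∀ i o u a b c n, Runs p (mem i o u (x.str.map some ++ a) b c n) t
    (mem i o u (y.str.map some ++ a) b c n)

variable {p q : Prog} {x y z : Code} {s t : ℕ}

theorem runs_pushA (s i o u a b c n) :
    Runs (push .A s) (mem i o u a b c n) 1 (mem i o u (s :: a) b c n) :=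
  Runs.push _ _ (update_A ..)

theorem Realizes.mono (h : Realizes p x y s) (hst : s ≤ t) : Realizes p x y t :=
  fun i o u a b c n => (h i o u a b c n).mono hst

/-- The result cannot be larger than the steps allow, since each of them writes at most one letter. -/
theorem Realizes.size_le (h : Realizes p x y t) : y.size ≤ x.size + t := by
  obtain ⟨t', ht, hx⟩ := h [] [] [] [] [] [] []
  have := hx.length_le .A
  simp only [mem, List.append_nil, List.length_map, Code.length_str] at this
  omega

theorem Realizes.comp (hp : Realizes p x y s) (hq : Realizes q y z t) :
    Realizes (seq p q) x z (s + t) :=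
  fun i o u a b c n => (hp i o u a b c n).seq (hq i o u a b c n)

/-- Writes a word on `A`. -/
def pushWord : List Bool → Prog
  | [] => skip
  | s :: l => seq (pushWord l) (push .A (some s))

theorem runs_pushWord (l : List Bool) (i o u a b c n) :
    Runs (pushWord l) (mem i o u a b c n) (l.length + 1)
      (mem i o u (l.map some ++ a) b c n) := by
  induction l with
  | nil => exact Runs.skip _
  | cons s l ih =>
    have h := ih.seq (Runs.push Stk.A (some s) (update_A ..))
    exact h.mono (by simp)

theorem realizes_const (x y : Code) :
    Realizes (seq drop (pushWord y.str)) x y (5 * x.size + y.size + 5) := by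
  intro i o u a b c n
  have h := (runs_drop i o u a b c n x).seq (runs_pushWord y.str i o u a b c n)
  rw [Code.length_str] at h
  exact h.mono (by omega)

/-- Applies two programs to the same argument. -/
def pairProg (p q : Prog) : Prog :=
  seq copyB (seq p (seq toC (seq fromB (seq q (seq fromC (push .A (some true)))))))

theorem Realizes.pair (hp : Realizes p x y s) (hq : Realizes q x z t) :
    Realizes (pairProg p q) x (.node y z) (25 * x.size + 11 * s + t + 40) := by
  intro i o u a b c n
  have hy := hp.size_le
  have h := (runs_copyB i o u a b c n x).seq ((hp i o u a (Code.saved x ++ b) c n).seq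
    ((runs_toC i o u a (Code.saved x ++ b) c n y).seq
    ((runs_fromB i o u a b (Code.saved y ++ c) n x).seq
    ((hq i o u a b (Code.saved y ++ c) n).seq
    ((runs_fromC i o u (z.str.map some ++ a) b c n y).seq
      (runs_pushA (some true) ..))))))
  have h' := h.mono (show _ ≤ 25 * x.size + 11 * s + t + 40 by omega)
  unfold pairProg
  simpa [Code.str] using h'

/-- The left subtree; a leaf is left unchanged. -/
def Code.left : Code → Code
  | .leaf => .leaf
  | .node x _ => x

/-- The right subtree; a leaf is left unchanged. -/
def Code.right : Code → Code
  | .leaf => .leaf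
  | .node _ y => y

/-- Takes a letter from `A` and branches on it. -/
def caseA (p q : Prog) : Prog := loop .A (fun _ => false) fun
  | some (some true) => p
  | _ => q

theorem runs_caseA_true {S : ∀ k, List (StkSym k)} (i o u a b c n)
    (hp : Runs p (mem i o u a b c n) t S) :
    Runs (caseA p q) (mem i o u (some true :: a) b c n) (1 + t) S :=
  Runs.exit (some (some true)) rfl rfl (update_A ..) hp

theorem runs_caseA_false {S : ∀ k, List (StkSym k)} (i o u a b c n)
    (hq : Runs q (mem i o u a b c n) t S) :
    Runs (caseA p q) (mem i o u (some false :: a) b c n) (1 + t) S :=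
  Runs.exit (some (some false)) rfl rfl (update_A ..) hq

/-- The program for `Code.left`. -/
def leftProg : Prog := caseA (seq toB (seq drop fromB)) (push .A (some false))

theorem realizes_left (x : Code) : Realizes leftProg x (Code.left x) (10 * x.size + 20) := by
  intro i o u a b c n
  cases x with
  | leaf =>
    have h := runs_caseA_false (p := (seq toB (seq drop fromB))) i o u a b c n
      (runs_pushA (some false) i o u a b c n)
    exact h.mono (by omega)
  | node x y =>
    have h := runs_caseA_true (q := push .A (some false)) i o u _ b c n
      ((runs_toB i o u (y.str.map some ++ a) b c n x).seq
      ((runs_drop i o u a (Code.saved x ++ b) c n y).seq (runs_fromB i o u a b c n x)))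
    have h' := h.mono (show _ ≤ 10 * (Code.node x y).size + 20 by simp only [Code.size]; omega)
    simpa [Code.str, leftProg, Code.left] using h'

/-- The program for `Code.right`. -/
def rightProg : Prog := caseA drop (push .A (some false))

theorem realizes_right (x : Code) : Realizes rightProg x (Code.right x) (10 * x.size + 20) := by
  intro i o u a b c n
  cases x with
  | leaf =>
    have h := runs_caseA_false (p := drop) i o u a b c n
      (runs_pushA (some false) i o u a b c n)
    exact h.mono (by omega)
  | node x y =>
    have h := runs_caseA_true (q := push .A (some false)) i o u _ b c n
      (runs_drop i o u (y.str.map some ++ a) b c n x)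
    have h' := h.mono (show _ ≤ 10 * (Code.node x y).size + 20 by simp only [Code.size]; omega)
    simpa [Code.str, rightProg, Code.right] using h'

/-- Branches on the left subtree of the argument: if it is a leaf, it is removed and `p` is applied
to the right subtree; otherwise `q` is applied to the whole argument. -/
def condProg (p q : Prog) : Prog :=
  caseA (caseA (seq (push .A (some true)) (seq (push .A (some true)) q)) p) skip

theorem realizes_cond_leaf (hp : Realizes p y z t) :
    Realizes (condProg p q) (.node .leaf y) z (t + 10) := by
  intro i o u a b c n
  have h := runs_caseA_true (q := skip) i o u _ b c n (runs_caseA_false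
    (p := seq (push .A (some true)) (seq (push .A (some true)) q)) i o u _ b c n
    (hp i o u a b c n))
  have h' := h.mono (show _ ≤ t + 10 by omega)
  simpa [Code.str, condProg] using h'

theorem realizes_cond_node {x₁ x₂ : Code} (hq : Realizes q (.node (.node x₁ x₂) y) z t) :
    Realizes (condProg p q) (.node (.node x₁ x₂) y) z (t + 10) := by
  intro i o u a b c n
  have h' := hq i o u a b c n
  simp only [Code.str, List.map_cons, List.cons_append] at h'
  have h := runs_caseA_true (q := skip) i o u _ b c n (runs_caseA_true (q := p) i o u _ b c n
    ((runs_pushA (some true) ..).seq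
      ((runs_pushA (some true) ..).seq h')))
  exact h.mono (show _ ≤ t + 10 by omega)

/-- Removes a tree from `A`, putting one mark on `C` for each node of its right spine. -/
def spineProg : Prog := loop .A (fun s => s == some (some true)) fun
  | some (some true) => seq drop (push .C (some true))
  | _ => skip

theorem runs_spineProg (x : Code) (i o u a b c n) :
    Runs spineProg (mem i o u (x.str.map some ++ a) b c n) (10 * x.size)
      (mem i o u a b (List.replicate x.spine (some true) ++ c) n) := by
  induction x generalizing c with
  | leaf =>
    exact (Runs.exit (some (some false)) rfl rfl (update_A ..) (Runs.skip _)).mono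
      (by simp [Code.size])
  | node x y _ ih =>
    have h := ih (some true :: c)
    have h' : Runs spineProg (mem i o u ((Code.node x y).str.map some ++ a) b c n) _ _ :=
      Runs.again (k := Stk.A) (some (some true)) rfl rfl (update_A ..)
        (((by simpa using runs_drop i o u (y.str.map some ++ a) b c n x) :
          Runs drop (mem i o u (List.map some (x.str ++ y.str) ++ a) b c n) (5 * x.size + 4)
            (mem i o u (y.str.map some ++ a) b c n)).seq
          (Runs.push Stk.C (some true) (update_C ..))) h
    have e : List.replicate y.spine (some true) ++ some true :: c =
        List.replicate (Code.node x y).spine (some true) ++ c := by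
      rw [Code.spine, List.replicate_succ', List.append_assoc]; rfl
    rw [e] at h'
    exact h'.mono (by simp only [Code.size]; have := x.size_pos; omega)

/-- Applies `p` as often as there are marks above the topmost separator of `C`. -/
def repeatProg (p : Prog) : Prog := loop .C isLetter fun
  | some (some _) => p
  | _ => skip

theorem runs_repeatProg {y : ℕ → Code} {k : ℕ}
    (hp : ∀ j < k, Realizes p (y j) (y (j + 1)) t) (i o u a b c n) (m j : ℕ) (hj : j + m = k) :
    Runs (repeatProg p)
      (mem i o u ((y j).str.map some ++ a) b (List.replicate m (some true) ++ none :: c) n)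
      (m * (t + 1) + 2) (mem i o u ((y k).str.map some ++ a) b c n) := by
  induction m generalizing j with
  | zero =>
    obtain rfl : j = k := by omega
    exact (Runs.exit (some none) rfl rfl (update_C ..) (Runs.skip _)).mono (by omega)
  | succ m ih =>
    have h := Runs.again (k := Stk.C) (c := isLetter)
      (S := mem i o u ((y j).str.map some ++ a) b
        (List.replicate (m + 1) (some true) ++ none :: c) n)
      (f := fun | some (some _) => p | _ => skip) (some (some true)) rfl rfl (update_C ..)
      (hp j (by omega) i o u a b (List.replicate m (some true) ++ none :: c) n)
      (ih (j + 1) (by omega))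
    exact h.mono (by ring_nf; omega)

/-- Applied to a pair, iterates `p` on its second component as often as the length of the right
spine of its first component. -/
def iterProg (p : Prog) : Prog := caseA (seq (push .C none) (seq spineProg (repeatProg p))) skip

theorem realizes_iter {y : ℕ → Code} (hp : ∀ j < x.spine, Realizes p (y j) (y (j + 1)) t) :
    Realizes (iterProg p) (.node x (y 0)) (y x.spine) (10 * x.size + x.size * (t + 1) + 10) := by
  intro i o u a b c n
  have h := runs_caseA_true (q := skip) i o u _ b c n
    ((Runs.push Stk.C none (update_C ..)).seq
    ((runs_spineProg x i o u ((y 0).str.map some ++ a) b (none :: c) n).seq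
      (runs_repeatProg hp i o u a b c n x.spine 0 (by omega))))
  have hx : x.spine * (t + 1) ≤ x.size * (t + 1) :=
    Nat.mul_le_mul_right _ x.spine_lt_size.le
  have h' := h.mono (show _ ≤ 10 * x.size + x.size * (t + 1) + 10 by omega)
  simpa [Code.str, iterProg] using h'

end StackProg

open HasCode StackProg

/-! ### Polynomial-time functions between types encoded by trees -/

instance : HasCode Unit := ⟨fun _ => .leaf⟩

instance : HasCode Bool := ⟨fun b => bif b then .node .leaf .leaf else .leaf⟩

/-- Natural numbers are encoded in unary. -/
instance : HasCode ℕ := ⟨fun n => n.rec .leaf fun _ x => .node .leaf x⟩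

instance {α β : Type} [HasCode α] [HasCode β] : HasCode (α × β) :=
  ⟨fun p => .node (toCode p.1) (toCode p.2)⟩

instance {α : Type} [HasCode α] : HasCode (List α) :=
  ⟨fun l => l.rec .leaf fun a _ x => .node (toCode a) x⟩

section

variable {α β γ δ : Type} [HasCode α] [HasCode β] [HasCode γ] [HasCode δ]

theorem csize_pos (a : α) : 0 < csize a := Code.size_pos _

theorem csize_pair (a : α) (b : β) : csize (a, b) = csize a + csize b + 1 := rfl

@[simp] theorem csize_nil : csize ([] : List α) = 1 := rfl

@[simp] theorem csize_cons (a : α) (l : List α) : csize (a :: l) = csize a + csize l + 1 := rfl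

theorem csize_bool_le (b : Bool) : csize b ≤ 3 := by cases b <;> decide

theorem csize_nat (n : ℕ) : csize n = 2 * n + 1 := by
  induction n with
  | zero => rfl
  | succ n ih =>
    change 1 + csize n + 1 = _
    omega

theorem csize_append (l₁ l₂ : List α) : csize (l₁ ++ l₂) + 1 = csize l₁ + csize l₂ := by
  induction l₁ with
  | nil => simp; omega
  | cons a l ih => simp only [List.cons_append, csize_cons]; omega

theorem csize_le_of_mem {a : α} {l : List α} (h : a ∈ l) : csize a ≤ csize l := by
  induction l with
  | nil => simp at h
  | cons b l ih =>
    rw [csize_cons]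
    rcases List.mem_cons.1 h with rfl | h
    · omega
    · have := ih h; omega

theorem csize_le_of_suffix {l₁ l₂ : List α} (h : l₁ <:+ l₂) : csize l₁ ≤ csize l₂ := by
  obtain ⟨t, rfl⟩ := h
  have := csize_append t l₁
  have := csize_pos t
  omega

theorem length_lt_csize (l : List α) : l.length < csize l := by
  induction l with
  | nil => simp
  | cons a l ih => simp only [List.length_cons, csize_cons]; have := csize_pos a; omega

theorem spine_toCode_list (l : List α) : (toCode l).spine = l.length := by
  induction l with
  | nil => rfl
  | cons a l ih => exact congrArg (· + 1) ih

theorem Polynomial.eval_mono_nat (P : Polynomial ℕ) {m n : ℕ} (h : m ≤ n) :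
    P.eval m ≤ P.eval n := by
  simp only [Polynomial.eval_eq_sum_range]
  gcongr

/-- `f` is computable in polynomial time, with respect to the encodings by trees. As functions that
occur in the argument of another one keep their parameters, the lemmas below are stated for functions
of an arbitrary argument `a : α`. -/
@[fun_prop]
def PolyTime (f : α → β) : Prop :=
  ∃ (p : Prog) (P : Polynomial ℕ), ∀ a, Realizes p (toCode a) (toCode (f a)) (P.eval (csize a))

/-- `f` is bounded by a polynomial in the size of its argument. -/
def PolyBdd (f : α → ℕ) : Prop := ∃ P : Polynomial ℕ, ∀ a, f a ≤ P.eval (csize a)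

namespace PolyBdd

theorem mono {f g : α → ℕ} (hg : PolyBdd g) (h : ∀ a, f a ≤ g a) : PolyBdd f :=
  let ⟨P, hP⟩ := hg; ⟨P, fun a => (h a).trans (hP a)⟩

theorem const (n : ℕ) : PolyBdd fun _ : α => n := ⟨Polynomial.C n, fun _ => by simp⟩

theorem self : PolyBdd fun a : α => csize a := ⟨Polynomial.X, fun a => by simp⟩

theorem add {f g : α → ℕ} (hf : PolyBdd f) (hg : PolyBdd g) : PolyBdd fun a => f a + g a :=
  let ⟨P, hP⟩ := hf
  let ⟨Q, hQ⟩ := hg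
  ⟨P + Q, fun a => by rw [Polynomial.eval_add]; exact add_le_add (hP a) (hQ a)⟩

theorem mul {f g : α → ℕ} (hf : PolyBdd f) (hg : PolyBdd g) : PolyBdd fun a => f a * g a :=
  let ⟨P, hP⟩ := hf
  let ⟨Q, hQ⟩ := hg
  ⟨P * Q, fun a => by rw [Polynomial.eval_mul]; exact Nat.mul_le_mul (hP a) (hQ a)⟩

theorem eval {f : α → ℕ} (hf : PolyBdd f) (Q : Polynomial ℕ) : PolyBdd fun a => Q.eval (f a) :=
  let ⟨P, hP⟩ := hf
  ⟨Q.comp P, fun a => by rw [Polynomial.eval_comp]; exact Q.eval_mono_nat (hP a)⟩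

theorem comp {f : β → ℕ} (hf : PolyBdd f) {g : α → β} (hg : PolyBdd fun a => csize (g a)) :
    PolyBdd fun a => f (g a) :=
  let ⟨P, hP⟩ := hf
  (hg.eval P).mono fun a => hP (g a)

end PolyBdd

namespace PolyTime

/-- A program whose running time is bounded by a polynomial. -/
theorem of_bdd {f : α → β} (p : Prog) {t : α → ℕ} (ht : PolyBdd t)
    (h : ∀ a, Realizes p (toCode a) (toCode (f a)) (t a)) : PolyTime f :=
  let ⟨P, hP⟩ := ht; ⟨p, P, fun a => (h a).mono (hP a)⟩

theorem exists_bdd {f : α → β} (hf : PolyTime f) : ∃ (p : Prog) (t : α → ℕ),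
    PolyBdd t ∧ ∀ a, Realizes p (toCode a) (toCode (f a)) (t a) :=
  let ⟨p, P, h⟩ := hf; ⟨p, fun a => P.eval (csize a), ⟨P, fun _ => le_rfl⟩, h⟩

theorem bdd {f : α → β} (hf : PolyTime f) : PolyBdd fun a => csize (f a) :=
  let ⟨_, _, ht, h⟩ := hf.exists_bdd
  (PolyBdd.self.add ht).mono fun a => (h a).size_le

theorem of_code_eq {f : α → β} (h : ∀ a, toCode (f a) = toCode a) : PolyTime f :=
  of_bdd skip (PolyBdd.const 1) fun a i o u _ b c n => by rw [h]; exact Runs.skip _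

@[fun_prop]
theorem id : PolyTime fun a : α => a := of_code_eq fun _ => rfl

@[fun_prop]
theorem const (b : β) : PolyTime fun _ : α => b :=
  of_bdd _ (((PolyBdd.const 5).mul .self).add (.const _)) fun _ => (realizes_const _ _).mono
    (add_assoc _ _ _).le

@[fun_prop]
theorem comp {g : β → γ} {f : α → β} (hg : PolyTime g) (hf : PolyTime f) :
    PolyTime fun a => g (f a) :=
  let ⟨_, _, ht, h⟩ := hf.exists_bdd
  let ⟨_, _, hs, k⟩ := hg.exists_bdd
  of_bdd _ (ht.add (hs.comp hf.bdd)) fun a => (h a).comp (k (f a))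

@[fun_prop]
theorem prodMk {f : α → β} {g : α → γ} (hf : PolyTime f) (hg : PolyTime g) :
    PolyTime fun a => (f a, g a) :=
  let ⟨_, _, ht, h⟩ := hf.exists_bdd
  let ⟨_, _, hs, k⟩ := hg.exists_bdd
  of_bdd _ (((((PolyBdd.const 25).mul .self).add ((PolyBdd.const 11).mul ht)).add hs).add
    (.const 40)) fun a => (h a).pair (k a)

theorem of_left {f : α → β} (h : ∀ a, toCode (f a) = (toCode a).left) : PolyTime f :=
  of_bdd _ (((PolyBdd.const 10).mul .self).add (.const 20))
    fun a => by rw [h]; exact realizes_left _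

theorem of_right {f : α → β} (h : ∀ a, toCode (f a) = (toCode a).right) : PolyTime f :=
  of_bdd _ (((PolyBdd.const 10).mul .self).add (.const 20))
    fun a => by rw [h]; exact realizes_right _

@[fun_prop]
theorem fst {f : α → β × γ} (hf : PolyTime f) : PolyTime fun a => (f a).1 :=
  (of_left fun _ => rfl : PolyTime fun p : β × γ => p.1).comp hf

@[fun_prop]
theorem snd {f : α → β × γ} (hf : PolyTime f) : PolyTime fun a => (f a).2 :=
  (of_right fun _ => rfl : PolyTime fun p : β × γ => p.2).comp hf

theorem congr {f g : α → β} (hf : PolyTime f) (h : ∀ a, f a = g a) : PolyTime g := funext h ▸ hf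

/-- Case distinction on whether the code of `c a` is a leaf. If it is not, a program may use the
two subtrees of that code. -/
theorem of_cond {c : α → δ} {f : α → β} (hc : PolyTime c) (hf : PolyTime f) {k : α → β}
    (q : Prog) (P : Polynomial ℕ) (h₀ : ∀ a, toCode (c a) = .leaf → k a = f a)
    (h₁ : ∀ a, toCode (c a) ≠ .leaf →
      Realizes q (toCode (c a, a)) (toCode (k a)) (P.eval (csize (c a, a)))) : PolyTime k := by
  obtain ⟨p, s, hs, hp⟩ := hf.exists_bdd
  have hm : PolyTime fun a => (c a, a) := hc.prodMk id
  obtain ⟨r, u, hu, hr⟩ := hm.exists_bdd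
  refine of_bdd (seq r (condProg p q)) ((hu.add (hs.add (hm.bdd.eval P))).add (.const 10)) ?_
  intro a
  have hra : Realizes r (toCode a) (.node (toCode (c a)) (toCode a)) (u a) := hr a
  by_cases h : toCode (c a) = .leaf
  · rw [h] at hra
    rw [h₀ a h]
    exact (hra.comp (realizes_cond_leaf (hp a))).mono (by omega)
  · have hqa : Realizes q (.node (toCode (c a)) (toCode a)) _ _ := h₁ a h
    obtain ⟨x₁, x₂, hx⟩ : ∃ x₁ x₂, toCode (c a) = .node x₁ x₂ := by
      cases hx : toCode (c a) with
      | leaf => exact absurd hx h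
      | node x₁ x₂ => exact ⟨x₁, x₂, rfl⟩
    rw [hx] at hra hqa
    exact (hra.comp (realizes_cond_node hqa)).mono (by omega)

@[fun_prop]
theorem cond {c : α → Bool} {f g : α → β} (hc : PolyTime c) (hf : PolyTime f) (hg : PolyTime g) :
    PolyTime fun a => bif c a then f a else g a := by
  obtain ⟨q, P, hq⟩ : PolyTime fun p : Bool × α => f p.2 := by fun_prop
  refine of_cond hc hg q P (fun a h => ?_) fun a h => ?_
  · cases hca : c a
    · rfl
    · rw [hca] at h
      exact Code.noConfusion h
  · cases hca : c a
    · exact absurd (by rw [hca]; rfl) h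
    · have := hq (c a, a)
      rwa [hca] at this

@[fun_prop]
theorem not {c : α → Bool} (hc : PolyTime c) : PolyTime fun a => !c a :=
  (show PolyTime fun a => bif c a then false else true by fun_prop).congr
    fun a => by cases c a <;> rfl

@[fun_prop]
theorem and {c d : α → Bool} (hc : PolyTime c) (hd : PolyTime d) :
    PolyTime fun a => c a && d a :=
  (show PolyTime fun a => bif c a then d a else false by fun_prop).congr
    fun a => by cases c a <;> rfl

@[fun_prop]
theorem or {c d : α → Bool} (hc : PolyTime c) (hd : PolyTime d) :
    PolyTime fun a => c a || d a :=
  (show PolyTime fun a => bif c a then true else d a by fun_prop).congr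
    fun a => by cases c a <;> rfl

@[fun_prop]
theorem casesOn_list {l : α → List β} {f : α → γ} {g : α → β → List β → γ} (hl : PolyTime l)
    (hf : PolyTime f) (hg : PolyTime fun p : (β × List β) × α => g p.2 p.1.1 p.1.2) :
    PolyTime fun a => (List.casesOn (l a) (f a) (g a) : γ) := by
  obtain ⟨q, P, hq⟩ := hg
  refine of_cond hl hf q P (fun a h => ?_) fun a h => ?_
  · cases hla : l a with
    | nil => rfl
    | cons x xs => rw [hla] at h; exact Code.noConfusion h
  · cases hla : l a with
    | nil => exact absurd (by rw [hla]; rfl) h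
    | cons x xs => exact hq ((x, xs), a)

/-- Iterating a function takes polynomial time if the number of rounds is given by the length of a
list and the intermediate results are of polynomial size. -/
theorem iterate {l : α → List β} {f : γ → γ} {y : α → γ} (hl : PolyTime l) (hf : PolyTime f)
    (hy : PolyTime y) {s : α → ℕ} (hs : PolyBdd s)
    (h : ∀ a, ∀ i ≤ (l a).length, csize (f^[i] (y a)) ≤ s a) :
    PolyTime fun a => f^[(l a).length] (y a) := by
  obtain ⟨p, P, hp⟩ := hf
  have hm := hl.prodMk hy
  obtain ⟨r, u, hu, hr⟩ := hm.exists_bdd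
  refine of_bdd (seq r (iterProg p)) (hu.add ((((PolyBdd.const 10).mul hl.bdd).add
    (hl.bdd.mul ((hs.eval P).add (.const 1)))).add (.const 10))) fun a => (hr a).comp ?_
  rw [← spine_toCode_list]
  refine realizes_iter (y := fun i => toCode (f^[i] (y a))) fun j hj => ?_
  rw [spine_toCode_list] at hj
  rw [Function.iterate_succ_apply']
  exact (hp _).mono (P.eval_mono_nat (h a j hj.le))

@[fun_prop]
theorem cons {x : α → β} {l : α → List β} (hx : PolyTime x) (hl : PolyTime l) :
    PolyTime fun a => x a :: l a :=
  (of_code_eq fun _ => rfl : PolyTime fun p : β × List β => p.1 :: p.2).comp (hx.prodMk hl)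

@[fun_prop]
theorem tail {l : α → List β} (hl : PolyTime l) : PolyTime fun a => (l a).tail :=
  (of_right fun l => by cases l <;> rfl : PolyTime fun l : List β => l.tail).comp hl

@[fun_prop]
theorem headD {l : α → List β} {x : α → β} (hl : PolyTime l) (hx : PolyTime x) :
    PolyTime fun a => (l a).headD (x a) :=
  (casesOn_list (g := fun _ x _ => x) hl hx (by fun_prop)).congr fun a => by cases l a <;> rfl

/-- A left fold takes polynomial time if the step function does and the intermediate results are
of polynomial size. -/
theorem foldl_of_bdd {l : α → List β} {g : α → γ → β → γ} {y : α → γ} (hl : PolyTime l)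
    (hg : PolyTime fun p : α × γ × β => g p.1 p.2.1 p.2.2) (hy : PolyTime y) {s : α → ℕ}
    (hs : PolyBdd s)
    (h : ∀ a, ∀ i ≤ (l a).length, csize (((l a).take i).foldl (g a) (y a)) ≤ s a) :
    PolyTime fun a => (l a).foldl (g a) (y a) := by
  -- iterate on the remaining list, the parameter, and the intermediate result
  let f : List β × α × γ → List β × α × γ := fun p =>
    List.casesOn p.1 p fun x xs => (xs, p.2.1, g p.2.1 p.2.2 x)
  have hf : PolyTime f :=
    casesOn_list (g := fun p x xs => (xs, p.2.1, g p.2.1 p.2.2 x)) (by fun_prop) (by fun_prop)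
      ((by fun_prop : PolyTime fun p : (β × List β) × List β × α × γ => p.1.2).prodMk
        ((by fun_prop : PolyTime fun p : (β × List β) × List β × α × γ => p.2.2.1).prodMk
          (hg.comp (f := fun p : (β × List β) × List β × α × γ => (p.2.2.1, p.2.2.2, p.1.1))
            (by fun_prop))))
  have hi : ∀ (a : α) (i : ℕ), i ≤ (l a).length → f^[i] (l a, a, y a) =
      ((l a).drop i, a, ((l a).take i).foldl (g a) (y a)) := by
    intro a i hi
    induction i with
    | zero => simp
    | succ i ih =>
      rw [Function.iterate_succ_apply', ih (by omega), List.take_add_one,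
        List.getElem?_eq_getElem (by omega), List.foldl_append, List.drop_eq_getElem_cons (by omega)]
      rfl
  have := iterate (y := fun a => (l a, a, y a)) (s := fun a => csize (l a) + (csize a + s a + 1) + 1)
    hl hf (by fun_prop) ((hl.bdd.add ((PolyBdd.self.add hs).add (.const 1))).add (.const 1))
    (fun a i hia => by
      rw [hi a i hia, csize_pair, csize_pair]
      have := csize_le_of_suffix (List.drop_suffix i (l a))
      have := h a i hia
      omega)
  exact (this.snd.snd).congr fun a => by rw [hi a _ le_rfl, List.take_length]

/-- A left fold takes polynomial time if the step function does and every step adds at most a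
polynomial amount to the size of the intermediate result. -/
theorem foldl_of_add {l : α → List β} {g : α → γ → β → γ} {y : α → γ} (hl : PolyTime l)
    (hg : PolyTime fun p : α × γ × β => g p.1 p.2.1 p.2.2) (hy : PolyTime y) {s : α → ℕ}
    (hs : PolyBdd s)
    (h : ∀ a, ∀ x ∈ l a, ∀ c, csize (g a c x) ≤ csize c + s a) :
    PolyTime fun a => (l a).foldl (g a) (y a) := by
  refine foldl_of_bdd hl hg hy (s := fun a => csize (y a) + csize (l a) * s a)
    (hy.bdd.add (hl.bdd.mul hs)) fun a i hi => ?_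
  have key : ∀ (m : List β) (c : γ), (∀ x ∈ m, x ∈ l a) →
      csize (m.foldl (g a) c) ≤ csize c + m.length * s a := by
    intro m
    induction m with
    | nil => intro c _; simp
    | cons x m ih =>
      intro c hm
      have h₁ := ih (g a c x) fun z hz => hm z (List.mem_cons_of_mem _ hz)
      have h₂ := h a x (hm x List.mem_cons_self) c
      simp only [List.foldl_cons, List.length_cons, Nat.add_mul]
      omega
  refine (key _ _ fun x hx => List.mem_of_mem_take hx).trans ?_
  gcongr
  exact (List.length_take_le' i _).trans (length_lt_csize _).le

theorem foldl_bool {l : α → List β} {g : α → Bool → β → Bool} {y : α → Bool} (hl : PolyTime l)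
    (hg : PolyTime fun p : α × Bool × β => g p.1 p.2.1 p.2.2) (hy : PolyTime y) :
    PolyTime fun a => (l a).foldl (g a) (y a) :=
  foldl_of_bdd hl hg hy (.const 3) fun _ _ _ => csize_bool_le _

@[fun_prop]
theorem reverse {l : α → List β} (hl : PolyTime l) : PolyTime fun a => (l a).reverse :=
  (foldl_of_add (g := fun _ c x => x :: c) (y := fun _ => []) hl (by fun_prop) (by fun_prop)
    (hl.bdd.add (.const 1)) fun a x hx c => by
      have := csize_le_of_mem hx
      rw [csize_cons]; omega).congr fun a => by simp

theorem foldr_bool {l : α → List β} {g : α → β → Bool → Bool} {y : α → Bool} (hl : PolyTime l)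
    (hg : PolyTime fun p : α × Bool × β => g p.1 p.2.2 p.2.1) (hy : PolyTime y) :
    PolyTime fun a => (l a).foldr (g a) (y a) :=
  (foldl_bool (g := fun a c x => g a x c) hl.reverse hg hy).congr fun a => by
    rw [List.foldl_reverse]

@[fun_prop]
theorem append {l m : α → List β} (hl : PolyTime l) (hm : PolyTime m) :
    PolyTime fun a => l a ++ m a :=
  (foldl_of_add (g := fun _ c x => x :: c) hl.reverse (by fun_prop) hm
    (hl.bdd.add (.const 1)) fun a x hx c => by
      have := csize_le_of_mem (List.mem_reverse.1 hx)
      rw [csize_cons]; omega).congr fun a => by simp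

theorem bdd_of_mem {f : α → β → γ} {l : α → List β}
    (hf : PolyTime fun p : α × β => f p.1 p.2) (hl : PolyTime l) :
    ∃ s, PolyBdd s ∧ ∀ a, ∀ x ∈ l a, csize (f a x) ≤ s a := by
  obtain ⟨P, hP⟩ := hf.bdd
  refine ⟨_, ((PolyBdd.self.add hl.bdd).add (.const 1)).eval P, fun a x hx =>
    (hP (a, x)).trans (P.eval_mono_nat ?_)⟩
  rw [csize_pair]
  have := csize_le_of_mem hx
  omega

@[fun_prop]
theorem map {f : α → β → γ} {l : α → List β} (hf : PolyTime fun p : α × β => f p.1 p.2)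
    (hl : PolyTime l) : PolyTime fun a => (l a).map (f a) := by
  obtain ⟨s, hs, h⟩ := bdd_of_mem hf hl
  refine ((foldl_of_add (g := fun a c x => f a x :: c) (y := fun _ => []) hl
    ((hf.comp (f := fun p : α × List γ × β => (p.1, p.2.2)) (by fun_prop)).cons (by fun_prop))
    (by fun_prop) (hs.add (.const 1)) fun a x hx c => ?_).reverse).congr fun a => ?_
  · have := h a x hx
    rw [csize_cons]; omega
  · rw [← List.foldr_reverse]
    simp

@[fun_prop]
theorem flatMap {f : α → β → List γ} {l : α → List β} (hf : PolyTime fun p : α × β => f p.1 p.2)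
    (hl : PolyTime l) : PolyTime fun a => (l a).flatMap (f a) := by
  obtain ⟨s, hs, h⟩ := bdd_of_mem hf hl
  refine (foldl_of_add (g := fun a c x => c ++ f a x) (y := fun _ => []) hl
    ((by fun_prop : PolyTime fun p : α × List γ × β => p.2.1).append
      (hf.comp (f := fun p : α × List γ × β => (p.1, p.2.2)) (by fun_prop)))
    (by fun_prop) hs fun a x hx c => ?_).congr fun a => ?_
  · have := h a x hx
    have := csize_append c (f a x)
    omega
  · rw [List.flatMap_eq_foldl]

@[fun_prop]
theorem filter {f : α → β → Bool} {l : α → List β} (hf : PolyTime fun p : α × β => f p.1 p.2)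
    (hl : PolyTime l) : PolyTime fun a => (l a).filter (f a) := by
  have h : PolyTime fun a => (l a).flatMap fun x => bif f a x then [x] else [] := by fun_prop
  exact h.congr fun a => by
    induction l a with
    | nil => rfl
    | cons x l ih =>
      rw [List.flatMap_cons, ih]
      cases hx : f a x <;> simp [hx]

@[fun_prop]
theorem all {f : α → β → Bool} {l : α → List β} (hf : PolyTime fun p : α × β => f p.1 p.2)
    (hl : PolyTime l) : PolyTime fun a => (l a).all (f a) :=
  (foldr_bool (g := fun a x c => f a x && c) (y := fun _ => true) hl (by fun_prop)
    (by fun_prop)).congr fun a => by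
      induction l a with
      | nil => rfl
      | cons x l ih => simp [← ih]

@[fun_prop]
theorem any {f : α → β → Bool} {l : α → List β} (hf : PolyTime fun p : α × β => f p.1 p.2)
    (hl : PolyTime l) : PolyTime fun a => (l a).any (f a) :=
  (foldr_bool (g := fun a x c => f a x || c) (y := fun _ => false) hl (by fun_prop)
    (by fun_prop)).congr fun a => by
      induction l a with
      | nil => rfl
      | cons x l ih => simp [← ih]

end PolyTime

end

section

variable {α β γ δ : Type} [HasCode α] [HasCode β] [HasCode γ] [HasCode δ]

namespace PolyTime

/-! ### Arithmetic on unary numbers -/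

theorem of_toCode_eq {f : α → β} {g : α → γ} (hg : PolyTime g)
    (h : ∀ a, toCode (f a) = toCode (g a)) : PolyTime f :=
  let ⟨p, P, hp⟩ := hg; ⟨p, P, fun a => h a ▸ hp a⟩

@[fun_prop]
theorem replicate {f : α → ℕ} (hf : PolyTime f) :
    PolyTime fun a => List.replicate (f a) () :=
  of_toCode_eq hf fun a => by
    induction f a with
    | zero => rfl
    | succ n ih =>
      change Code.node _ (toCode (List.replicate n ())) = _
      rw [ih]; rfl

@[fun_prop]
theorem length {l : α → List β} (hl : PolyTime l) : PolyTime fun a => (l a).length :=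
  of_toCode_eq (g := fun a => (l a).map fun _ => ()) (by fun_prop) fun a => by
    induction l a with
    | nil => rfl
    | cons x l ih =>
      change Code.node _ (toCode l.length) = _
      rw [ih]; rfl

@[fun_prop]
theorem natAdd {f g : α → ℕ} (hf : PolyTime f) (hg : PolyTime g) : PolyTime fun a => f a + g a :=
  (show PolyTime fun a => (List.replicate (f a) () ++ List.replicate (g a) ()).length by
    fun_prop).congr fun a => by simp

@[fun_prop]
theorem natMul {f g : α → ℕ} (hf : PolyTime f) (hg : PolyTime g) : PolyTime fun a => f a * g a :=
  (show PolyTime fun a =>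
      ((List.replicate (f a) ()).flatMap fun _ => List.replicate (g a) ()).length by
    fun_prop).congr fun a => by simp

@[fun_prop]
theorem drop {n : α → ℕ} {l : α → List β} (hn : PolyTime n) (hl : PolyTime l) :
    PolyTime fun a => (l a).drop (n a) := by
  have e : ∀ (l : List β) (i : ℕ), List.tail^[i] l = l.drop i := by
    intro l i
    induction i with
    | zero => rfl
    | succ i ih => rw [Function.iterate_succ_apply', ih, List.tail_drop]
  refine (iterate (l := fun a => List.replicate (n a) ()) (f := fun l : List β => l.tail) (y := l)
    (by fun_prop) (by fun_prop) hl hl.bdd fun a i _ => ?_).congr fun a => ?_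
  · rw [e]
    exact csize_le_of_suffix (List.drop_suffix _ _)
  · rw [e, List.length_replicate]

@[fun_prop]
theorem natSub {f g : α → ℕ} (hf : PolyTime f) (hg : PolyTime g) : PolyTime fun a => f a - g a :=
  (show PolyTime fun a => ((List.replicate (f a) ()).drop (g a)).length by
    fun_prop).congr fun a => by simp

@[fun_prop]
theorem getD {l : α → List β} {n : α → ℕ} {x : α → β} (hl : PolyTime l) (hn : PolyTime n)
    (hx : PolyTime x) : PolyTime fun a => (l a).getD (n a) (x a) :=
  (show PolyTime fun a => ((l a).drop (n a)).headD (x a) by fun_prop).congr fun a => by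
    rw [List.headD_eq_head?_getD, List.head?_drop, List.getD_eq_getElem?_getD]

@[fun_prop]
theorem isEmpty {l : α → List β} (hl : PolyTime l) : PolyTime fun a => (l a).isEmpty :=
  (casesOn_list (f := fun _ => true) (g := fun _ _ _ => false) hl (by fun_prop)
    (by fun_prop)).congr fun a => by cases l a <;> rfl

@[fun_prop]
theorem natLt {f g : α → ℕ} (hf : PolyTime f) (hg : PolyTime g) :
    PolyTime fun a => decide (f a < g a) :=
  (show PolyTime fun a => !(List.replicate (g a - f a) ()).isEmpty by fun_prop).congr fun a => by
    rw [Bool.eq_iff_iff]; simp; omega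

@[fun_prop]
theorem natLe {f g : α → ℕ} (hf : PolyTime f) (hg : PolyTime g) :
    PolyTime fun a => decide (f a ≤ g a) :=
  (show PolyTime fun a => (List.replicate (f a - g a) ()).isEmpty by fun_prop).congr fun a => by
    rw [Bool.eq_iff_iff]; simp; omega

@[fun_prop]
theorem natEq {f g : α → ℕ} (hf : PolyTime f) (hg : PolyTime g) :
    PolyTime fun a => decide (f a = g a) :=
  (show PolyTime fun a => decide (f a ≤ g a) && decide (g a ≤ f a) by fun_prop).congr
    fun a => by rw [Bool.eq_iff_iff]; simp; omega

@[fun_prop]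
theorem natMin {f g : α → ℕ} (hf : PolyTime f) (hg : PolyTime g) :
    PolyTime fun a => min (f a) (g a) :=
  (show PolyTime fun a => f a - (f a - g a) by fun_prop).congr fun a => by omega

@[fun_prop]
theorem natMax {f g : α → ℕ} (hf : PolyTime f) (hg : PolyTime g) :
    PolyTime fun a => max (f a) (g a) :=
  (show PolyTime fun a => f a + (g a - f a) by fun_prop).congr fun a => by omega

theorem csize_le_of_forall {l : List β} {s : ℕ} (h : ∀ x ∈ l, csize x ≤ s) :
    csize l ≤ l.length * (s + 1) + 1 := by
  induction l with
  | nil => simp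
  | cons x l ih =>
    have h₁ := h x List.mem_cons_self
    have h₂ := ih fun y hy => h y (List.mem_cons_of_mem _ hy)
    simp only [csize_cons, List.length_cons, Nat.add_mul]
    omega

@[fun_prop]
theorem range {n : α → ℕ} (hn : PolyTime n) : PolyTime fun a => List.range (n a) := by
  have e : ∀ i, (List.replicate i ()).foldl (fun c _ => c ++ [c.length]) [] = List.range i := by
    intro i
    induction i with
    | zero => rfl
    | succ i ih => rw [List.replicate_succ', List.foldl_append, ih, List.range_succ]; simp
  refine (foldl_of_bdd (l := fun a => List.replicate (n a) ()) (γ := List ℕ)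
    (g := fun _ c _ => c ++ [c.length]) (y := fun _ => []) (s := fun a => csize (n a) *
    (csize (n a) + 1) + 1) (by fun_prop) (by fun_prop) (by fun_prop)
    ((hn.bdd.mul (hn.bdd.add (.const 1))).add (.const 1)) fun a i hi => ?_).congr fun a => e _
  rw [List.length_replicate] at hi
  rw [List.take_replicate, e, min_eq_left hi]
  refine (csize_le_of_forall (s := csize (n a)) fun x hx => ?_).trans ?_
  · rw [List.mem_range] at hx
    rw [csize_nat, csize_nat]; omega
  · rw [List.length_range]
    gcongr
    rw [csize_nat]; omega

/-- Addition of `1` to a binary number, least significant digit first. -/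
def incBits : List Bool → List Bool
  | [] => [true]
  | false :: l => true :: l
  | true :: l => false :: incBits l

theorem bits_succ (n : ℕ) : (n + 1).bits = incBits n.bits := by
  induction n using Nat.binaryRec' with
  | zero => simp [incBits]
  | bit b n h ih =>
    rw [Nat.bits_append_bit n b h]
    cases b with
    | false =>
      rw [show Nat.bit false n + 1 = Nat.bit true n by simp [Nat.bit_val],
        Nat.bits_append_bit n true (by simp)]
      rfl
    | true =>
      rw [show Nat.bit true n + 1 = Nat.bit false (n + 1) by simp [Nat.bit_val]; ring,
        Nat.bits_append_bit (n + 1) false (by simp), ih]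
      rfl

/-- Addition of `1` as a left fold that carries along the overflow and the digits written so far. -/
theorem foldl_incBits (l : List Bool) (c : Bool) (m : List Bool) :
    (fun p : Bool × List Bool => bif p.1 then p.2 ++ [true] else p.2)
      (l.foldl (fun p b => (p.1 && b, p.2 ++ [bif p.1 then !b else b])) (c, m)) =
      m ++ bif c then incBits l else l := by
  induction l generalizing c m with
  | nil => cases c <;> simp [incBits]
  | cons b l ih => rw [List.foldl_cons, ih]; cases b <;> cases c <;> simp [incBits]

theorem polyTime_incBits : PolyTime incBits := by
  have h : PolyTime fun l : List Bool =>
      l.foldl (fun p b => (p.1 && b, p.2 ++ [bif p.1 then !b else b]))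
        ((true, []) : Bool × List Bool) :=
    foldl_of_add (l := fun l : List Bool => l)
      (g := fun _ (p : Bool × List Bool) b => (p.1 && b, p.2 ++ [bif p.1 then !b else b]))
      (y := fun _ => (true, [])) (by fun_prop) (by fun_prop) (by fun_prop) (.const 10)
      fun a b hb p => by
        have h₁ := csize_bool_le (p.1 && b)
        have h₂ := csize_bool_le (bif p.1 then !b else b)
        have h₃ := csize_append p.2 [bif p.1 then !b else b]
        rw [csize_cons, csize_nil] at h₃
        have h₄ := csize_pair p.1 p.2
        rw [csize_pair]
        change csize p = _ at h₄
        omega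
  have h' : PolyTime fun p : Bool × List Bool => bif p.1 then p.2 ++ [true] else p.2 := by
    fun_prop
  exact (h'.comp h).congr fun l => by simpa using foldl_incBits l true []

theorem csize_incBits_le (l : List Bool) : csize (incBits l) ≤ csize l + 4 := by
  induction l with
  | nil => decide
  | cons b l ih =>
    cases b with
    | false =>
      have : csize true = csize false + 2 := by decide
      simp only [incBits, csize_cons]; omega
    | true =>
      have : csize true = csize false + 2 := by decide
      simp only [incBits, csize_cons]; omega

@[fun_prop]
theorem natBits {f : α → ℕ} (hf : PolyTime f) : PolyTime fun a => (f a).bits := by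
  refine (foldl_of_add (l := fun a => List.replicate (f a) ()) (g := fun _ c _ => incBits c)
    (y := fun _ => []) (by fun_prop)
    (polyTime_incBits.comp (f := fun p : α × List Bool × Unit => p.2.1) (by fun_prop))
    (by fun_prop) (.const 4) fun a x hx c => csize_incBits_le c).congr fun a => ?_
  induction f a with
  | zero => simp
  | succ n ih => rw [List.replicate_succ', List.foldl_append, ih, bits_succ]; rfl

/-- The value of a binary number, cut off at `m`. The values of this function are of polynomial size
in `m` although numbers are encoded in unary. -/
def ofBits (m : ℕ) (l : List Bool) : ℕ := l.foldr (fun b v => min m (2 * v + bif b then 1 else 0)) 0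

theorem ofBits_bits {m n : ℕ} (h : n ≤ m) : ofBits m n.bits = n := by
  induction n using Nat.binaryRec' with
  | zero => simp [ofBits]
  | bit b n hn ih =>
    have hb : Nat.bit b n = 2 * n + bif b then 1 else 0 := by cases b <;> simp [Nat.bit_val]
    rw [Nat.bits_append_bit n b hn, ofBits, List.foldr_cons]
    change min m (2 * ofBits m n.bits + _) = _
    rw [ih (by omega), ← hb, min_eq_right h]

@[fun_prop]
theorem polyTime_ofBits {m : α → ℕ} {l : α → List Bool} (hm : PolyTime m) (hl : PolyTime l) :
    PolyTime fun a => ofBits (m a) (l a) := by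
  have hm' : PolyTime fun p : α × ℕ × Bool => m p.1 := hm.comp (by fun_prop)
  have hle : ∀ m l, ofBits m l ≤ m := by
    intro m l
    cases l with
    | nil => exact Nat.zero_le _
    | cons b l => exact min_le_left _ _
  refine (foldl_of_bdd (l := fun a => (l a).reverse) (γ := ℕ)
    (g := fun a v b => min (m a) (2 * v + bif b then 1 else 0)) (y := fun _ => 0) (by fun_prop)
    (by fun_prop) (by fun_prop) hm.bdd fun a i hi => ?_).congr fun a => ?_
  · rw [← List.reverse_reverse ((l a).reverse.take i), List.foldl_reverse, csize_nat, csize_nat]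
    have := hle (m a) ((l a).reverse.take i).reverse
    unfold ofBits at this
    omega
  · rw [List.foldl_reverse]; rfl

end PolyTime

/-! ### Words over the input alphabet -/

/-- The letters of the input alphabet as short lists. -/
def Tok.view : Tok → List (List Bool)
  | .item => []
  | .close => [[]]
  | .bit b => [[b]]

instance : HasCode Tok := ⟨fun t => toCode t.view⟩

namespace PolyTime

@[fun_prop]
theorem tokBit {f : α → Bool} (hf : PolyTime f) : PolyTime fun a => Tok.bit (f a) :=
  of_toCode_eq (g := fun a => [[f a]]) (by fun_prop) fun _ => rfl

@[fun_prop]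
theorem tokView {f : α → Tok} (hf : PolyTime f) : PolyTime fun a => (f a).view :=
  of_toCode_eq hf fun _ => rfl

end PolyTime

end

/-! ### From programs on trees to Turing machines -/

namespace StackProg

theorem csize_tok_le (t : Tok) : csize t ≤ 7 := by
  rcases t with b | _ | _
  · cases b <;> decide
  · decide
  · decide

/-- Writes a word on `B`, first letter first. -/
def wordB : List Bool → Prog
  | [] => skip
  | s :: l => seq (push .B (some s)) (wordB l)

theorem runs_wordB (l : List Bool) (i o u a b c n) :
    Runs (wordB l) (mem i o u a b c n) (l.length + 1)
      (mem i o u a (l.reverse.map some ++ b) c n) := by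
  induction l generalizing b with
  | nil => exact Runs.skip _
  | cons s l ih =>
    have h := Runs.seq (Runs.push (S := mem i o u a b c n) Stk.B (some s) (update_B ..))
      (ih (some s :: b))
    have h' := h.mono (show _ ≤ (s :: l).length + 1 by simp only [List.length_cons]; omega)
    simpa [wordB] using h'

/-- The main loop of `readInput`. -/
def readLoop : Prog := loop .inp (fun t => t.isSome) fun
  | some t => wordB (true :: (toCode t).str)
  | none => push .B (some false)

/-- Replaces the input by its encoding as a tree, on the stack `A`. -/
def readInput : Prog := seq (push .B none) (seq readLoop fromB)

theorem runs_readLoop (l : List Tok) (o u a b c n) :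
    Runs readLoop (mem l o u a b c n) (10 * l.length + 2)
      (mem [] o u a ((toCode l).str.reverse.map some ++ b) c n) := by
  induction l generalizing b with
  | nil =>
    unfold readLoop
    exact (Runs.exit (S := mem [] o u a b c n) none rfl rfl (update_inp ..)
      (Runs.push Stk.B (some false) (update_B ..))).mono le_rfl
  | cons t l ih =>
    have h₁ := runs_wordB (true :: (toCode t).str) l o u a b c n
    have h₂ := ih ((true :: (toCode t).str).reverse.map some ++ b)
    have h : Runs readLoop (mem (t :: l) o u a b c n) _ _ :=
      Runs.again (k := Stk.inp) (some t) rfl rfl (update_inp ..) h₁ h₂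
    have ht := csize_tok_le t
    unfold csize at ht
    have h' := h.mono (show _ ≤ 10 * (t :: l).length + 2 by
      simp only [List.length_cons, Code.length_str]; omega)
    have e : toCode (t :: l) = .node (toCode t) (toCode l) := rfl
    simpa [e, Code.str] using h'

theorem csize_toks_le (l : List Tok) : csize l ≤ 8 * l.length + 1 := by
  have := PolyTime.csize_le_of_forall (l := l) fun t _ => csize_tok_le t
  omega

theorem runs_readInput (l : List Tok) :
    Runs readInput (mem l [] [] [] [] [] []) (100 * l.length + 100)
      (mem [] [] [] ((toCode l).str.map some) [] [] []) := by
  have h₁ := runs_readLoop l [] [] [] [none] [] []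
  have h₂ := runs_fromB [] [] [] [] [] [] [] (toCode l)
  simp only [Code.saved, List.append_nil] at h₂
  have h := Runs.seq (Runs.push (S := mem l [] [] [] [] [] []) Stk.B none (update_B ..))
    (h₁.seq h₂)
  have hl := csize_toks_le l
  unfold csize at hl
  exact h.mono (by omega)

/-- Takes the code of a letter from `A` and writes the letter on the output stack. -/
def writeTok : Prog :=
  caseA (caseA (caseA (seq drop (seq drop (seq drop (seq drop (push .outT (.bit true))))))
    (seq drop (seq drop (push .outT (.bit false))))) (seq drop (push .outT .close)))
    (push .outT .item)

theorem runs_writeTok (t : Tok) (i o u a b c n) :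
    Runs writeTok (mem i o u ((toCode t).str.map some ++ a) b c n) 60
      (mem i (t :: o) u a b c n) := by
  have hd : ∀ a, Runs drop (mem i o u (some false :: a) b c n) 9 (mem i o u a b c n) :=
    fun a => runs_drop i o u a b c n .leaf
  have hw : ∀ t a, Runs (push .outT t) (mem i o u a b c n) 1 (mem i (t :: o) u a b c n) :=
    fun t a => Runs.push _ _ (update_outT ..)
  rcases t with b | _ | _
  · cases b
    · exact (runs_caseA_true _ _ _ _ _ _ _ (runs_caseA_true _ _ _ _ _ _ _
        (runs_caseA_false _ _ _ _ _ _ _ ((hd _).seq ((hd _).seq (hw _ _)))))).mono (by omega)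
    · exact (runs_caseA_true _ _ _ _ _ _ _ (runs_caseA_true _ _ _ _ _ _ _
        (runs_caseA_true _ _ _ _ _ _ _
          ((hd _).seq ((hd _).seq ((hd _).seq ((hd _).seq (hw _ _)))))))).mono (by omega)
  · exact (runs_caseA_false _ _ _ _ _ _ _ (hw _ _)).mono (by omega)
  · exact (runs_caseA_true _ _ _ _ _ _ _ (runs_caseA_false _ _ _ _ _ _ _
      ((hd _).seq (hw _ _)))).mono (by omega)

/-- Writes the word encoded on `A` on the output stack, in reverse because the first letter is
pushed first. -/
def writeOutput : Prog := loop .A (fun s => s == some (some true)) fun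
  | some (some true) => writeTok
  | _ => skip

theorem runs_writeOutput (l : List Tok) (i o u a b c n) :
    Runs writeOutput (mem i o u ((toCode l).str.map some ++ a) b c n) (61 * l.length + 2)
      (mem i (l.reverse ++ o) u a b c n) := by
  induction l generalizing o with
  | nil =>
    unfold writeOutput
    exact (Runs.exit (S := mem i o u (some false :: a) b c n) (some (some false)) rfl rfl
      (update_A ..) (Runs.skip _)).mono le_rfl
  | cons t l ih =>
    have h₁ := runs_writeTok t i o u ((toCode l).str.map some ++ a) b c n
    have h₂ := ih (t :: o)
    have h : Runs writeOutput (mem i o u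
        (some true :: ((toCode t).str.map some ++ ((toCode l).str.map some ++ a))) b c n) _ _ :=
      Runs.again (k := Stk.A) (some (some true)) rfl rfl (update_A ..) h₁ h₂
    have h' := h.mono (show _ ≤ 61 * (t :: l).length + 2 by
      simp only [List.length_cons]; omega)
    have e : toCode (t :: l) = .node (toCode t) (toCode l) := rfl
    simpa [e, Code.str] using h'

/-- Writes the truth value encoded on `A` on the output stack. -/
def writeBool : Prog :=
  caseA (seq drop (seq drop (push .outB true))) (push .outB false)

theorem runs_writeBool (s : Bool) :
    Runs writeBool (mem [] [] [] ((toCode s).str.map some) [] [] []) 30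
      (mem [] [] [s] [] [] [] []) := by
  have hd : ∀ a, Runs drop (mem [] [] [] (some false :: a) [] [] []) 9 (mem [] [] [] a [] [] []) :=
    fun a => runs_drop [] [] [] a [] [] [] .leaf
  have hw : ∀ t, Runs (push .outB t) (mem [] [] [] [] [] [] []) 1 (mem [] [] [t] [] [] [] []) :=
    fun t => Runs.push _ _ (update_outB ..)
  cases s
  · exact (runs_caseA_false _ _ _ _ _ _ _ (hw _)).mono (by omega)
  · exact (runs_caseA_true _ _ _ _ _ _ _ ((hd _).seq ((hd _).seq (hw _)))).mono (by omega)

end StackProg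

namespace PolyTime

variable {α : Type} [HasCode α] {ea : α → List Tok}

theorem bdd_of_csize (he : ∀ a, toCode a = toCode (ea a)) {t : α → ℕ} (ht : PolyBdd t) :
    ∃ P : Polynomial ℕ, ∀ a, t a ≤ P.eval (ea a).length := by
  obtain ⟨P, hP⟩ := ht
  refine ⟨P.comp (8 * Polynomial.X + 1), fun a => (hP a).trans ?_⟩
  rw [Polynomial.eval_comp]
  refine P.eval_mono_nat ?_
  have h := csize_toks_le (ea a)
  rw [csize, ← he] at h
  simpa [csize] using h

theorem length_le_csize (he : ∀ a, toCode a = toCode (ea a)) (a : α) :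
    (ea a).length ≤ csize a := by
  rw [csize, he]
  exact (length_lt_csize (ea a)).le

theorem mem_eq_update_inp (l : List Tok) :
    Function.update (β := fun k => List (StkSym k)) (fun _ => []) Stk.inp l =
      mem l [] [] [] [] [] [] := by
  funext k; cases k <;> rfl

theorem mem_eq_update_outT (l : List Tok) :
    Function.update (β := fun k => List (StkSym k)) (fun _ => []) Stk.outT l =
      mem [] l [] [] [] [] [] := by
  funext k; cases k <;> rfl

theorem mem_eq_update_outB (l : List Bool) :
    Function.update (β := fun k => List (StkSym k)) (fun _ => []) Stk.outB l =
      mem [] [] l [] [] [] [] := by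
  funext k; cases k <;> rfl

/-- Functions that are computable in polynomial time on trees are so on Turing machines. -/
theorem computable (he : ∀ a, toCode a = toCode (ea a)) {f : α → List Tok} (hf : PolyTime f) :
    PolyTimeComputable ea f := by
  obtain ⟨p, t, ht, hp⟩ := hf.reverse.exists_bdd
  obtain ⟨P, hP⟩ := bdd_of_csize he
    ((((((PolyBdd.const 100).mul PolyBdd.self).add (.const 100)).add ht).add
      ((PolyBdd.const 61).mul hf.bdd)).add (.const 2))
  refine nonempty_computable (Γ := StkSym) Stk.inp Stk.outT (Equiv.refl Tok) (Equiv.refl Tok)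
    (seq readInput (seq p writeOutput)) P fun a => ?_
  have h₁ := runs_readInput (ea a)
  have h₂ := hp a [] [] [] [] [] [] []
  have h₃ := runs_writeOutput (f a).reverse [] [] [] [] [] [] []
  rw [he] at h₂
  simp only [List.append_nil] at h₂ h₃
  obtain ⟨s, hs, hx⟩ := h₁.seq (h₂.seq h₃)
  refine ⟨s, (hs.trans ?_).trans (hP a), ?_⟩
  · have := length_le_csize he a
    have := length_lt_csize (f a)
    rw [List.length_reverse]
    omega
  · rw [List.reverse_reverse] at hx
    simp only [Equiv.refl_symm, Equiv.coe_refl, List.map_id]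
    rwa [mem_eq_update_inp, mem_eq_update_outT]

/-- Properties that are decidable in polynomial time on trees are so on Turing machines. -/
theorem decidable (he : ∀ a, toCode a = toCode (ea a)) {P : α → Prop} {f : α → Bool}
    (hf : PolyTime f) (h : ∀ a, f a = true ↔ P a) : PolyTimeDecidable ea P := by
  obtain ⟨p, t, ht, hp⟩ := hf.exists_bdd
  obtain ⟨Q, hQ⟩ := bdd_of_csize he
    (((((PolyBdd.const 100).mul PolyBdd.self).add (.const 100)).add ht).add (.const 30))
  refine nonempty_computable (Γ := StkSym) Stk.inp Stk.outB (Equiv.refl Tok) (Equiv.refl Bool)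
    (seq readInput (seq p writeBool)) Q fun a => ?_
  have h₁ := runs_readInput (ea a)
  have h₂ := hp a [] [] [] [] [] [] []
  have h₃ := runs_writeBool (f a)
  rw [he] at h₂
  simp only [List.append_nil] at h₂
  obtain ⟨s, hs, hx⟩ := h₁.seq (h₂.seq h₃)
  refine ⟨s, (hs.trans ?_).trans (hQ a), ?_⟩
  · have := length_le_csize he a
    omega
  · simp only [Equiv.refl_symm, Equiv.coe_refl, List.map_id, Computability.encodeBool]
    -- the statement to be proved uses a classical decision procedure for `P a`
    have e : ∀ (_ : Decidable (P a)), decide (P a) = f a := fun _ => by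
      rw [Bool.eq_iff_iff, h, decide_eq_true_iff]
    rw [mem_eq_update_inp, e]
    exact (mem_eq_update_outB [f a]).symm ▸ hx

end PolyTime

/-! ### Parsing instances -/

section Parsing

variable {α β ι : Type}

/-- Collects the results of `step` as long as there are any. A parsing step returns a list of at
most one result, together with the remaining input. Every step consumes a letter, so as many rounds
as there are letters suffice; the rounds after the last result have no effect. -/
def many (step : List Tok → List (β × List Tok)) (s : List Tok) : List β × List Tok :=
  s.foldl (fun p _ => List.casesOn (step p.2) p fun x _ => (p.1 ++ [x.1], x.2)) ([], s)

theorem many_flatMap {step : List Tok → List (β × List Tok)} {e : ι → List Tok} {v : ι → β}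
    {L : List ι} {r : List Tok} (h : ∀ x ∈ L, ∀ r, step (e x ++ r) = [(v x, r)])
    (hr : step r = []) (he : ∀ x ∈ L, e x ≠ []) : many step (L.flatMap e ++ r) = (L.map v, r) := by
  have key : ∀ (L : List ι) (t : List Tok) (m : List β),
      (∀ x ∈ L, ∀ r, step (e x ++ r) = [(v x, r)]) → L.length ≤ t.length →
      t.foldl (fun p _ => List.casesOn (step p.2) p fun x _ => (p.1 ++ [x.1], x.2))
        (m, L.flatMap e ++ r) = (m ++ L.map v, r) := by
    intro L t
    induction t generalizing L with
    | nil =>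
      intro m _ hL
      obtain rfl : L = [] := List.length_eq_zero_iff.1 (by simpa using hL)
      simp
    | cons a t ih =>
      intro m hL hlen
      rw [List.foldl_cons]
      cases L with
      | nil => simpa [hr] using ih [] m (by simp) (by simp)
      | cons x L =>
        have := ih L (m ++ [v x]) (fun y hy => hL y (List.mem_cons_of_mem _ hy))
          (by simpa using hlen)
        simpa [List.flatMap_cons, hL x List.mem_cons_self] using this
  refine key L _ [] h ?_
  rw [List.length_append, List.length_flatMap]
  refine le_add_right ?_
  clear key h
  induction L with
  | nil => simp
  | cons x L ih =>
    have h₁ := ih fun y hy => he y (List.mem_cons_of_mem _ hy)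
    have h₂ := List.length_pos_iff.2 (he x List.mem_cons_self)
    simp only [List.length_cons, List.map_cons, List.sum_cons]
    omega

theorem many_snd_suffix {step : List Tok → List (β × List Tok)}
    (h : ∀ s, ∀ y ∈ step s, y.2 <:+ s) (s : List Tok) : (many step s).2 <:+ s := by
  have key : ∀ (t : List Tok) (p : List β × List Tok), p.2 <:+ s →
      (t.foldl (fun p _ => List.casesOn (step p.2) p fun x _ => (p.1 ++ [x.1], x.2)) p).2 <:+ s := by
    intro t
    induction t with
    | nil => exact fun p hp => hp
    | cons a t ih =>
      intro p hp
      refine ih _ ?_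
      beta_reduce
      cases hx : step p.2 with
      | nil => exact hp
      | cons x l => exact (h p.2 x (by simp [hx])).trans hp
  exact key s _ List.suffix_rfl

variable [HasCode α] [HasCode β]

theorem PolyTime.many {step : α → List Tok → List (β × List Tok)} {s : α → List Tok}
    (hstep : PolyTime fun p : α × List Tok => step p.1 p.2) (hs : PolyTime s)
    (h : ∀ a s, ∀ y ∈ step a s, y.2 <:+ s) : PolyTime fun a => many (step a) (s a) := by
  obtain ⟨P, hP⟩ := hstep.bdd
  have hg : PolyTime fun p : α × (List β × List Tok) × Tok =>
      (List.casesOn (step p.1 p.2.1.2) p.2.1 fun x _ => (p.2.1.1 ++ [x.1], x.2) :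
        List β × List Tok) :=
    casesOn_list (g := fun (p : α × (List β × List Tok) × Tok) x _ => (p.2.1.1 ++ [x.1], x.2))
      (hstep.comp (f := fun p : α × (List β × List Tok) × Tok => (p.1, p.2.1.2)) (by fun_prop))
      (by fun_prop) (by fun_prop)
  -- every round adds at most one result, of polynomial size as it comes from a suffix of the input
  refine foldl_of_bdd (l := s) (y := fun a => ([], s a))
    (g := fun a p _ => List.casesOn (step a p.2) p fun x _ => (p.1 ++ [x.1], x.2))
    (s := fun a => (1 + csize (s a) * (P.eval (csize a + csize (s a) + 1) + 2)) + csize (s a) + 1)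
    hs hg (by fun_prop) ((((PolyBdd.const 1).add (hs.bdd.mul
      ((((PolyBdd.self.add hs.bdd).add (.const 1)).eval P).add (.const 2)))).add hs.bdd).add
        (.const 1)) fun a i hi => ?_
  have key : ∀ (t : List Tok) (p : List β × List Tok), p.2 <:+ s a →
      (t.foldl (fun p _ => (List.casesOn (step a p.2) p fun x _ => (p.1 ++ [x.1], x.2) :
        List β × List Tok)) p).2 <:+ s a ∧
      csize (t.foldl (fun p _ => (List.casesOn (step a p.2) p fun x _ => (p.1 ++ [x.1], x.2) :
        List β × List Tok)) p).1 ≤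
        csize p.1 + t.length * (P.eval (csize a + csize (s a) + 1) + 2) := by
    intro t
    induction t with
    | nil => exact fun p hp => ⟨hp, by simp⟩
    | cons b t ih =>
      intro p hp
      rw [List.foldl_cons]
      cases hx : step a p.2 with
      | nil =>
        refine ⟨(ih p hp).1, (ih p hp).2.trans ?_⟩
        gcongr
        simp
      | cons x l =>
        have hp' := (h a p.2 x (by simp [hx])).trans hp
        refine ⟨(ih (p.1 ++ [x.1], x.2) hp').1, (ih (p.1 ++ [x.1], x.2) hp').2.trans ?_⟩
        have h₁ : csize (step a p.2) ≤ P.eval (csize a + csize (s a) + 1) :=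
          (hP (a, p.2)).trans (P.eval_mono_nat (by
            rw [csize_pair]
            have := csize_le_of_suffix hp
            omega))
        have h₂ : csize x ≤ csize (step a p.2) := csize_le_of_mem (by simp [hx])
        have h₃ : csize x = csize x.1 + csize x.2 + 1 := rfl
        have h₄ := csize_append p.1 [x.1]
        rw [csize_cons, csize_nil] at h₄
        simp only [List.length_cons, Nat.add_mul]
        omega
  obtain ⟨h₁, h₂⟩ := key ((s a).take i) ([], s a) List.suffix_rfl
  rw [csize_pair]
  have h₃ := csize_le_of_suffix h₁
  have h₄ : ((s a).take i).length * (P.eval (csize a + csize (s a) + 1) + 2) ≤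
      csize (s a) * (P.eval (csize a + csize (s a) + 1) + 2) :=
    Nat.mul_le_mul_right _ ((List.length_take_le' i _).trans (length_lt_csize _).le)
  rw [csize_nil] at h₂
  omega

end Parsing

/-- Tests for the letter `item`. -/
def Tok.isItem (t : Tok) : Bool := t.view.isEmpty

/-- Tests for a binary digit. -/
def Tok.isBit (t : Tok) : Bool := !t.view.isEmpty && !(t.view.headD []).isEmpty

/-- The value of a binary digit. -/
def Tok.val (t : Tok) : Bool := (t.view.headD []).headD false

/-- The binary digit at position `k` of a word. -/
def bitAt (k : ℕ) (s : List Tok) : Bool := ((s.drop k).headD .item).val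

/-- Parsing step for a binary digit. -/
def bitStep (s : List Tok) : List (Bool × List Tok) :=
  bif (s.headD .item).isBit then [((s.headD .item).val, s.tail)] else []

/-- Parser for a binary number, which is returned as the list of its digits. -/
def parseNat (s : List Tok) : List Bool × List Tok := ((many bitStep s).1, (many bitStep s).2.tail)

/-- Parsing step for an entry of a list. -/
def itemStep {β : Type} (p : List Tok → β × List Tok) (s : List Tok) : List (β × List Tok) :=
  bif (s.headD .close).isItem then [p s.tail] else []

/-- Parser for a list, given a parser for its entries. -/
def parseList {β : Type} (p : List Tok → β × List Tok) (s : List Tok) : List β × List Tok :=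
  ((many (itemStep p) s).1, (many (itemStep p) s).2.tail)

theorem bitStep_suffix (s : List Tok) : ∀ y ∈ bitStep s, y.2 <:+ s := by
  intro y hy
  unfold bitStep at hy
  cases h : (s.headD .item).isBit
  · rw [h] at hy
    exact absurd hy List.not_mem_nil
  · rw [h, cond_true, List.mem_singleton] at hy
    exact hy ▸ List.tail_suffix s

theorem itemStep_suffix {β : Type} {p : List Tok → β × List Tok} (hp : ∀ s, (p s).2 <:+ s)
    (s : List Tok) : ∀ y ∈ itemStep p s, y.2 <:+ s := by
  intro y hy
  unfold itemStep at hy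
  cases h : (s.headD .close).isItem
  · rw [h] at hy
    exact absurd hy List.not_mem_nil
  · rw [h, cond_true, List.mem_singleton] at hy
    exact hy ▸ (hp _).trans (List.tail_suffix s)

theorem parseNat_suffix (s : List Tok) : (parseNat s).2 <:+ s :=
  (List.tail_suffix _).trans (many_snd_suffix bitStep_suffix s)

theorem parseList_suffix {β : Type} {p : List Tok → β × List Tok} (hp : ∀ s, (p s).2 <:+ s)
    (s : List Tok) : (parseList p s).2 <:+ s :=
  (List.tail_suffix _).trans (many_snd_suffix (itemStep_suffix hp) s)

theorem parseNat_nat (m : ℕ) (r : List Tok) : parseNat (Encode.nat m ++ r) = (m.bits, r) := by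
  have h := many_flatMap (step := bitStep) (e := fun b : Bool => [Tok.bit b]) (v := id)
    (L := m.bits) (r := Tok.close :: r) (fun b _ r => rfl) rfl (by simp)
  rw [List.map_id, ← List.map_eq_flatMap] at h
  simp [parseNat, Encode.nat, h]

theorem parseList_list {ι β : Type} {p : List Tok → β × List Tok} {e : ι → List Tok} {v : ι → β}
    {L : List ι} (h : ∀ x ∈ L, ∀ r, p (e x ++ r) = (v x, r)) (r : List Tok) :
    parseList p (Encode.list e L ++ r) = (L.map v, r) := by
  have h := many_flatMap (step := itemStep p) (e := fun x => Tok.item :: e x) (v := v)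
    (L := L) (r := Tok.close :: r) (fun x hx r => congrArg (fun y => [y]) (h x hx r)) rfl (by simp)
  simp [parseList, Encode.list, h]

section

variable {α β : Type} [HasCode α] [HasCode β]

namespace PolyTime

@[fun_prop]
theorem bitAt {k : α → ℕ} {s : α → List Tok} (hk : PolyTime k) (hs : PolyTime s) :
    PolyTime fun a => bitAt (k a) (s a) := by
  unfold _root_.bitAt Tok.val; fun_prop

@[fun_prop]
theorem parseNat {s : α → List Tok} (hs : PolyTime s) : PolyTime fun a => parseNat (s a) := by
  have hb : PolyTime bitStep := by unfold bitStep Tok.isBit Tok.val; fun_prop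
  have hm : PolyTime fun s => _root_.many bitStep s :=
    many (step := fun _ => bitStep) (s := fun s => s)
      (hb.comp (f := fun p : List Tok × List Tok => p.2) (by fun_prop)) (by fun_prop)
      fun _ => bitStep_suffix
  have h : PolyTime fun s => _root_.parseNat s := by unfold _root_.parseNat; fun_prop
  exact h.comp hs

theorem parseList {p : α → List Tok → β × List Tok} {s : α → List Tok}
    (hp : PolyTime fun x : α × List Tok => p x.1 x.2) (hs : PolyTime s)
    (h : ∀ a s, (p a s).2 <:+ s) : PolyTime fun a => parseList (p a) (s a) := by
  have hi : PolyTime fun x : α × List Tok => itemStep (p x.1) x.2 := by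
    have h : PolyTime fun x : α × List Tok => p x.1 x.2.tail :=
      hp.comp (f := fun x : α × List Tok => (x.1, x.2.tail)) (by fun_prop)
    unfold itemStep Tok.isItem; fun_prop
  have hm : PolyTime fun a => _root_.many (itemStep (p a)) (s a) :=
    many hi hs fun a => itemStep_suffix (h a)
  unfold _root_.parseList; fun_prop

end PolyTime

end

/-- Parser for a word. -/
def parseWord : List Tok → List (List Bool) × List Tok := parseList parseNat

/-- Parser for a rule; `c` tells whether it carries a probability, which is skipped. -/
def parseRule (c : Bool) (s : List Tok) : List (List Bool) × List Tok :=
  ((parseWord s).1, bif c then (parseNat (parseNat (parseWord s).2).2).2 else (parseWord s).2)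

/-- Parser for the data of a stack symbol: its owner, its membership in the target set, and its
rules. -/
def parseSymbol (s : List Tok) :
    ((Bool × Bool) × Bool × List (List (List Bool))) × List Tok :=
  let s' := (parseNat s).2
  let r := parseList (parseRule (bitAt 0 s')) (s'.drop 3)
  (((bitAt 0 s', bitAt 1 s'), bitAt 2 s', r.1), r.2)

/-- The data of a stack symbol on which the winning regions depend: the two binary digits of its
owner, its membership in the target set, and the right-hand sides of its rules. -/
abbrev SymbolData := (Bool × Bool) × Bool × List (List ℕ)

/-- Parser for an instance. -/
def parseInst (s : List Tok) : List SymbolData :=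
  let l := (parseList parseSymbol s).1
  l.map fun e => (e.1, e.2.1, e.2.2.map fun w => w.map (PolyTime.ofBits l.length))

/-- The two binary digits that encode a player. -/
def Owner.digits : Owner → Bool × Bool
  | .box => (false, false)
  | .diamond => (false, true)
  | .random => (true, false)

/-- The data of an instance without probabilities, as lists of numbers. -/
def BPAInstance.data (I : BPAInstance) : List SymbolData :=
  (List.finRange I.n).map fun X => ((I.Δ.owner X).digits, decide (X ∈ I.ΓT),
    ((I.Δ.rules X).sort (· ≤ ·)).map (List.map Fin.val))

theorem parseWord_suffix (s : List Tok) : (parseWord s).2 <:+ s :=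
  parseList_suffix parseNat_suffix s

theorem parseRule_suffix (c : Bool) (s : List Tok) : (parseRule c s).2 <:+ s := by
  cases c
  · exact parseWord_suffix s
  · exact (parseNat_suffix _).trans ((parseNat_suffix _).trans (parseWord_suffix s))

theorem parseSymbol_suffix (s : List Tok) : (parseSymbol s).2 <:+ s :=
  (parseList_suffix (parseRule_suffix _) _).trans ((List.drop_suffix _ _).trans (parseNat_suffix s))

theorem encode_word {n : ℕ} (α : List (Fin n)) :
    Encode.word α = Encode.list Encode.nat (α.map Fin.val) := by
  rw [List.map_eq_flatMap]; rfl

theorem parseWord_word {n : ℕ} (α : List (Fin n)) (r : List Tok) :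
    parseWord (Encode.word α ++ r) = (α.map fun X : Fin _ => (X : ℕ).bits, r) := by
  rw [encode_word]
  exact (parseList_list (fun m _ r => parseNat_nat m r) r).trans (by rw [List.map_map]; rfl)

theorem parseRule_rule (I : BPAInstance) (X : Fin I.n) (α : List (Fin I.n)) (r : List Tok) :
    parseRule (I.Δ.owner X).digits.1 (Encode.rule I X α ++ r) =
      (α.map fun X : Fin _ => (X : ℕ).bits, r) := by
  unfold parseRule Encode.rule
  cases I.Δ.owner X <;> simp [parseWord_word, parseNat_nat, Owner.digits]

theorem parseSymbol_symbol (I : BPAInstance) (X : Fin I.n) (r : List Tok) :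
    parseSymbol (Encode.symbol I X ++ r) = (((I.Δ.owner X).digits, decide (X ∈ I.ΓT),
      ((I.Δ.rules X).sort (· ≤ ·)).map (List.map fun X : Fin _ => (X : ℕ).bits)), r) := by
  have h : ∀ r, parseList (parseRule (I.Δ.owner X).digits.1)
      (Encode.list (Encode.rule I X) ((I.Δ.rules X).sort (· ≤ ·)) ++ r) =
        (((I.Δ.rules X).sort (· ≤ ·)).map (List.map fun X : Fin _ => (X : ℕ).bits), r) :=
    parseList_list fun α _ r => parseRule_rule I X α r
  unfold parseSymbol Encode.symbol
  simp only [List.append_assoc, parseNat_nat]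
  cases ho : I.Δ.owner X <;> rw [ho] at h <;> simp only [Owner.digits] at h <;>
    simp [Encode.owner, Owner.digits, bitAt, Tok.val, Tok.view, h]

theorem parseInst_inst (I : BPAInstance) (r : List Tok) :
    parseInst (Encode.inst I ++ r) = I.data := by
  have h : parseList parseSymbol (Encode.inst I ++ r) = _ :=
    parseList_list (fun X _ r => parseSymbol_symbol I X r) r
  simp only [parseInst, h, BPAInstance.data, List.map_map, List.length_map, List.length_finRange]
  refine List.map_congr_left fun X _ => ?_
  simp only [Function.comp_def, List.map_map]
  congr 3
  refine funext fun α => List.map_congr_left fun Y _ => ?_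
  exact PolyTime.ofBits_bits Y.2.le

theorem parseInst_snd_inst (I : BPAInstance) (r : List Tok) :
    (parseList parseSymbol (Encode.inst I ++ r)).2 = r :=
  congrArg Prod.snd (parseList_list (fun X _ r => parseSymbol_symbol I X r) r)

attribute [local irreducible] parseNat in
@[fun_prop]
theorem polyTime_parseWord : PolyTime parseWord :=
  PolyTime.parseList (p := fun _ : List Tok => parseNat) (s := fun s => s) (by fun_prop)
    (by fun_prop) fun _ => parseNat_suffix

section

-- `fun_prop` is to apply the lemmas on these functions instead of unfolding them
attribute [local irreducible] parseNat parseWord parseList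

theorem polyTime_parseSymbols : PolyTime (parseList parseSymbol) := by
  have hr : PolyTime fun x : Bool × List Tok => parseRule x.1 x.2 := by
    unfold parseRule; fun_prop
  have hr' : PolyTime fun s : List Tok => parseList (parseRule (bitAt 0 (parseNat s).2))
      ((parseNat s).2.drop 3) :=
    PolyTime.parseList (p := fun s => parseRule (bitAt 0 (parseNat s).2))
      (hr.comp (f := fun x : List Tok × List Tok => (bitAt 0 (parseNat x.1).2, x.2))
        (by fun_prop)) (by fun_prop) fun _ => parseRule_suffix _
  have hp : PolyTime parseSymbol := by
    unfold parseSymbol; dsimp only; fun_prop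
  exact PolyTime.parseList (p := fun _ : List Tok => parseSymbol) (s := fun s => s)
    (hp.comp (by fun_prop)) (by fun_prop) fun _ => parseSymbol_suffix

@[fun_prop]
theorem polyTime_parseInst : PolyTime parseInst := by
  have := polyTime_parseSymbols
  unfold parseInst; fun_prop

instance : HasCode BPAInstance := ⟨fun I => toCode (Encode.inst I)⟩

instance : HasCode (Σ I : BPAInstance, List (Fin I.n)) := ⟨fun x => toCode (Encode.instConfig x)⟩

theorem polyTime_data : PolyTime BPAInstance.data := by
  have : PolyTime Encode.inst := PolyTime.of_code_eq fun _ => rfl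
  exact (show PolyTime fun I => parseInst (Encode.inst I) by fun_prop).congr fun I => by
    simpa using parseInst_inst I []

theorem polyTime_data_fst : PolyTime fun x : Σ I : BPAInstance, List (Fin I.n) => x.1.data := by
  have : PolyTime Encode.instConfig := PolyTime.of_code_eq fun _ => rfl
  exact (show PolyTime fun x => parseInst (Encode.instConfig x) by fun_prop).congr fun x =>
    parseInst_inst x.1 _

theorem polyTime_config :
    PolyTime fun x : Σ I : BPAInstance, List (Fin I.n) => x.2.map Fin.val := by
  have : PolyTime Encode.instConfig := PolyTime.of_code_eq fun _ => rfl
  have := polyTime_parseSymbols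
  have h := polyTime_data_fst
  have hm : PolyTime fun p : List SymbolData × List (List Bool) =>
      p.2.map (PolyTime.ofBits p.1.length) := by fun_prop
  have hw : PolyTime fun x : Σ I : BPAInstance, List (Fin I.n) =>
      (parseWord (parseList parseSymbol (Encode.instConfig x)).2).1 := by fun_prop
  refine (hm.comp (h.prodMk hw)).congr fun x => ?_
  rw [Encode.instConfig, parseInst_snd_inst]
  have e := parseWord_word x.2 []
  rw [List.append_nil] at e
  simp only [e, List.map_map]
  refine List.map_congr_left fun Y _ => PolyTime.ofBits_bits ?_
  simp [BPAInstance.data, Y.2.le]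

end

/-! ### Reachability in Markov chains -/

section Chain

variable {S : Type} [MeasurableSpace S] [DiscreteMeasurableSpace S] (step : S → PMF S) (s : S)

instance : IsProbabilityMeasure (chainMeasure step s) := by
  unfold chainMeasure
  infer_instance

theorem chainMeasure_zero : chainMeasure step s {ω | ω 0 = s} = 1 := by
  have h := Kernel.traj_map_frestrictLe_apply (X := fun _ : ℕ => S) (κ := chainKernel step) 0 0
    (fun _ => s)
  rw [Kernel.partialTraj_self, Kernel.id_apply] at h
  have hm : MeasurableSet {f : ∀ _ : Finset.Iic 0, S | f ⟨0, Finset.mem_Iic.2 le_rfl⟩ = s} :=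
    measurable_pi_apply (X := fun _ : Finset.Iic 0 => S) _ (MeasurableSet.of_discrete (s := {s}))
  have h' := congrArg (fun μ => μ {f | f ⟨0, Finset.mem_Iic.2 le_rfl⟩ = s}) h
  beta_reduce at h'
  rw [Measure.map_apply (by fun_prop) hm, Measure.dirac_apply' _ hm] at h'
  simpa [chainMeasure] using h'

/-- The law of a state of the chain is obtained from that of its predecessor by a transition. -/
theorem chainMeasure_succ (n : ℕ) (E : Set S) :
    chainMeasure step s {ω | ω (n + 1) ∈ E} =
      ∫⁻ ω, (step (ω n)).toMeasure E ∂chainMeasure step s := by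
  have h := Kernel.partialTraj_compProd_eq_map_traj (X := fun _ : ℕ => S) (κ := chainKernel step)
    (a := 0) (b := n) (Nat.zero_le n) (x₀ := fun _ => s)
  have hE : MeasurableSet (Set.univ ×ˢ E : Set ((∀ _ : Finset.Iic n, S) × S)) :=
    MeasurableSet.univ.prod MeasurableSet.of_discrete
  have h' := congrArg (fun μ => μ (Set.univ ×ˢ E)) h
  beta_reduce at h'
  rw [Measure.map_apply (by fun_prop) hE, Measure.compProd_apply hE,
    ← Kernel.traj_map_frestrictLe_apply,
    lintegral_map (Kernel.measurable_kernel_prodMk_left hE) (by fun_prop)] at h'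
  simpa [chainMeasure, chainKernel, Set.preimage] using h'.symm

variable {step s}

/-- A state that can be reached by transitions of positive probability is visited with positive
probability. -/
theorem exists_chainMeasure_pos {t : S}
    (h : Relation.ReflTransGen (fun a b => b ∈ (step a).support) s t) :
    ∃ n, 0 < chainMeasure step s {ω | ω n = t} := by
  induction h with
  | refl => exact ⟨0, by simp [chainMeasure_zero]⟩
  | @tail a b _ hab ih =>
    obtain ⟨n, hn⟩ := ih
    refine ⟨n + 1, ?_⟩
    have hm : MeasurableSet {ω : ℕ → S | ω n = a} :=
      measurable_pi_apply (X := fun _ : ℕ => S) n (MeasurableSet.of_discrete (s := {a}))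
    change 0 < chainMeasure step s {ω | ω (n + 1) ∈ ({b} : Set S)}
    rw [chainMeasure_succ]
    -- restrict the integral to the runs that are in `a` at time `n`
    refine lt_of_lt_of_le ?_ (setLIntegral_le_lintegral {ω | ω n = a} _)
    rw [setLIntegral_congr_fun hm (g := fun _ => step a b) fun ω hω => by
      rw [show ω n = a from hω, PMF.toMeasure_apply_singleton _ _ MeasurableSet.of_discrete],
      setLIntegral_const]
    exact ENNReal.mul_pos ((PMF.mem_support_iff _ _).1 hab) hn.ne'

/-- A set of states that the transitions do not leave is almost surely never left. -/
theorem ae_mem_of_closed {D : Set S} (hs : s ∈ D) (hD : ∀ a ∈ D, (step a).support ⊆ D) :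
    ∀ᵐ ω ∂chainMeasure step s, ∀ n, ω n ∈ D := by
  rw [ae_all_iff]
  intro n
  induction n with
  | zero =>
    have hm : MeasurableSet {ω : ℕ → S | ω 0 = s} :=
      measurable_pi_apply (X := fun _ : ℕ => S) 0 (MeasurableSet.of_discrete (s := {s}))
    have h : ∀ᵐ ω ∂chainMeasure step s, ω 0 = s :=
      (prob_compl_eq_zero_iff hm).2 (chainMeasure_zero step s)
    filter_upwards [h] with ω hω
    rwa [hω]
  | succ n ih =>
    change chainMeasure step s {ω | ω (n + 1) ∈ Dᶜ} = 0
    rw [chainMeasure_succ, lintegral_eq_zero_iff (by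
      exact (Measurable.of_discrete (f := fun a : S => (step a).toMeasure Dᶜ)).comp
        (measurable_pi_apply n))]
    filter_upwards [ih] with ω hω
    rw [Pi.zero_apply, PMF.toMeasure_apply_eq_zero_iff _ MeasurableSet.of_discrete]
    exact Set.disjoint_compl_right_iff_subset.2 (hD _ hω)

end Chain

/-! ### Attractors and traps in stochastic games -/

namespace StochasticGame

variable {V : Type} (G : StochasticGame V)

/-- The memoryless deterministic strategy that moves from `v` to `c v`. -/
noncomputable def memoryless (p : Owner) (c : V → V) (hc : ∀ v, G.edge v (c v)) :
    G.Strategy p where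
  act _ v := PMF.pure (c v)
  act_edge w v u hu := by
    rw [PMF.support_pure, Set.mem_singleton_iff] at hu
    exact hu ▸ hc v

/-- The vertices from which `T` can be reached against every play of `◇`, where `□` moves from
`v` to `c v` and chance cooperates. -/
inductive Attr (T : Set V) (c : V → V) : V → Prop
  | target {v} (h : v ∈ T) : Attr T c v
  | box {v} (h : G.owner v = Owner.box) (hc : Attr T c (c v)) : Attr T c v
  | diamond {v} (h : G.owner v = Owner.diamond) (hu : ∀ u, G.edge v u → Attr T c u) : Attr T c v
  | random {v u} (h : G.owner v = Owner.random) (hu : G.edge v u) (ha : Attr T c u) : Attr T c v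

variable {G}

theorem nextVertex_box {σ : G.Strategy Owner.box} {π : G.Strategy Owner.diamond}
    {s : PlayState V} (h : G.owner s.cur = Owner.box) :
    G.nextVertex σ π s = σ.act s.hist ⟨s.cur, h⟩ := by
  unfold nextVertex
  split <;> first | rfl | exact absurd (h.symm.trans ‹_›) (by simp)

theorem nextVertex_diamond {σ : G.Strategy Owner.box} {π : G.Strategy Owner.diamond}
    {s : PlayState V} (h : G.owner s.cur = Owner.diamond) :
    G.nextVertex σ π s = π.act s.hist ⟨s.cur, h⟩ := by
  unfold nextVertex
  split <;> first | rfl | exact absurd (h.symm.trans ‹_›) (by simp)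

theorem nextVertex_random {σ : G.Strategy Owner.box} {π : G.Strategy Owner.diamond}
    {s : PlayState V} (h : G.owner s.cur = Owner.random) :
    G.nextVertex σ π s = G.prob s.cur h := by
  unfold nextVertex
  split <;> first | rfl | exact absurd (h.symm.trans ‹_›) (by simp)

theorem edge_of_mem_support_nextVertex {σ : G.Strategy Owner.box} {π : G.Strategy Owner.diamond}
    {s : PlayState V} {u : V} (hu : u ∈ (G.nextVertex σ π s).support) : G.edge s.cur u := by
  cases h : G.owner s.cur with
  | box => exact σ.act_edge _ _ u (nextVertex_box (σ := σ) (π := π) h ▸ hu)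
  | diamond => exact π.act_edge _ _ u (nextVertex_diamond (σ := σ) (π := π) h ▸ hu)
  | random => exact (G.prob_support _ h u).1 (nextVertex_random (σ := σ) (π := π) h ▸ hu)

theorem mem_support_playStep {σ : G.Strategy Owner.box} {π : G.Strategy Owner.diamond}
    {s t : PlayState V} : t ∈ (G.playStep σ π s).support ↔
      ∃ u ∈ (G.nextVertex σ π s).support, (⟨s.hist ++ [s.cur], u⟩ : PlayState V) = t := by
  rw [playStep, PMF.mem_support_map_iff]

/-- Whatever the history `w` and the strategy of `◇` are, the play continues from a vertex of the
attractor to `T` along some path of positive probability. -/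
theorem Attr.exists_path {T : Set V} {c : V → V} {hc : ∀ v, G.edge v (c v)} {v : V}
    (h : G.Attr T c v) (π : G.Strategy Owner.diamond) (w : List V) :
    ∃ t : PlayState V, t.cur ∈ T ∧ Relation.ReflTransGen
      (fun a b => b ∈ (G.playStep (G.memoryless Owner.box c hc) π a).support) ⟨w, v⟩ t := by
  have key : ∀ {v u : V} {w : List V},
      u ∈ (G.nextVertex (G.memoryless Owner.box c hc) π ⟨w, v⟩).support →
      (∀ w, ∃ t : PlayState V, t.cur ∈ T ∧ Relation.ReflTransGen
        (fun a b => b ∈ (G.playStep (G.memoryless Owner.box c hc) π a).support) ⟨w, u⟩ t) →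
      ∃ t : PlayState V, t.cur ∈ T ∧ Relation.ReflTransGen
        (fun a b => b ∈ (G.playStep (G.memoryless Owner.box c hc) π a).support) ⟨w, v⟩ t := by
    intro v u w hu ih
    obtain ⟨t, ht, hp⟩ := ih (w ++ [v])
    exact ⟨t, ht, .head (mem_support_playStep.2 ⟨u, hu, rfl⟩) hp⟩
  induction h generalizing w with
  | target h => exact ⟨_, h, .refl⟩
  | @box v h _ ih =>
    refine key (u := c v) ?_ ih
    rw [nextVertex_box h]
    simp [memoryless]
  | @diamond v h _ ih =>
    obtain ⟨u, hu⟩ := (G.nextVertex (G.memoryless Owner.box c hc) π ⟨w, v⟩).support_nonempty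
    exact key hu (ih u (edge_of_mem_support_nextVertex hu))
  | @random v u h hu _ ih =>
    refine key (u := u) ?_ ih
    rw [nextVertex_random h]
    exact (G.prob_support v h u).2 hu

theorem Attr.winningPos {T : Set V} {c : V → V} {hc : ∀ v, G.edge v (c v)} {v : V}
    (h : G.Attr T c v) : WinningPos T (G.memoryless Owner.box c hc) v := by
  intro π
  obtain ⟨t, ht, hp⟩ := h.exists_path (hc := hc) π []
  obtain ⟨n, hn⟩ := exists_chainMeasure_pos hp
  exact hn.trans_le (measure_mono fun ω (hω : ω n = t) => ⟨n, hω ▸ ht⟩)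

/-- `◇` avoids `T` from all vertices of a set `D` disjoint from `T` that neither `□` nor chance
can leave and that the moves of `◇` respect. -/
theorem winningZero_of_trap {T D : Set V} {d : V → V} (hd : ∀ v, G.edge v (d v))
    (hT : ∀ v ∈ D, v ∉ T) (hdD : ∀ v ∈ D, G.owner v = Owner.diamond → d v ∈ D)
    (hD : ∀ v ∈ D, G.owner v ≠ Owner.diamond → ∀ u, G.edge v u → u ∈ D) {v : V} (hv : v ∈ D) :
    WinningZero T (G.memoryless Owner.diamond d hd) v := by
  intro σ
  have h := ae_mem_of_closed (step := G.playStep σ (G.memoryless Owner.diamond d hd))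
    (s := ⟨[], v⟩) (D := {s | s.cur ∈ D}) hv fun s hs t ht => by
      obtain ⟨u, hu, rfl⟩ := mem_support_playStep.1 ht
      by_cases ho : G.owner s.cur = Owner.diamond
      · rw [nextVertex_diamond ho] at hu
        obtain rfl : u = d s.cur := by simpa [memoryless] using hu
        exact hdD _ hs ho
      · exact hD _ hs ho u (edge_of_mem_support_nextVertex hu)
  refine measure_mono_null ?_ h
  rintro ω ⟨i, hi⟩ hω
  exact hT _ (hω i) hi

theorem WinningPos.notMem_regionZero {T : Set V} {σ : G.Strategy Owner.box} {v : V}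
    (h : WinningPos T σ v) : v ∉ G.regionZero T :=
  fun ⟨π, hπ⟩ => (h π).ne' (hπ σ)

theorem WinningZero.notMem_regionPos {T : Set V} {π : G.Strategy Owner.diamond} {v : V}
    (h : WinningZero T π v) : v ∉ G.regionPos T :=
  fun ⟨σ, hσ⟩ => (hσ π).ne' (h σ)

end StochasticGame

/-! ### Saturation -/

/-- The first member of `L` that satisfies `p`; if there is none, the first member of `L`. -/
def pick {α : Type} (p : List α → Bool) (L : List (List α)) : List α :=
  (L.filter p ++ L).headD []

theorem pick_mem {α : Type} (p : List α → Bool) {L : List (List α)} (h : L ≠ []) :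
    pick p L ∈ L := by
  obtain ⟨a, l, hl⟩ := List.exists_cons_of_ne_nil (l := L.filter p ++ L) (by simp [h])
  have : a ∈ L.filter p ++ L := by simp [hl]
  rw [pick, hl, List.headD_cons]
  simp only [List.mem_append, List.mem_filter] at this
  tauto

theorem pick_spec {α : Type} {p : List α → Bool} {L : List (List α)} (h : ∃ γ ∈ L, p γ = true) :
    p (pick p L) = true := by
  obtain ⟨γ, hγ, hp⟩ := h
  obtain ⟨a, l, hl⟩ := List.exists_cons_of_ne_nil (List.ne_nil_of_mem (List.mem_filter.2 ⟨hγ, hp⟩))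
  have : a ∈ L.filter p := by simp [hl]
  rw [pick, hl, List.cons_append, List.headD_cons]
  exact (List.mem_filter.1 this).2

/-- Whether the stack `α` on top of a stack of status `b` is winning, where `A X s` tells whether
`X` is winning on top of a stack of status `s`. -/
def wins {Γ : Type} (A : Γ → Bool → Bool) (b : Bool) (α : List Γ) : Bool := α.foldr A b

theorem wins_append {Γ : Type} (A : Γ → Bool → Bool) (b : Bool) (α β : List Γ) :
    wins A b (α ++ β) = wins A (wins A b β) α := List.foldr_append

theorem wins_mono {Γ : Type} {A B : Γ → Bool → Bool} (h : ∀ X b c, b ≤ c → A X b ≤ B X c)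
    {b c : Bool} (hb : b ≤ c) (α : List Γ) : wins A b α ≤ wins B c α := by
  induction α with
  | nil => exact hb
  | cons X α ih => exact h _ _ _ ih

namespace BPAInstance

variable (I : BPAInstance)

/-- The right-hand sides of the rules of `X`, in lexicographic order. -/
def ruleList (X : Fin I.n) : List (List (Fin I.n)) := (I.Δ.rules X).sort (· ≤ ·)

variable {I} in
theorem mem_ruleList {X : Fin I.n} {γ : List (Fin I.n)} : γ ∈ I.ruleList X ↔ γ ∈ I.Δ.rules X :=
  Finset.mem_sort _

theorem ruleList_ne_nil (X : Fin I.n) : I.ruleList X ≠ [] := by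
  obtain ⟨γ, hγ⟩ := I.Δ.rules_nonempty X
  exact List.ne_nil_of_mem (mem_ruleList.2 hγ)

/-- One round of the saturation: given what is known about `□` winning from a symbol on top of
a stack of some status, `□` wins from `X` on top of a stack of status `b` if `X` is a target symbol
or if some rule of `X` (all rules, if `X` belongs to `◇`) leads to a stack known to be winning. -/
def round (A : Fin I.n → Bool → Bool) (X : Fin I.n) (b : Bool) : Bool :=
  decide (X ∈ I.ΓT) || bif decide (I.Δ.owner X = Owner.diamond)
    then (I.ruleList X).all (wins A b) else (I.ruleList X).any (wins A b)

/-- The stages of the saturation: `stage i X b` tells whether `□` is known after `i` rounds to be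
able to reach the target from `X` on top of a stack of status `b`, where emptying the part of the
stack above a stack of status `true` is as good as reaching the target. -/
def stage (i : ℕ) : Fin I.n → Bool → Bool := I.round^[i] fun _ _ => false

/-- A number of rounds after which the saturation is complete. -/
abbrev bound : ℕ := I.n + I.n

variable {I} in
theorem round_eq_true {A : Fin I.n → Bool → Bool} {X : Fin I.n} {b : Bool} :
    I.round A X b = true ↔ X ∈ I.ΓT ∨
      (I.Δ.owner X = Owner.diamond ∧ ∀ γ ∈ I.ruleList X, wins A b γ = true) ∨
      (I.Δ.owner X ≠ Owner.diamond ∧ ∃ γ ∈ I.ruleList X, wins A b γ = true) := by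
  by_cases h : I.Δ.owner X = Owner.diamond <;> simp [round, h]

theorem round_mono {A B : Fin I.n → Bool → Bool} (h : ∀ X b c, b ≤ c → A X b ≤ B X c)
    (X : Fin I.n) (b c : Bool) (hb : b ≤ c) : I.round A X b ≤ I.round B X c := by
  have h' := wins_mono h hb
  simp only [Bool.le_iff_imp] at h' ⊢
  rw [round_eq_true, round_eq_true]
  rintro (h₁ | ⟨h₁, h₂⟩ | ⟨h₁, γ, hγ, h₂⟩)
  · exact .inl h₁
  · exact .inr (.inl ⟨h₁, fun γ hγ => h' γ (h₂ γ hγ)⟩)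
  · exact .inr (.inr ⟨h₁, γ, hγ, h' γ h₂⟩)

theorem stage_succ (i : ℕ) : I.stage (i + 1) = I.round (I.stage i) :=
  Function.iterate_succ_apply' _ _ _

theorem stage_mono_right (i : ℕ) (X : Fin I.n) (b c : Bool) (h : b ≤ c) :
    I.stage i X b ≤ I.stage i X c := by
  induction i generalizing X b c with
  | zero => exact le_rfl
  | succ i ih =>
    rw [stage_succ]
    exact I.round_mono ih X b c h

theorem stage_le_succ (i : ℕ) (X : Fin I.n) (b c : Bool) (h : b ≤ c) :
    I.stage i X b ≤ I.stage (i + 1) X c := by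
  induction i generalizing X b c with
  | zero => exact Bool.false_le _
  | succ i ih =>
    rw [stage_succ, stage_succ _ (i + 1)]
    exact I.round_mono ih X b c h

variable {I}

theorem stage_mono {i j : ℕ} (h : i ≤ j) {X : Fin I.n} {b : Bool} (hX : I.stage i X b = true) :
    I.stage j X b = true := by
  induction h with
  | refl => exact hX
  | step _ ih => exact Bool.le_iff_imp.1 (I.stage_le_succ _ X b b le_rfl) ih

theorem stage_mono_status {i : ℕ} {X : Fin I.n} (b : Bool) (hX : I.stage i X false = true) :
    I.stage i X b = true :=
  Bool.le_iff_imp.1 (I.stage_mono_right i X false b (Bool.false_le b)) hX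

variable (I)

/-- After `bound` rounds nothing new is found, because each round before that finds some new pair
of a symbol and a status. -/
theorem round_stage_bound : I.round (I.stage I.bound) = I.stage I.bound := by
  let S (i : ℕ) : Finset (Fin I.n × Bool) := {p | I.stage i p.1 p.2 = true}
  have hS : Monotone S := fun i j h p => by
    simpa [S] using stage_mono h
  have hi {i j : ℕ} (h : S i = S j) : I.stage i = I.stage j := by
    funext X b
    have := congrArg ((X, b) ∈ ·) h
    simpa [S, ← Bool.eq_iff_iff] using this
  have hcard : (S (I.bound + 1)).card = (S I.bound).card := by
    refine Nat.stabilises_of_monotone (f := fun i => (S i).card)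
      (fun i j h => Finset.card_le_card (hS h)) (fun i => ?_) (fun i h => ?_) (Nat.le_succ _)
    · refine (Finset.card_le_univ _).trans ?_
      simp [mul_two]
    · have := hi (Finset.eq_of_subset_of_card_le (hS (Nat.le_succ i)) h.symm.le)
      rw [show S (i + 1) = S (i + 2) by
        have h₂ : I.stage (i + 1) = I.stage (i + 2) := by
          rw [I.stage_succ (i + 1), ← this, ← I.stage_succ, ← this]
        simp only [S, h₂]]
  rw [← stage_succ]
  exact (hi (Finset.eq_of_subset_of_card_le (hS (Nat.le_succ _)) hcard.le)).symm

/-- The result of the saturation. -/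
def sat : Fin I.n → Bool → Bool := I.stage I.bound

variable {I} in
theorem sat_eq_true {X : Fin I.n} {b : Bool} : I.sat X b = true ↔ X ∈ I.ΓT ∨
    (I.Δ.owner X = Owner.diamond ∧ ∀ γ ∈ I.ruleList X, wins I.sat b γ = true) ∨
    (I.Δ.owner X ≠ Owner.diamond ∧ ∃ γ ∈ I.ruleList X, wins I.sat b γ = true) := by
  rw [← round_eq_true, sat, round_stage_bound]

/-! ### The strategy of `◇` -/

/-- The table of an SMD strategy of `◇`: use a rule that keeps the upper part of the stack losing
for `□` even if emptying it were as good as reaching the target, otherwise a rule that keeps it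
losing if emptying it is of no use. -/
def table (X : Fin I.n) : List (Fin I.n) :=
  pick (fun γ => !wins I.sat true γ)
    ((I.ruleList X).filter (fun γ => !wins I.sat false γ) ++ I.ruleList X)

theorem table_mem (X : Fin I.n) : I.table X ∈ I.Δ.rules X := by
  have := pick_mem (fun γ => !wins I.sat true γ)
    (L := (I.ruleList X).filter (fun γ => !wins I.sat false γ) ++ I.ruleList X)
    (by simp [I.ruleList_ne_nil])
  rw [List.mem_append, List.mem_filter] at this
  exact mem_ruleList.1 (this.elim And.left id)

variable {I}

/-- Whatever the status of the lower part of a stack of `◇` is, a losing symbol on top of it is replaced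
by a losing word. -/
theorem wins_table {X : Fin I.n} {b : Bool} (h : I.sat X b = false)
    (hX : I.Δ.owner X = Owner.diamond) : wins I.sat b (I.table X) = false := by
  have hw {b : Bool} : I.sat X b = false → ∃ γ ∈ I.ruleList X, wins I.sat b γ = false := by
    rw [← Bool.not_eq_true, sat_eq_true]
    intro h
    simp only [hX, true_and, not_or, not_forall, Bool.not_eq_true] at h
    obtain ⟨-, ⟨γ, hγ, h⟩, -⟩ := h
    exact ⟨γ, hγ, h⟩
  have hmono (γ : List (Fin I.n)) (h : wins I.sat true γ = false) : wins I.sat b γ = false := by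
    have := wins_mono (A := I.sat) (B := I.sat) (I.stage_mono_right _) (Bool.le_true b) γ
    rw [h] at this
    exact le_bot_iff.1 this
  by_cases ht : ∃ γ ∈ I.ruleList X, wins I.sat true γ = false
  · refine hmono _ ?_
    obtain ⟨γ, hγ, h⟩ := ht
    simpa [table] using pick_spec (p := fun γ => !wins I.sat true γ)
      (L := (I.ruleList X).filter (fun γ => !wins I.sat false γ) ++ I.ruleList X)
      ⟨γ, by simp [hγ], by simp [h]⟩
  · -- the status below `X` cannot be `true`, and the first filter in `table` is empty
    obtain rfl : b = false := by
      by_contra hb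
      rw [Bool.not_eq_false] at hb
      exact ht (hw (hb ▸ h))
    have hnil : ((I.ruleList X).filter (fun γ => !wins I.sat false γ) ++ I.ruleList X).filter
        (fun γ => !wins I.sat true γ) = [] := by
      rw [List.filter_eq_nil_iff]
      intro γ hγ h₁
      rw [List.mem_append, List.mem_filter] at hγ
      exact ht ⟨γ, hγ.elim And.left id, by simpa using h₁⟩
    rw [table, pick, hnil, List.nil_append]
    change wins I.sat false (pick _ _) = false
    obtain ⟨γ, hγ, h⟩ := hw h
    simpa only [Bool.not_eq_true'] using pick_spec (p := fun γ => !wins I.sat false γ) (L := I.ruleList X)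
      ⟨γ, hγ, by simp [h]⟩

variable (I)

/-- The move of the strategy of `◇` in a configuration. -/
def tableMove : List (Fin I.n) → List (Fin I.n)
  | [] => []
  | X :: α => I.table X ++ α

theorem edge_tableMove (α : List (Fin I.n)) : I.Δ.game.edge α (I.tableMove α) := by
  cases α with
  | nil => rfl
  | cons X α => exact ⟨_, I.table_mem X, rfl⟩

/-- The SMD strategy of `◇`. -/
noncomputable def diamondStrategy : I.Δ.game.Strategy Owner.diamond :=
  I.Δ.game.memoryless Owner.diamond I.tableMove I.edge_tableMove

/-- The configurations that are not winning after the saturation form a trap for `□`. -/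
theorem winningZero_diamondStrategy {α : List (Fin I.n)} (hα : wins I.sat false α = false) :
    StochasticGame.WinningZero I.T I.diamondStrategy α := by
  refine StochasticGame.winningZero_of_trap (D := {α | wins I.sat false α = false})
    I.edge_tableMove ?_ ?_ ?_ hα
  · rintro α hα ⟨X, hX, α, rfl⟩
    rw [Set.mem_ofPred_eq, wins, List.foldr_cons, Bool.eq_false_iff] at hα
    exact hα (sat_eq_true.2 (.inl hX))
  · rintro (_ | ⟨X, α⟩) hα ho
    · exact hα
    · rw [Set.mem_ofPred_eq, tableMove, wins_append]
      exact wins_table hα ho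
  · rintro (_ | ⟨X, α⟩) hα ho u hu
    · obtain rfl : u = [] := hu
      exact hα
    · obtain ⟨γ, hγ, rfl⟩ := hu
      rw [Set.mem_ofPred_eq, wins_append]
      rw [Set.mem_ofPred_eq, wins, List.foldr_cons, Bool.eq_false_iff] at hα
      rw [Bool.eq_false_iff]
      intro h
      exact hα (sat_eq_true.2 (.inr (.inr ⟨ho, γ, mem_ruleList.2 hγ, h⟩)))

/-! ### The strategy of `□` -/

/-- The rank of a symbol on top of a stack of status `b`: one less than the first stage at which
it is winning, and `bound` if there is none. -/
def rank (b : Bool) (X : Fin I.n) : ℕ :=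
  ((List.range I.bound).filter fun i => !I.stage (i + 1) X b).length

/-- The rank of the stack that results from putting `X` on a stack of rank `m`. -/
def push (X : Fin I.n) (m : ℕ) : ℕ := min (I.rank false X) (max (I.rank true X) m)

/-- The rank of a stack: one less than the first stage at which it is winning, and `bound` if there
is none. -/
def height (α : List (Fin I.n)) : ℕ := α.foldr I.push I.bound

/-- The rule used by `□` in a configuration with top symbol `X` above a stack of rank `m`. It reaches
for the target above that stack if this was found to be possible not later than winning by removing
`X`, and otherwise it tries to remove `X`. In both cases the rule has to be winning at the stage
before the one at which `X` is found to be winning in this way. -/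
def choose (X : Fin I.n) (m : ℕ) : List (Fin I.n) :=
  bif decide (I.rank false X ≤ max (I.rank true X) m)
    then pick (wins (I.stage (I.rank false X)) false) (I.ruleList X)
    else pick (wins (I.stage (I.rank true X)) true) (I.ruleList X)

theorem choose_mem (X : Fin I.n) (m : ℕ) : I.choose X m ∈ I.Δ.rules X := by
  rw [choose]
  cases decide (I.rank false X ≤ max (I.rank true X) m)
  · exact mem_ruleList.1 (pick_mem _ (I.ruleList_ne_nil X))
  · exact mem_ruleList.1 (pick_mem _ (I.ruleList_ne_nil X))

theorem rank_le (b : Bool) (X : Fin I.n) : I.rank b X ≤ I.bound :=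
  (List.length_filter_le _ _).trans List.length_range.le

variable {I}

theorem rank_le_iff {b : Bool} {X : Fin I.n} {i : ℕ} (hi : i < I.bound) :
    I.rank b X ≤ i ↔ I.stage (i + 1) X b = true := by
  have h : I.rank b X =
      ((Finset.range I.bound).filter fun i => I.stage (i + 1) X b = false).card := by
    rw [rank, ← List.toFinset_card_of_nodup (List.nodup_range.filter _), List.toFinset_filter]
    simp [List.toFinset_range]
  rw [h]
  constructor
  · intro h
    by_contra hs
    have : Finset.range (i + 1) ⊆
        (Finset.range I.bound).filter fun i => I.stage (i + 1) X b = false := by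
      intro j hj
      rw [Finset.mem_range] at hj
      rw [Finset.mem_filter, Finset.mem_range, Bool.eq_false_iff]
      exact ⟨by omega, fun h => hs (stage_mono (by omega) h)⟩
    have := Finset.card_le_card this
    rw [Finset.card_range] at this
    omega
  · intro hs
    rw [← Finset.card_range i]
    refine Finset.card_le_card fun j hj => ?_
    rw [Finset.mem_filter, Bool.eq_false_iff] at hj
    rw [Finset.mem_range]
    by_contra h
    exact hj.2 (stage_mono (by omega) hs)

theorem height_cons (X : Fin I.n) (α : List (Fin I.n)) :
    I.height (X :: α) = min (I.rank false X) (max (I.rank true X) (I.height α)) := rfl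

theorem height_le (α : List (Fin I.n)) : I.height α ≤ I.bound := by
  cases α with
  | nil => exact le_rfl
  | cons X α => exact (min_le_left _ _).trans (I.rank_le _ _)

theorem height_append_le (α β : List (Fin I.n)) : I.height (α ++ β) ≤ I.height α := by
  induction α with
  | nil => exact height_le _
  | cons X α ih =>
    rw [List.cons_append, height_cons, height_cons]
    gcongr

theorem height_le_iff {α : List (Fin I.n)} {i : ℕ} (hi : i < I.bound) :
    I.height α ≤ i ↔ wins (I.stage (i + 1)) false α = true := by
  induction α with
  | nil => simpa [height, wins] using hi
  | cons X α ih =>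
    rw [height_cons, min_le_iff, max_le_iff, ih, rank_le_iff hi, rank_le_iff hi]
    change _ ↔ I.stage (i + 1) X (wins (I.stage (i + 1)) false α) = true
    cases wins (I.stage (i + 1)) false α with
    | false => simp
    | true => simpa using stage_mono_status true

variable (I)

/-- The move of the strategy of `□` in a configuration. -/
def chooseMove : List (Fin I.n) → List (Fin I.n)
  | [] => []
  | X :: α => I.choose X (I.height α) ++ α

theorem edge_chooseMove (α : List (Fin I.n)) : I.Δ.game.edge α (I.chooseMove α) := by
  cases α with
  | nil => rfl
  | cons X α => exact ⟨_, I.choose_mem X _, rfl⟩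

/-- The regular strategy of `□`. -/
noncomputable def boxStrategy : I.Δ.game.Strategy Owner.box :=
  I.Δ.game.memoryless Owner.box I.chooseMove I.edge_chooseMove

variable {I}

/-- A symbol of rank below `bound` was found to be winning by a round of the saturation; the moves
considered in that round lead from `X :: α` to the configurations `γ ++ α` of `h`. -/
theorem attr_cons {b : Bool} {X : Fin I.n} {α : List (Fin I.n)} (hb : I.rank b X < I.bound)
    (hc : (∃ γ ∈ I.ruleList X, wins (I.stage (I.rank b X)) b γ = true) →
      wins (I.stage (I.rank b X)) b (I.choose X (I.height α)) = true)
    (h : ∀ γ, wins (I.stage (I.rank b X)) b γ = true → I.Δ.game.Attr I.T I.chooseMove (γ ++ α)) :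
    I.Δ.game.Attr I.T I.chooseMove (X :: α) := by
  have hX := (rank_le_iff hb).1 le_rfl
  rw [stage_succ, round_eq_true] at hX
  obtain hX | ⟨ho, hX⟩ | ⟨ho, hX⟩ := hX
  · exact .target ⟨X, hX, α, rfl⟩
  · refine .diamond ho ?_
    rintro u ⟨γ, hγ, rfl⟩
    exact h γ (hX γ (mem_ruleList.2 hγ))
  · cases ho' : I.Δ.owner X with
    | box => exact .box ho' (h _ (hc hX))
    | diamond => exact absurd ho' ho
    | random =>
      obtain ⟨γ, hγ, hX⟩ := hX
      exact .random ho' ⟨γ, mem_ruleList.1 hγ, rfl⟩ (h γ hX)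

/-- Reaching for the target above a stack: here the rank decreases. -/
theorem attr_cons_false {X : Fin I.n} {α : List (Fin I.n)} {r : ℕ} (hr : r < I.bound)
    (hX : I.rank false X ≤ r) (hα : I.rank false X ≤ max (I.rank true X) (I.height α))
    (ih : ∀ β, I.height β < r → I.Δ.game.Attr I.T I.chooseMove β) :
    I.Δ.game.Attr I.T I.chooseMove (X :: α) := by
  refine attr_cons (b := false) (by omega) (fun h => ?_) fun γ hγ => ?_
  · rw [choose, decide_eq_true hα, cond_true]
    exact pick_spec h
  · cases hk : I.rank false X with
    | zero =>
      -- no word is winning at stage `0`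
      exfalso
      rw [hk] at hγ
      cases γ with
      | nil => exact Bool.false_ne_true hγ
      | cons Y γ => exact Bool.false_ne_true hγ
    | succ k =>
      rw [hk, ← height_le_iff (by omega)] at hγ
      exact ih _ (((height_append_le γ α).trans hγ).trans_lt (by omega))

/-- Removing symbols from the top of a stack in the attractor: here the rank of the removed symbols
decreases, unless the rank of the whole stack does. -/
theorem attr_cons_true {r : ℕ} (hr : r < I.bound)
    (ih : ∀ β, I.height β < r → I.Δ.game.Attr I.T I.chooseMove β) {X : Fin I.n}
    {α : List (Fin I.n)} (hα : I.Δ.game.Attr I.T I.chooseMove α) (hαr : I.height α ≤ r)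
    (hX : I.rank true X ≤ r) : I.Δ.game.Attr I.T I.chooseMove (X :: α) := by
  induction hk : I.rank true X using Nat.strong_induction_on generalizing X α with
  | _ k ihk =>
  by_cases hm : I.rank false X ≤ max (I.rank true X) (I.height α)
  · exact attr_cons_false hr (hm.trans (max_le hX hαr)) hm ih
  refine attr_cons (b := true) (by omega) (fun h => ?_) fun γ hγ => ?_
  · rw [choose, decide_eq_false hm, cond_false]
    exact pick_spec h
  rw [hk] at hγ
  suffices h : I.Δ.game.Attr I.T I.chooseMove (γ ++ α) ∧ I.height (γ ++ α) ≤ r from h.1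
  induction γ with
  | nil => exact ⟨hα, hαr⟩
  | cons Y γ ihγ =>
    obtain _ | k := k
    · exact (Bool.false_ne_true hγ).elim
    change I.stage (k + 1) Y (wins (I.stage (k + 1)) true γ) = true at hγ
    rw [List.cons_append, height_cons]
    cases hw : wins (I.stage (k + 1)) true γ with
    | false =>
      -- `Y` wins without being removed, so the rank of the whole stack is below `r`
      rw [hw, ← rank_le_iff (by omega)] at hγ
      refine ⟨ih _ ?_, (min_le_left _ _).trans (by omega)⟩
      rw [height_cons]
      exact (min_le_left _ _).trans_lt (by omega)
    | true =>
      rw [hw, ← rank_le_iff (by omega)] at hγ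
      obtain ⟨h₁, h₂⟩ := ihγ hw
      exact ⟨ihk _ (by omega) h₁ h₂ (by omega) rfl,
        (min_le_right _ _).trans (max_le (by omega) h₂)⟩

/-- By induction on the rank `r` of a configuration, and for fixed `r` by induction on the
configuration. -/
theorem attr_of_height_lt {α : List (Fin I.n)} (hα : I.height α < I.bound) :
    I.Δ.game.Attr I.T I.chooseMove α := by
  suffices key : ∀ r < I.bound, ∀ α, I.height α ≤ r → I.Δ.game.Attr I.T I.chooseMove α from
    key _ hα α le_rfl
  intro r hr
  induction r using Nat.strong_induction_on with
  | _ r ihr =>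
  have ih (β : List (Fin I.n)) (hβ : I.height β < r) : I.Δ.game.Attr I.T I.chooseMove β :=
    ihr _ hβ (hβ.trans hr) β le_rfl
  intro α hα
  induction α with
  | nil => exact absurd hα hr.not_ge
  | cons X α ihα =>
    by_cases hm : max (I.rank true X) (I.height α) ≤ r
    · obtain ⟨h₁, h₂⟩ := max_le_iff.1 hm
      exact attr_cons_true hr ih (ihα h₂) h₂ h₁
    · rw [height_cons] at hα
      exact attr_cons_false hr (by omega) (by omega) ih

theorem winningPos_boxStrategy {α : List (Fin I.n)} (hα : wins I.sat false α = true) :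
    StochasticGame.WinningPos I.T I.boxStrategy α := by
  refine (attr_of_height_lt ?_).winningPos
  cases hn : I.bound with
  | zero =>
    -- there are no stack symbols
    cases α with
    | nil => exact absurd hα (by simp [wins])
    | cons X α => exact absurd X.2 (by simp only [bound] at hn; omega)
  | succ m =>
    rw [sat, hn, ← height_le_iff (by omega)] at hα
    omega

variable (I)

theorem WBox_eq : I.WBox = {α | wins I.sat false α = true} := by
  ext α
  refine ⟨fun h => ?_, fun h => ⟨_, winningPos_boxStrategy h⟩⟩
  by_contra hα
  exact (I.winningZero_diamondStrategy (by simpa using hα)).notMem_regionPos h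

theorem WDiamond_eq : I.WDiamond = {α | wins I.sat false α = false} := by
  ext α
  refine ⟨fun h => ?_, fun h => ⟨_, I.winningZero_diamondStrategy h⟩⟩
  by_contra hα
  exact (winningPos_boxStrategy (by simpa using hα)).notMem_regionZero h

end BPAInstance

/-! ### The saturation on the data of an instance -/

/-- The entry for the symbol `X` and the status `b` in a table that lists, for every symbol, the
values for the statuses `false` and `true`. -/
def lookup (t : List (Bool × Bool)) (X : ℕ) (b : Bool) : Bool :=
  bif b then (t.getD X (false, false)).2 else (t.getD X (false, false)).1

/-- The value of one round of the saturation for a symbol with the data `d`. The second digit of the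
owner tells whether it is `◇`. -/
def roundEntry (t : List (Bool × Bool)) (d : SymbolData) (b : Bool) : Bool :=
  d.2.1 || bif d.1.2 then d.2.2.all (wins (lookup t) b) else d.2.2.any (wins (lookup t) b)

/-- `BPAInstance.round` as an operation on tables. -/
def roundTab (D : List SymbolData) (t : List (Bool × Bool)) : List (Bool × Bool) :=
  D.map fun d => (roundEntry t d false, roundEntry t d true)

/-- `BPAInstance.stage` as a table; a missing entry counts as `false`. -/
def stageTab (D : List SymbolData) (i : ℕ) : List (Bool × Bool) :=
  (List.replicate i ()).foldl (fun t _ => roundTab D t) []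

/-- `BPAInstance.sat` as a table. -/
def satTab (D : List SymbolData) : List (Bool × Bool) := stageTab D (D.length + D.length)

/-- The rules of the symbol `X`. -/
def rulesOf (D : List SymbolData) (X : ℕ) : List (List ℕ) :=
  (D.getD X ((false, false), false, [])).2.2

/-- `BPAInstance.table` on the data of an instance. -/
def tableOf (D : List SymbolData) (X : ℕ) : List ℕ :=
  pick (fun γ => !wins (lookup (satTab D)) true γ)
    ((rulesOf D X).filter (fun γ => !wins (lookup (satTab D)) false γ) ++ rulesOf D X)

/-- `BPAInstance.rank` on the data of an instance. -/
def rankOf (D : List SymbolData) (b : Bool) (X : ℕ) : ℕ :=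
  ((List.range (D.length + D.length)).filter fun i => !lookup (stageTab D (i + 1)) X b).length

/-- `BPAInstance.push` on the data of an instance. -/
def pushOf (D : List SymbolData) (X m : ℕ) : ℕ :=
  min (rankOf D false X) (max (rankOf D true X) m)

/-- `BPAInstance.choose` on the data of an instance. -/
def chooseOf (D : List SymbolData) (X m : ℕ) : List ℕ :=
  bif decide (rankOf D false X ≤ max (rankOf D true X) m)
    then pick (wins (lookup (stageTab D (rankOf D false X))) false) (rulesOf D X)
    else pick (wins (lookup (stageTab D (rankOf D true X))) true) (rulesOf D X)

namespace PolyTime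

variable {α β : Type} [HasCode α] [HasCode β]

@[fun_prop]
theorem lookup {t : α → List (Bool × Bool)} {X : α → ℕ} {b : α → Bool} (ht : PolyTime t)
    (hX : PolyTime X) (hb : PolyTime b) : PolyTime fun a => lookup (t a) (X a) (b a) := by
  unfold _root_.lookup
  fun_prop

attribute [local irreducible] _root_.lookup in
@[fun_prop]
theorem wins_lookup {t : α → List (Bool × Bool)} {γ : α → List ℕ} {b : α → Bool}
    (ht : PolyTime t) (hb : PolyTime b) (hγ : PolyTime γ) :
    PolyTime fun a => wins (_root_.lookup (t a)) (b a) (γ a) :=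
  foldr_bool (g := fun a X s => _root_.lookup (t a) X s) hγ
    ((ht.comp (f := fun p : α × Bool × ℕ => p.1) (by fun_prop)).lookup (by fun_prop)
      (by fun_prop)) hb

theorem pick {p : α → List ℕ → Bool} {L : α → List (List ℕ)}
    (hp : PolyTime fun x : α × List ℕ => p x.1 x.2) (hL : PolyTime L) :
    PolyTime fun a => pick (p a) (L a) := by
  unfold _root_.pick
  fun_prop

section

-- `fun_prop` is to apply the lemmas on these functions instead of unfolding them
attribute [local irreducible] _root_.lookup wins

@[fun_prop]
theorem roundTab {D : α → List SymbolData} {t : α → List (Bool × Bool)} (hD : PolyTime D)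
    (ht : PolyTime t) : PolyTime fun a => roundTab (D a) (t a) := by
  have h : PolyTime fun x : (List (Bool × Bool) × SymbolData) × Bool =>
      roundEntry x.1.1 x.1.2 x.2 := by
    unfold roundEntry
    fun_prop
  have h' (b : Bool) : PolyTime fun x : List (Bool × Bool) × SymbolData =>
      roundEntry x.1 x.2 b :=
    h.comp (f := fun x => (x, b)) (by fun_prop)
  have h₁ (b : Bool) : PolyTime fun x : α × SymbolData => roundEntry (t x.1) x.2 b :=
    (h' b).comp (f := fun x : α × SymbolData => (t x.1, x.2)) (by fun_prop)
  unfold _root_.roundTab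
  exact map ((h₁ false).prodMk (h₁ true)) hD

theorem csize_roundTab_le (D : List SymbolData) (t : List (Bool × Bool)) :
    csize (_root_.roundTab D t) ≤ D.length * 8 + 1 := by
  refine (csize_le_of_forall (s := 7) fun x _ => ?_).trans (by simp [_root_.roundTab])
  have h₁ := csize_bool_le x.1
  have h₂ := csize_bool_le x.2
  rw [csize_pair]
  omega

attribute [local irreducible] _root_.roundTab

@[fun_prop]
theorem stageTab {D : α → List SymbolData} {i : α → ℕ} (hD : PolyTime D) (hi : PolyTime i) :
    PolyTime fun a => stageTab (D a) (i a) := by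
  have hs : PolyTime fun a => (D a).length := by fun_prop
  refine foldl_of_bdd (l := fun a => List.replicate (i a) ())
    (g := fun a t _ => _root_.roundTab (D a) t) (y := fun _ => []) (by fun_prop) (by fun_prop)
    (by fun_prop) (((hD.bdd).mul (.const 8)).add (.const 1)) fun a j _ => ?_
  have h : (D a).length * 8 + 1 ≤ csize (D a) * 8 + 1 := by
    have := length_lt_csize (D a)
    omega
  refine le_trans ?_ h
  rcases List.eq_nil_or_concat' ((List.replicate (i a) ()).take j) with h | ⟨l, x, h⟩ <;> rw [h]
  · simp
  · rw [List.foldl_append]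
    exact csize_roundTab_le _ _

attribute [local irreducible] _root_.stageTab

@[fun_prop]
theorem satTab {D : α → List SymbolData} (hD : PolyTime D) : PolyTime fun a => satTab (D a) := by
  unfold _root_.satTab
  fun_prop

attribute [local irreducible] _root_.satTab

@[fun_prop]
theorem rulesOf {D : α → List SymbolData} {X : α → ℕ} (hD : PolyTime D) (hX : PolyTime X) :
    PolyTime fun a => rulesOf (D a) (X a) := by
  unfold _root_.rulesOf
  fun_prop

attribute [local irreducible] _root_.rulesOf

@[fun_prop]
theorem tableOf {D : α → List SymbolData} {X : α → ℕ} (hD : PolyTime D) (hX : PolyTime X) :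
    PolyTime fun a => tableOf (D a) (X a) := by
  unfold _root_.tableOf
  exact pick (p := fun a γ => !wins (_root_.lookup (_root_.satTab (D a))) true γ) (by fun_prop)
    (by fun_prop)

@[fun_prop]
theorem rankOf {D : α → List SymbolData} {X : α → ℕ} (hD : PolyTime D) (b : Bool)
    (hX : PolyTime X) : PolyTime fun a => rankOf (D a) b (X a) := by
  unfold _root_.rankOf
  fun_prop

attribute [local irreducible] _root_.rankOf

@[fun_prop]
theorem pushOf {D : α → List SymbolData} {X m : α → ℕ} (hD : PolyTime D) (hX : PolyTime X)
    (hm : PolyTime m) : PolyTime fun a => pushOf (D a) (X a) (m a) := by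
  unfold _root_.pushOf
  fun_prop

@[fun_prop]
theorem chooseOf {D : α → List SymbolData} {X m : α → ℕ} (hD : PolyTime D) (hX : PolyTime X)
    (hm : PolyTime m) : PolyTime fun a => chooseOf (D a) (X a) (m a) := by
  have h (b : Bool) : PolyTime fun a => _root_.pick
      (wins (_root_.lookup (_root_.stageTab (D a) (_root_.rankOf (D a) b (X a)))) b)
      (_root_.rulesOf (D a) (X a)) :=
    pick (p := fun a => wins
      (_root_.lookup (_root_.stageTab (D a) (_root_.rankOf (D a) b (X a)))) b)
      (by fun_prop) (by fun_prop)
  have h₀ := h false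
  have h₁ := h true
  unfold _root_.chooseOf
  fun_prop

end

/-! ### Printing -/

@[fun_prop]
theorem encodeNat {f : α → ℕ} (hf : PolyTime f) : PolyTime fun a => Encode.nat (f a) := by
  unfold Encode.nat
  fun_prop

@[fun_prop]
theorem encodeList {e : α → β → List Tok} {l : α → List β}
    (he : PolyTime fun x : α × β => e x.1 x.2) (hl : PolyTime l) :
    PolyTime fun a => Encode.list (e a) (l a) := by
  unfold Encode.list
  fun_prop

end PolyTime

namespace Encode

theorem list_map {β γ : Type} (e : γ → List Tok) (f : β → γ) (l : List β) :
    list e (l.map f) = list (fun b => e (f b)) l := by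
  rw [list, List.flatMap_map, list]

theorem list_eq_list_id {β : Type} {e : β → List Tok} {l : List β} {L : List (List Tok)}
    (h : l.map e = L) : list e l = list id L := by
  rw [← h, list_map]
  rfl

theorem list_finRange {n : ℕ} (e : ℕ → List Tok) :
    list (fun X : Fin n => e X) (List.finRange n) = list e (List.range n) := by
  rw [← List.map_coe_finRange_eq_range, list_map]

end Encode

/-! ### Correctness of the tables -/

theorem pick_map {α β : Type} {f : α → β} {p : List α → Bool} {q : List β → Bool}
    (h : ∀ γ, q (γ.map f) = p γ) (L : List (List α)) :
    pick q (L.map (List.map f)) = (pick p L).map f := by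
  have : q ∘ List.map f = p := funext h
  rw [pick, pick, List.filter_map, this, ← List.map_append]
  cases L.filter p ++ L <;> rfl

theorem wins_map {α β : Type} {f : α → β} {A : α → Bool → Bool} {B : β → Bool → Bool}
    (h : ∀ X b, B (f X) b = A X b) (b : Bool) (γ : List α) :
    wins B b (γ.map f) = wins A b γ := by
  induction γ with
  | nil => rfl
  | cons X γ ih =>
    change B (f X) (wins B b (γ.map f)) = A X (wins A b γ)
    rw [ih, h]

namespace BPAInstance

variable (I : BPAInstance)

theorem length_data : I.data.length = I.n := by simp [data]

theorem getD_map_data {β : Type} (f : SymbolData → β) (X : Fin I.n) (y : β) :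
    (I.data.map f).getD X y = f ((I.Δ.owner X).digits, decide (X ∈ I.ΓT),
      (I.ruleList X).map (List.map Fin.val)) := by
  simp [data, ruleList]

theorem rulesOf_data (X : Fin I.n) :
    rulesOf I.data X = (I.ruleList X).map (List.map Fin.val) := by
  have := I.getD_map_data id X ((false, false), false, [])
  rw [List.map_id] at this
  rw [rulesOf, this]
  rfl

theorem lookup_stageTab (i : ℕ) (X : Fin I.n) (b : Bool) :
    lookup (stageTab I.data i) X b = I.stage i X b := by
  induction i generalizing X b with
  | zero => cases b <;> rfl
  | succ i ih =>
    have hs : stageTab I.data (i + 1) = roundTab I.data (stageTab I.data i) := by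
      simp [stageTab, List.replicate_succ']
    have hr : lookup (stageTab I.data (i + 1)) X b = roundEntry (stageTab I.data i)
        ((I.Δ.owner X).digits, decide (X ∈ I.ΓT), (I.ruleList X).map (List.map Fin.val)) b := by
      rw [hs, lookup, roundTab, getD_map_data]
      cases b <;> rfl
    rw [hr, stage_succ, roundEntry, round]
    have hw : wins (lookup (stageTab I.data i)) b ∘ List.map Fin.val = wins (I.stage i) b :=
      funext fun γ => wins_map ih b γ
    simp only [List.all_map, List.any_map, hw]
    cases I.Δ.owner X <;> rfl

theorem lookup_satTab (X : Fin I.n) (b : Bool) : lookup (satTab I.data) X b = I.sat X b := by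
  rw [satTab, length_data]
  exact I.lookup_stageTab _ X b

theorem tableOf_data (X : Fin I.n) : tableOf I.data X = (I.table X).map Fin.val := by
  have h (b : Bool) (γ : List (Fin I.n)) :
      (!wins (lookup (satTab I.data)) b (γ.map Fin.val)) = !wins I.sat b γ := by
    rw [wins_map I.lookup_satTab]
  rw [table, ← pick_map (q := fun γ => !wins (lookup (satTab I.data)) true γ) (h true), tableOf, rulesOf_data, List.filter_map, List.map_append,
    ← funext (h false)]
  rfl

theorem rankOf_data (b : Bool) (X : Fin I.n) : rankOf I.data b X = I.rank b X := by
  simp only [rankOf, rank, lookup_stageTab, length_data]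

theorem pushOf_data (X : Fin I.n) (m : ℕ) : pushOf I.data X m = I.push X m := by
  rw [pushOf, rankOf_data, rankOf_data, push]

theorem chooseOf_data (X : Fin I.n) (m : ℕ) :
    chooseOf I.data X m = (I.choose X m).map Fin.val := by
  have h (i : ℕ) (b : Bool) : pick (wins (lookup (stageTab I.data i)) b) (rulesOf I.data X) =
      (pick (wins (I.stage i) b) (I.ruleList X)).map Fin.val := by
    rw [rulesOf_data]
    exact pick_map (wins_map (I.lookup_stageTab i) b) _
  simp only [chooseOf, choose, rankOf_data, h]
  cases decide (I.rank false X ≤ max (I.rank true X) m) <;> rfl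

end BPAInstance

/-! ### The automata for the winning regions -/

namespace BPAInstance

variable (I : BPAInstance)

/-- The automaton for one of the winning regions, for `W_□(T, >0)` if `b` is true. Reading a
configuration from its top, it searches for a symbol from which `□` can win without removing it
(state `1`); a symbol that `□` can neither win from nor remove ends the search without success
(state `2`). -/
def regionDFA (b : Bool) : DFA (Fin I.n) (Fin 3) where
  step q X := bif decide (q = 0)
    then (bif I.sat X false then 1 else bif I.sat X true then 0 else 2) else q
  start := 0
  accept := {q | decide (q = 1) = b}

variable {I} in
theorem evalFrom_regionDFA {b : Bool} {q : Fin 3} (hq : q ≠ 0) (α : List (Fin I.n)) :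
    (I.regionDFA b).evalFrom q α = q := by
  induction α with
  | nil => rfl
  | cons X α ih =>
    rw [DFA.evalFrom_cons]
    convert ih
    simp [regionDFA, hq]

theorem eval_regionDFA (b : Bool) (α : List (Fin I.n)) :
    decide ((I.regionDFA b).eval α = 1) = wins I.sat false α := by
  change decide ((I.regionDFA b).evalFrom 0 α = 1) = _
  induction α with
  | nil => rfl
  | cons X α ih =>
    rw [DFA.evalFrom_cons]
    change _ = I.sat X (wins I.sat false α)
    have hs : (I.regionDFA b).step 0 X =
        bif I.sat X false then 1 else bif I.sat X true then 0 else 2 := rfl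
    rw [hs]
    cases h₀ : I.sat X false with
    | true =>
      rw [cond_true, evalFrom_regionDFA (by decide)]
      exact (stage_mono_status _ h₀).symm
    | false =>
      cases h₁ : I.sat X true with
      | true =>
        rw [cond_false, cond_true, ih]
        cases wins I.sat false α <;> simp [h₀, h₁]
      | false =>
        rw [cond_false, cond_false, evalFrom_regionDFA (by decide)]
        cases wins I.sat false α <;> simp [h₀, h₁]

theorem mem_accepts_regionDFA (b : Bool) (α : List (Fin I.n)) :
    α ∈ (I.regionDFA b).accepts ↔ wins I.sat false α = b := by
  rw [← eval_regionDFA I b α]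
  rfl

end BPAInstance

/-- The transition function of `BPAInstance.regionDFA` on the data of an instance. -/
def regionStep (D : List SymbolData) (q X : ℕ) : ℕ := bif decide (q = 0)
  then (bif lookup (satTab D) X false then 1 else bif lookup (satTab D) X true then 0 else 2) else q

/-- The encoding of `BPAInstance.regionDFA` in terms of the data of an instance. -/
def printRegion (b : Bool) (D : List SymbolData) : List Tok :=
  Encode.nat 0 ++ Encode.list (fun q => Encode.nat q ++
    [Tok.bit (bif b then decide (q = 1) else !decide (q = 1))] ++
      Encode.list (fun X => Encode.nat (regionStep D q X)) (List.range D.length)) (List.range 3)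

theorem encode_regionDFA (b : Bool) (I : BPAInstance) :
    Encode.dfa ⟨3, I.regionDFA b⟩ = printRegion b I.data := by
  have ha (q : Fin 3) : (q ∈ (I.regionDFA b).accept) ↔
      (bif b then decide ((q : ℕ) = 1) else !decide ((q : ℕ) = 1)) = true := by
    change decide (q = 1) = b ↔ _
    revert q b
    decide
  have hs (q : Fin 3) (X : Fin I.n) :
      ((I.regionDFA b).step q X : ℕ) = regionStep I.data q X := by
    rw [regionStep, I.lookup_satTab, I.lookup_satTab]
    change ((bif decide (q = 0) then
      (bif I.sat X false then 1 else bif I.sat X true then 0 else 2) else q : Fin 3) : ℕ) = _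
    generalize I.sat X false = c, I.sat X true = d
    revert q c d
    decide
  unfold Encode.dfa printRegion
  rw [← Encode.list_finRange, I.length_data]
  simp only [← Encode.list_finRange, ha, hs, Bool.decide_eq_true]
  rfl

theorem polyTime_printRegion (b : Bool) : PolyTime (printRegion b) := by
  have h : PolyTime fun x : List SymbolData × ℕ × ℕ => regionStep x.1 x.2.1 x.2.2 := by
    unfold regionStep
    fun_prop
  have h' : PolyTime fun x : (List SymbolData × ℕ) × ℕ => regionStep x.1.1 x.1.2 x.2 :=
    h.comp (f := fun x : (List SymbolData × ℕ) × ℕ => (x.1.1, x.1.2, x.2)) (by fun_prop)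
  unfold printRegion
  fun_prop

/-! ### The automaton for the strategy of `□` -/

/-- The values for the control states of the automaton for the strategy of `□`: the value `x` for
the initial state, followed by the values `f X m` for the states `BPAInstance.state X m`. -/
def stateList {β : Type} (n N : ℕ) (x : β) (f : ℕ → ℕ → β) : List β :=
  x :: (List.range (N + 1)).flatMap fun m => (List.range n).map fun X => f X m

theorem map_finRange_eq_stateList {β : Type} {n N : ℕ} {x : β} {f : ℕ → ℕ → β}
    {F : Fin ((N + 1) * n + 1) → β} (h₀ : F 0 = x)
    (h : ∀ (m : Fin (N + 1)) (X : Fin n), F (finProdFinEquiv (m, X)).succ = f X m) :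
    (List.finRange _).map F = stateList n N x f := by
  rw [List.finRange_succ, List.map_cons, h₀, List.map_map, ← List.ofFn_eq_map, List.ofFn_mul,
    stateList, ← List.map_coe_finRange_eq_range, ← List.map_coe_finRange_eq_range,
    List.flatMap_map, List.ofFn_eq_map, ← List.flatMap_def]
  congr 2
  funext m
  rw [List.ofFn_eq_map, List.map_map]
  congr 1
  funext X
  refine (congrArg (fun q => F (Fin.succ q)) (Fin.ext ?_)).trans (h m X)
  simp only [finProdFinEquiv_apply_val]
  ring

theorem PolyTime.stateList {α β : Type} [HasCode α] [HasCode β] {n N : α → ℕ} {x : α → β}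
    {f : α → ℕ → ℕ → β} (hn : PolyTime n) (hN : PolyTime N) (hx : PolyTime x)
    (hf : PolyTime fun p : (α × ℕ) × ℕ => f p.1.1 p.2 p.1.2) :
    PolyTime fun a => stateList (n a) (N a) (x a) (f a) := by
  have hn' : PolyTime fun p : α × ℕ => n p.1 := hn.comp (by fun_prop)
  have hr : PolyTime fun p : α × ℕ => (List.range (n p.1)).map fun X => f p.1 X p.2 :=
    map hf (by fun_prop)
  unfold _root_.stateList
  fun_prop

namespace BPAInstance

variable (I : BPAInstance)

theorem push_lt (X : Fin I.n) (m : ℕ) : I.push X m < I.bound + 1 :=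
  Nat.lt_succ_of_le ((min_le_left _ _).trans (I.rank_le _ _))

/-- The control state that is entered when `X` is read on top of a stack of rank `m`. -/
def state (X : Fin I.n) (m : Fin (I.bound + 1)) : Fin ((I.bound + 1) * I.n + 1) :=
  (finProdFinEquiv (m, X)).succ

/-- The automaton for the strategy of `□`. Its control states are an initial state `0` and the
states `state X m`. -/
def strategyAutomaton : StrategyAutomaton (Fin I.n) where
  k := (I.bound + 1) * I.n + 1
  dfa :=
    { step := fun q X => Fin.cases (motive := fun _ => Fin ((I.bound + 1) * I.n + 1))
        (I.state X (Fin.last _)) (fun q => I.state X ⟨I.push (finProdFinEquiv.symm q).2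
          (finProdFinEquiv.symm q).1, I.push_lt _ _⟩) q
      start := 0
      accept := ∅ }
  choice q := Fin.cases (motive := fun _ => List (Fin I.n)) []
    (fun q => I.choose (finProdFinEquiv.symm q).2 (finProdFinEquiv.symm q).1) q

theorem step_strategyAutomaton_zero (X : Fin I.n) :
    I.strategyAutomaton.dfa.step (0 : Fin ((I.bound + 1) * I.n + 1)) X =
      I.state X (Fin.last _) := rfl

theorem step_strategyAutomaton_state (X Y : Fin I.n) (m : Fin (I.bound + 1)) :
    I.strategyAutomaton.dfa.step (I.state Y m) X = I.state X ⟨I.push Y m, I.push_lt _ _⟩ := by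
  simp only [strategyAutomaton, state, Fin.cases_succ, Equiv.symm_apply_apply]

theorem choice_strategyAutomaton_state (X : Fin I.n) (m : Fin (I.bound + 1)) :
    I.strategyAutomaton.choice (I.state X m) = I.choose X m := by
  simp only [strategyAutomaton, state, Fin.cases_succ, Equiv.symm_apply_apply]

/-- The control state after reading a configuration bottom-up consists of its top symbol and the rank
of the stack below that symbol. -/
theorem eval_strategyAutomaton (X : Fin I.n) (α : List (Fin I.n)) :
    I.strategyAutomaton.dfa.eval (X :: α).reverse =
      I.state X ⟨I.height α, Nat.lt_succ_of_le (height_le α)⟩ := by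
  induction α generalizing X with
  | nil => exact I.step_strategyAutomaton_zero X
  | cons Y α ih =>
    rw [List.reverse_cons, DFA.eval_append_singleton, ih, step_strategyAutomaton_state]
    rfl

theorem describes_boxStrategy : I.strategyAutomaton.Describes I.boxStrategy := by
  intro w X α h
  rw [eval_strategyAutomaton, choice_strategyAutomaton_state]
  rfl

theorem isRegular_boxStrategy : BPAGame.IsRegular I.boxStrategy := by
  refine ⟨Fin I.strategyAutomaton.k, inferInstance, I.strategyAutomaton.dfa,
    fun q => PMF.pure (I.strategyAutomaton.choice q), fun w X α h => ?_⟩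
  rw [PMF.pure_map]
  exact I.describes_boxStrategy w X α h

theorem isGivenByTable_diamondStrategy : BPAGame.IsGivenByTable I.table I.diamondStrategy :=
  fun _ _ _ _ => rfl

end BPAInstance

/-- The encoding of the control state with the number `s` of `BPAInstance.strategyAutomaton`, in
terms of the data of an instance; `m` is the rank of the stack read so far. -/
def printState (D : List SymbolData) (s m : ℕ) : List Tok :=
  Encode.nat s ++ [Tok.bit false] ++
    Encode.list (fun X => Encode.nat (X + D.length * m + 1)) (List.range D.length)

/-- The encoding of `BPAInstance.strategyAutomaton` in terms of the data of an instance. -/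
def printStrategy (D : List SymbolData) : List Tok :=
  Encode.nat 0 ++
    Encode.list id (stateList D.length (D.length + D.length)
      (printState D 0 (D.length + D.length))
      fun X m => printState D (X + D.length * m + 1) (pushOf D X m)) ++
    Encode.list id (stateList D.length (D.length + D.length) (Encode.list Encode.nat [])
      fun X m => Encode.list Encode.nat (chooseOf D X m))

/-- The encoding of the table of the strategy of `◇` in terms of the data of an instance. -/
def printTable (D : List SymbolData) : List Tok :=
  Encode.list (fun X => Encode.list Encode.nat (tableOf D X)) (List.range D.length)

theorem encode_strategyAutomaton (I : BPAInstance) :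
    Encode.strategy I.strategyAutomaton = printStrategy I.data := by
  classical
  have hs (s m : ℕ) (hm : m < I.bound + 1) :
      Encode.nat s ++ [Tok.bit false] ++
        Encode.list (fun X => Encode.nat (I.state X ⟨m, hm⟩)) (List.finRange I.n) =
      printState I.data s m := by
    rw [printState, I.length_data, ← Encode.list_finRange]
    rfl
  have ha (q) : decide (q ∈ I.strategyAutomaton.dfa.accept) = false := decide_eq_false fun h => h
  unfold Encode.strategy Encode.dfa printStrategy
  rw [I.length_data]
  simp only [ha]
  congr 1
  · congr 1
    refine Encode.list_eq_list_id (map_finRange_eq_stateList ?_ fun m X => ?_)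
    · exact hs 0 I.bound (Nat.lt_succ_self _)
    · rw [I.pushOf_data, ← hs _ _ (I.push_lt X m)]
      simp only [← I.step_strategyAutomaton_state]
      rfl
  · refine Encode.list_eq_list_id (map_finRange_eq_stateList ?_ fun m X => ?_)
    · rfl
    · rw [encode_word, I.chooseOf_data, ← I.choice_strategyAutomaton_state]
      rfl

theorem encode_table (I : BPAInstance) : Encode.table I.table = printTable I.data := by
  rw [Encode.table, printTable, I.length_data, ← Encode.list_finRange]
  congr 1
  funext X
  rw [encode_word, I.tableOf_data]

theorem polyTime_printTable : PolyTime printTable := by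
  unfold printTable
  fun_prop

section

-- `fun_prop` is to apply the lemmas on these functions instead of unfolding them
attribute [local irreducible] Encode.nat Encode.list chooseOf pushOf

theorem polyTime_printStrategy : PolyTime printStrategy := by
  have hp : PolyTime fun x : List SymbolData × ℕ × ℕ => printState x.1 x.2.1 x.2.2 := by
    unfold printState
    fun_prop
  have h₀ : PolyTime fun D : List SymbolData => printState D 0 (D.length + D.length) :=
    hp.comp (f := fun D : List SymbolData => (D, 0, D.length + D.length)) (by fun_prop)
  have h₁ : PolyTime fun p : (List SymbolData × ℕ) × ℕ =>
      printState p.1.1 (p.2 + p.1.1.length * p.1.2 + 1) (pushOf p.1.1 p.2 p.1.2) :=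
    hp.comp (f := fun p : (List SymbolData × ℕ) × ℕ =>
      (p.1.1, p.2 + p.1.1.length * p.1.2 + 1, pushOf p.1.1 p.2 p.1.2)) (by fun_prop)
  have h₂ := PolyTime.stateList (n := fun D : List SymbolData => D.length)
    (N := fun D => D.length + D.length)
    (f := fun D X m => printState D (X + D.length * m + 1) (pushOf D X m))
    (by fun_prop) (by fun_prop) h₀ h₁
  have h₃ := PolyTime.stateList (n := fun D : List SymbolData => D.length)
    (N := fun D => D.length + D.length) (x := fun _ => Encode.list Encode.nat [])
    (f := fun D X m => Encode.list Encode.nat (chooseOf D X m))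
    (by fun_prop) (by fun_prop) (by fun_prop) (by fun_prop)
  unfold printStrategy
  exact ((PolyTime.const _).append (.encodeList (e := fun _ => id) (by fun_prop) h₂)).append
    (.encodeList (e := fun _ => id) (by fun_prop) h₃)

end

theorem mainTheorem3 :
    -- membership in the two winning regions is decidable in polynomial time
    PolyTimeDecidable Encode.instConfig (fun x => x.2 ∈ x.1.WBox) ∧
    PolyTimeDecidable Encode.instConfig (fun x => x.2 ∈ x.1.WDiamond) ∧
    -- both regions are regular, with automata computable in polynomial time
    (∃ M : ∀ I : BPAInstance, FinDFA (Fin I.n),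
      PolyTimeComputable Encode.inst (fun I => Encode.dfa (M I)) ∧
      ∀ I, {α | α ∈ (M I).dfa.accepts} = I.WBox) ∧
    (∃ M : ∀ I : BPAInstance, FinDFA (Fin I.n),
      PolyTimeComputable Encode.inst (fun I => Encode.dfa (M I)) ∧
      ∀ I, {α | α ∈ (M I).dfa.accepts} = I.WDiamond) ∧
    -- a regular strategy of `□`, computable in polynomial time, that wins on the whole region
    (∃ A : ∀ I : BPAInstance, StrategyAutomaton (Fin I.n),
      PolyTimeComputable Encode.inst (fun I => Encode.strategy (A I)) ∧
      ∀ I, ∃ σ : I.Δ.game.Strategy Owner.box,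
        BPAGame.IsRegular σ ∧ (A I).Describes σ ∧
        ∀ α ∈ I.WBox, StochasticGame.WinningPos I.T σ α) ∧
    -- an SMD strategy of `◇`, computable in polynomial time, that wins on the whole region
    (∃ c : ∀ I : BPAInstance, Fin I.n → List (Fin I.n),
      PolyTimeComputable Encode.inst (fun I => Encode.table (c I)) ∧
      ∀ I, ∃ π : I.Δ.game.Strategy Owner.diamond,
        BPAGame.IsSMD π ∧ BPAGame.IsGivenByTable (c I) π ∧
        ∀ α ∈ I.WDiamond, StochasticGame.WinningZero I.T π α) := by
  have hI (I : BPAInstance) : toCode I = toCode (Encode.inst I) := rfl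
  have hx (x : Σ I : BPAInstance, List (Fin I.n)) : toCode x = toCode (Encode.instConfig x) := rfl
  have hr (b : Bool) : PolyTime fun I => Encode.dfa ⟨3, BPAInstance.regionDFA I b⟩ :=
    ((polyTime_printRegion b).comp polyTime_data).congr fun I => (encode_regionDFA b I).symm
  have hw : PolyTime fun x : Σ I : BPAInstance, List (Fin I.n) => wins x.1.sat false x.2 := by
    have h₁ := polyTime_data_fst
    have h₂ := polyTime_config
    exact (PolyTime.wins_lookup (PolyTime.satTab h₁) (.const false) h₂).congr fun x =>
      wins_map x.1.lookup_satTab _ _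
  refine ⟨PolyTime.decidable hx hw fun x => ?_, PolyTime.decidable hx hw.not fun x => ?_,
    ⟨fun I => ⟨3, I.regionDFA true⟩, PolyTime.computable hI (hr true), fun I => ?_⟩,
    ⟨fun I => ⟨3, I.regionDFA false⟩, PolyTime.computable hI (hr false), fun I => ?_⟩,
    ⟨fun I => I.strategyAutomaton, PolyTime.computable hI
      ((polyTime_printStrategy.comp polyTime_data).congr fun I =>
        (encode_strategyAutomaton I).symm),
      fun I => ⟨I.boxStrategy, I.isRegular_boxStrategy, I.describes_boxStrategy, fun α hα => ?_⟩⟩,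
    ⟨fun I => I.table, PolyTime.computable hI
      ((polyTime_printTable.comp polyTime_data).congr fun I => (encode_table I).symm),
      fun I => ⟨I.diamondStrategy, ⟨_, I.isGivenByTable_diamondStrategy⟩,
        I.isGivenByTable_diamondStrategy, fun α hα => ?_⟩⟩⟩
  · rw [BPAInstance.WBox_eq]
    rfl
  · rw [BPAInstance.WDiamond_eq, Bool.not_eq_true']
    rfl
  · rw [I.WBox_eq]
    exact Set.ext (I.mem_accepts_regionDFA true)
  · rw [I.WDiamond_eq]
    exact Set.ext (I.mem_accepts_regionDFA false)
  · rw [I.WBox_eq] at hα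
    exact BPAInstance.winningPos_boxStrategy hα
  · rw [I.WDiamond_eq] at hα
    exact I.winningZero_diamondStrategy hα
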